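/- **Setting.** Let $n\in\{2,3\}$, let $\Omega\subset\mathbb R^n$ be a bounded domain, and let $A:\Omega\to M_n(\mathbb R)$ be measurable, bounded, uniformly elliptic and a.e. symmetric. Write $\|\cdot\|$ and $(\cdot,\cdot)$ for the norm and inner product of $L^2(\Omega)$ or $L^2(\Omega)^n$, and $a(z,w)=\int_\Omega A\nabla z\cdot\nabla w\,dx$. Let $\alpha>0$, let $a,b\in[-\infty,+\infty]$, let $f,\overline y_d\in H^1(\Omega)$ and $\overline u_d\in H^2(\Omega)$, and put $\mathcal U_{ad}=\{u\in L^2(\Omega): a\le u\le b \text{ a.e.}\}$ and $P_{[a,b]}(s)=\min(b,\max(a,s))$. Let $(\overline y,\overline p,\overline u)\in H^1_0(\Omega)\times H^1_0(\Omega)\times\mathcal U_{ad}$ be a solution of the optimality system $$a(\overline y,w)=(f+\overline u,w)\ \text{ and }\ a(w,\overline p)=(\overline y-\overline y_d,w)\quad\forall w\in H^1_0(\Omega),\qquad (\overline p+\alpha(\overline u-\overline u_d),v-\overline u)\ge0\quad\forall v\in\mathcal U_{ad},$$ and suppose that $\overline y,\overline p\in H^2(\Omega)$. *Mesh.* Let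 $\mathcal T$ be a finite partition of $\Omega$ (up to cell boundaries) into open polygonal/polyhedral cells $K$, each star-shaped with respect to its centroid $\overline x_K$. Let $h=\max_K\operatorname{diam}(K)$, let $\rho_K$ be the largest radius of a ball centred at $\overline x_K$ and contained in $K$, and suppose $\operatorname{diam}(K)/\rho_K\le\eta$ for all $K$. Let $\mathcal U_h$ be the space of functions that are constant on each cell, let $\mathcal U_{ad,h}=\mathcal U_{ad}\cap\mathcal U_h$, and let $\mathcal P_{\mathcal T}v$ be the function equal on each $K$ to the mean value of $v$ over $K$. *Gradient discretisation.* Let $\mathcal D=(X_{\mathcal D,0},\Pi_{\mathcal D},\nabla_{\mathcal D})$, where $X_{\mathcal D,0}$ is a finite-dimensional real vector space and $\Pi_{\mathcal D}:X_{\mathcal D,0}\to L^2(\Omega)$, $\nabla_{\mathcal D}:X_{\mathcal D,0}\to L^2(\Omega)^n$ are linear maps such that $\|\nabla_{\mathcal D}\cdot\|$ is a norm. Put $C_{\mathcal D}=\max_{w\ne0}\|\Pi_{\mathcal D}w\|/\|\nabla_{\mathcal D}w\|$ and $a_{\mathcal D}(v,w)=\int_\Omega A\nabla_{\mathcal D}v\cdot\nabla_{\mathcal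 D}w\,dx$. For $F\in L^2(\Omega)$, the scheme solution with source $F$ is the $\psi_{\mathcal D}\in X_{\mathcal D,0}$ such that $a_{\mathcal D}(\psi_{\mathcal D},w)=(F,\Pi_{\mathcal D}w)$ for all $w\in X_{\mathcal D,0}$. Let $(\overline y_{\mathcal D},\overline p_{\mathcal D},\overline u_h)\in X_{\mathcal D,0}\times X_{\mathcal D,0}\times\mathcal U_{ad,h}$ be a solution of $$a_{\mathcal D}(\overline y_{\mathcal D},w)=(f+\overline u_h,\Pi_{\mathcal D}w)\ \text{ and }\ a_{\mathcal D}(w,\overline p_{\mathcal D})=(\Pi_{\mathcal D}\overline y_{\mathcal D}-\overline y_d,\Pi_{\mathcal D}w)\quad\forall w\in X_{\mathcal D,0},$$ $$(\Pi_{\mathcal D}\overline p_{\mathcal D}+\alpha(\overline u_h-\overline u_d),v_h-\overline u_h)\ge0\quad\forall v_h\in\mathcal U_{ad,h}.$$ **Convention.** $X\lesssim Y$ means $X\le cY$ with $c$ depending only on $\Omega$, $A$ and an upper bound of $C_{\mathcal D}$; in $\lesssim_\eta$ the constant may also depend on $\eta$ (and, in the conclusion, on the constants hidden in the assumptions below).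 **Assumptions.** 1. To each $w\in H^2(\Omega)$ is attached a function $w_{\mathcal T}\in L^2(\Omega)$ such that: (i) if $w\in H^2(\Omega)\cap H^1_0(\Omega)$ solves $-\operatorname{div}(A\nabla w)=g$ with $g\in H^1(\Omega)$, and $w_{\mathcal D}$ is the scheme solution with source $g$, then $\|\Pi_{\mathcal D}w_{\mathcal D}-w_{\mathcal T}\|\lesssim h^2\|g\|_{H^1(\Omega)}$; (ii) for all $w\in H^2(\Omega)$ and $v\in X_{\mathcal D,0}$, $|(w-w_{\mathcal T},\Pi_{\mathcal D}v)|\lesssim h^2\|w\|_{H^2(\Omega)}\|\Pi_{\mathcal D}v\|$ and $\|\mathcal P_{\mathcal T}(w-w_{\mathcal T})\|\lesssim h^2\|w\|_{H^2(\Omega)}$. 2. $\|\Pi_{\mathcal D}v-\mathcal P_{\mathcal T}(\Pi_{\mathcal D}v)\|\lesssim h\|\nabla_{\mathcal D}v\|$ for all $v\in X_{\mathcal D,0}$. 3. There is $\delta>0$ such that, for every $F\in L^2(\Omega)$, the scheme solution $\psi_{\mathcal D}$ with source $F$ satisfies $\|\Pi_{\mathcal D}\psi_{\mathcal D}\|_{L^\infty(\Omega)}\le\delta\|F\|$.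 4. Let $\mathcal T_2$ be the set of cells $K$ on which $\overline u=a$ a.e., or $\overline u=b$ a.e., or $a<\overline u<b$ a.e.; let $\mathcal T_1=\mathcal T\setminus\mathcal T_2$ and $\Omega_{1,\mathcal T}=\operatorname{int}\big(\bigcup_{K\in\mathcal T_1}\overline K\big)$. Then $|\Omega_{1,\mathcal T}|\lesssim h$, and $\overline u$ belongs to the broken space $W^{1,\infty}(\mathcal T_1)$, whose norm is $\max_{K\in\mathcal T_1}\|\cdot\|_{W^{1,\infty}(K)}$. Define the post-processed controls $$\widetilde u=P_{[a,b]}\big(\mathcal P_{\mathcal T}\overline u_d-\alpha^{-1}\overline p_{\mathcal T}\big),\qquad \widetilde u_h=P_{[a,b]}\big(\mathcal P_{\mathcal T}\overline u_d-\alpha^{-1}\Pi_{\mathcal D}\overline p_{\mathcal D}\big).$$ **Theorem.** There exists $C$ depending only on $\alpha$ and $\delta$ such that $$\|\widetilde u-\widetilde u_h\|\lesssim_\eta C\,h^2\Big[\|\overline u\|_{W^{1,\infty}(\mathcal T_1)}+\mathcal F(a,b,\overline y_d,\overline u_d,f,\overline y,\overline p)\Big],$$ where $$\mathcal F(a,b,\overline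 y_d,\overline u_d,f,\overline y,\overline p)=\operatorname{minmod}(a,b)+\|\overline y_d\|_{H^1(\Omega)}+\|\overline u_d\|_{H^2(\Omega)}+\|f\|_{H^1(\Omega)}+\|\overline y\|_{H^2(\Omega)}+\|\overline p\|_{H^2(\Omega)},$$ with $\operatorname{minmod}(a,b)=0$ if $ab\le0$ and $\operatorname{minmod}(a,b)=\min(|a|,|b|)$ otherwise. -/

import Mathlib

open MeasureTheory
open scoped ENNReal ContDiff

noncomputable section

namespace OptControl

/-! ### Lebesgue and Sobolev spaces on a subset of `ℝⁿ` -/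

/-- `ℝⁿ` with the Euclidean norm. -/
abbrev E (n : ℕ) : Type := EuclideanSpace ℝ (Fin n)

/-- `L²(Ω)`, with Mathlib's norm and inner product. -/
abbrev L2 {n : ℕ} (Ω : Set (E n)) : Type := Lp ℝ 2 (volume.restrict Ω)

/-- `L²(Ω)ⁿ`, with the Hilbert norm `(∑ i, ‖G i‖²)^(1/2)`. -/
abbrev L2Vec {n : ℕ} (Ω : Set (E n)) : Type := PiLp 2 (fun _ : Fin n => L2 Ω)

/-- `φ ∈ C_c^∞(U)`. -/
def IsTestFunction {n : ℕ} (U : Set (E n)) (φ : E n → ℝ) : Prop :=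
  ContDiff ℝ ∞ φ ∧ HasCompactSupport φ ∧ tsupport φ ⊆ U

/-- The classical `i`-th partial derivative of `φ`. -/
def partialDeriv {n : ℕ} (i : Fin n) (φ : E n → ℝ) (x : E n) : ℝ :=
  fderiv ℝ φ x (EuclideanSpace.single i 1)

/-- `g` is the `i`-th weak partial derivative of `u` on `U`. Only used on open bounded sets `U`, for
`u` and `g` in `L²(U)` or in `L^∞(U)`. -/
def IsWeakPartial {n : ℕ} (U : Set (E n)) (i : Fin n) (u g : E n → ℝ) : Prop :=
  ∀ φ : E n → ℝ, IsTestFunction U φ →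
    ∫ x in U, u x * partialDeriv i φ x = -∫ x in U, g x * φ x

/-- `u ∈ W^{1,p}(U)`. -/
def MemW1 {n : ℕ} (p : ℝ≥0∞) (U : Set (E n)) (u : E n → ℝ) : Prop :=
  MemLp u p (volume.restrict U) ∧
    ∀ i : Fin n, ∃ g : Lp ℝ p (volume.restrict U), IsWeakPartial U i u g

open Classical in
/-- The `i`-th weak partial derivative of `u` on `U`, as an element of `L^p(U)`
(and `0` when there is none in `L^p(U)`). -/
def weakPartial {n : ℕ} (p : ℝ≥0∞) (U : Set (E n)) (i : Fin n) (u : E n → ℝ) :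
    Lp ℝ p (volume.restrict U) :=
  if h : ∃ g : Lp ℝ p (volume.restrict U), IsWeakPartial U i u g then h.choose else 0

/-- `v ∈ H¹(Ω)`. -/
def MemH1 {n : ℕ} {Ω : Set (E n)} (v : L2 Ω) : Prop := MemW1 2 Ω v

/-- The weak gradient of `v ∈ H¹(Ω)`. -/
def weakGrad {n : ℕ} {Ω : Set (E n)} (v : L2 Ω) : L2Vec Ω :=
  WithLp.toLp 2 (fun i => weakPartial 2 Ω i v)

/-- The `H¹(Ω)` norm. -/
def normH1 {n : ℕ} {Ω : Set (E n)} (v : L2 Ω) : ℝ :=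
  Real.sqrt (‖v‖ ^ 2 + ‖weakGrad v‖ ^ 2)

/-- `v ∈ H²(Ω)`. -/
def MemH2 {n : ℕ} {Ω : Set (E n)} (v : L2 Ω) : Prop :=
  MemH1 v ∧ ∀ i : Fin n, MemH1 (weakGrad v i)

/-- The `H²(Ω)` norm. -/
def normH2 {n : ℕ} {Ω : Set (E n)} (v : L2 Ω) : ℝ :=
  Real.sqrt (‖v‖ ^ 2 + ‖weakGrad v‖ ^ 2 + ∑ i, ‖weakGrad (weakGrad v i)‖ ^ 2)

/-- `v ∈ H¹₀(Ω)`: `v` belongs to the closure of `C_c^∞(Ω)` in `H¹(Ω)`. -/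
def MemH10 {n : ℕ} {Ω : Set (E n)} (v : L2 Ω) : Prop :=
  MemH1 v ∧ ∀ ε : ℝ, 0 < ε → ∃ φ : E n → ℝ, IsTestFunction Ω φ ∧
    eLpNorm (fun x => v x - φ x) 2 (volume.restrict Ω) ≤ ENNReal.ofReal ε ∧
    ∀ i : Fin n, eLpNorm (fun x => weakGrad v i x - partialDeriv i φ x) 2 (volume.restrict Ω)
      ≤ ENNReal.ofReal ε

/-- The `W^{1,∞}(U)` norm `max (‖u‖_∞, ‖∂₁u‖_∞, …, ‖∂ₙu‖_∞)`. -/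
def normW1Inf {n : ℕ} (U : Set (E n)) (u : E n → ℝ) : ℝ≥0∞ :=
  max (eLpNorm u ∞ (volume.restrict U))
    (⨆ i : Fin n, eLpNorm (weakPartial ∞ U i u) ∞ (volume.restrict U))

/-! ### The diffusion operator -/

/-- `A` is measurable, bounded, uniformly elliptic on `Ω`, and symmetric almost everywhere. -/
def IsDiffusionTensor {n : ℕ} (Ω : Set (E n)) (A : E n → Matrix (Fin n) (Fin n) ℝ) : Prop :=
  (∀ i j, AEMeasurable (fun x => A x i j) (volume.restrict Ω)) ∧
  (∃ M : ℝ, ∀ᵐ x ∂(volume.restrict Ω), ∀ i j, |A x i j| ≤ M) ∧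
  (∃ m : ℝ, 0 < m ∧ ∀ᵐ x ∂(volume.restrict Ω), ∀ ξ : Fin n → ℝ,
    m * ∑ i, ξ i ^ 2 ≤ ∑ i, ∑ j, A x i j * ξ j * ξ i) ∧
  (∀ᵐ x ∂(volume.restrict Ω), (A x).IsSymm)

/-- `∫_Ω A G · H`. -/
def diffusionForm {n : ℕ} {Ω : Set (E n)} (A : E n → Matrix (Fin n) (Fin n) ℝ)
    (G H : L2Vec Ω) : ℝ :=
  ∫ x in Ω, ∑ i, ∑ j, A x i j * G j x * H i x

/-- `w ∈ H¹₀(Ω)` is the weak solution of `-div(A∇w) = F` in `Ω`, `w = 0` on `∂Ω`. -/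
def IsWeakSolution {n : ℕ} {Ω : Set (E n)} (A : E n → Matrix (Fin n) (Fin n) ℝ)
    (F w : L2 Ω) : Prop :=
  MemH10 w ∧ ∀ v : L2 Ω, MemH10 v →
    diffusionForm A (weakGrad w) (weakGrad v) = inner ℝ F v

/-! ### Gradient discretisations -/

/-- A gradient discretisation for homogeneous Dirichlet conditions, with space of degrees of
freedom `X` (a real vector space, finite-dimensional in all uses). -/
structure GradDisc {n : ℕ} (Ω : Set (E n)) (X : Type*) [AddCommGroup X] [Module ℝ X] where
  /-- The function reconstruction `Π_D`. -/
  recon : X →ₗ[ℝ] L2 Ω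
  /-- The gradient reconstruction `∇_D`. -/
  grad : X →ₗ[ℝ] L2Vec Ω
  /-- `‖∇_D ·‖` is a norm. -/
  eq_zero_of_norm_grad : ∀ v : X, ‖grad v‖ = 0 → v = 0

section GradDisc

variable {n : ℕ} {Ω : Set (E n)} {X : Type*} [AddCommGroup X] [Module ℝ X]

/-- `C_D = max_{w ≠ 0} ‖Π_D w‖ / ‖∇_D w‖`. -/
def GradDisc.coercivityConst (D : GradDisc Ω X) : ℝ :=
  sSup {r : ℝ | ∃ w : X, w ≠ 0 ∧ r = ‖D.recon w‖ / ‖D.grad w‖}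

/-- `a_D(v, w) = ∫_Ω A ∇_D v · ∇_D w`. -/
def GradDisc.form (D : GradDisc Ω X) (A : E n → Matrix (Fin n) (Fin n) ℝ) (v w : X) : ℝ :=
  diffusionForm A (D.grad v) (D.grad w)

/-- `ψ` solves the gradient scheme for `-div(A∇ψ) = F` with homogeneous Dirichlet conditions. -/
def GradDisc.IsSchemeSolution (D : GradDisc Ω X) (A : E n → Matrix (Fin n) (Fin n) ℝ)
    (F : L2 Ω) (ψ : X) : Prop :=
  ∀ w : X, D.form A ψ w = inner ℝ F (D.recon w)

end GradDisc

/-! ### Meshes -/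

/-- Open polytopal (polygonal, polyhedral, …) set: a non-empty bounded open set whose boundary is
contained in a finite union of hyperplanes. -/
def IsPolytopal {n : ℕ} (K : Set (E n)) : Prop :=
  K.Nonempty ∧ IsOpen K ∧ Bornology.IsBounded K ∧
    ∃ S : Finset (E n × ℝ), (∀ s ∈ S, s.1 ≠ 0) ∧
      frontier K ⊆ ⋃ s ∈ S, {x : E n | inner ℝ s.1 x = s.2}

/-- The centroid (centre of gravity) of `K`. -/
def centroid {n : ℕ} (K : Set (E n)) : E n := ⨍ x in K, x

/-- `ρ_K`, the maximal radius of the balls centred at the centroid and contained in `K`. -/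
def inRadius {n : ℕ} (K : Set (E n)) : ℝ :=
  sSup {r : ℝ | 0 < r ∧ Metric.ball (centroid K) r ⊆ K}

/-- A mesh of `Ω`: a finite partition (up to the boundaries of the cells) into open polytopal cells
that are star-shaped with respect to their centroids. -/
structure Mesh {n : ℕ} (Ω : Set (E n)) where
  /-- The set of cells. -/
  cells : Finset (Set (E n))
  polytopal : ∀ K ∈ cells, IsPolytopal K
  subset : ∀ K ∈ cells, K ⊆ Ω
  disjoint : ∀ K ∈ cells, ∀ L ∈ cells, K ≠ L → Disjoint K L
  cover : ⋃ K ∈ cells, closure K = closure Ω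
  star : ∀ K ∈ cells, StarConvex ℝ (centroid K) K

section Mesh

variable {n : ℕ} {Ω : Set (E n)}

/-- The mesh size `h = max_K diam(K)`. -/
def Mesh.size (T : Mesh Ω) : ℝ := ⨆ K : T.cells, Metric.diam (K : Set (E n))

/-- Mesh regularity: `diam(K) / ρ_K ≤ η` for all cells `K`. -/
def Mesh.IsRegular (T : Mesh Ω) (η : ℝ) : Prop :=
  ∀ K ∈ T.cells, Metric.diam K / inRadius K ≤ η

/-- The projection of `v` on piecewise constant functions: on each cell, the mean value of `v`. -/
def Mesh.proj (T : Mesh Ω) (v : E n → ℝ) (x : E n) : ℝ :=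
  ∑ K ∈ T.cells, K.indicator (fun _ => ⨍ z in K, v z) x

/-- `v ∈ U_h`: `v` is constant on each cell. -/
def Mesh.IsPiecewiseConst (T : Mesh Ω) (v : L2 Ω) : Prop :=
  ∀ K ∈ T.cells, ∃ c : ℝ, ∀ᵐ x ∂(volume.restrict K), v x = c

/-- `K ∈ T₂`: the control `u` is fully active on `K` (`u = a` or `u = b`) or fully inactive on `K`
(`a < u < b`). -/
def IsUniformCell (a b : EReal) (u : E n → ℝ) (K : Set (E n)) : Prop :=
  (∀ᵐ x ∂(volume.restrict K), (u x : EReal) = a) ∨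
  (∀ᵐ x ∂(volume.restrict K), (u x : EReal) = b) ∨
  (∀ᵐ x ∂(volume.restrict K), a < (u x : EReal) ∧ (u x : EReal) < b)

/-- `T₁`, the set of cells that are not in `T₂`. -/
def Mesh.mixedCells (T : Mesh Ω) (a b : EReal) (u : E n → ℝ) : Set (Set (E n)) :=
  {K | K ∈ T.cells ∧ ¬ IsUniformCell a b u K}

/-- `Ω_{1,T}`, the interior of the union of the closures of the cells in `T₁`. -/
def Mesh.mixedRegion (T : Mesh Ω) (a b : EReal) (u : E n → ℝ) : Set (E n) :=
  interior (⋃ K ∈ T.mixedCells a b u, closure K)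

/-- `u ∈ W^{1,∞}(T₁)` (broken Sobolev space). -/
def Mesh.MemBrokenW1Inf (T : Mesh Ω) (a b : EReal) (u : E n → ℝ) : Prop :=
  ∀ K ∈ T.mixedCells a b u, MemW1 ∞ K u

/-- The broken norm of `W^{1,∞}(T₁)`: the maximum of the norms on the cells in `T₁`. -/
def Mesh.normBrokenW1Inf (T : Mesh Ω) (a b : EReal) (u : E n → ℝ) : ℝ :=
  (⨆ K ∈ T.mixedCells a b u, normW1Inf K u).toReal

end Mesh

/-! ### The control problem -/

section Control

variable {n : ℕ} {Ω : Set (E n)} {X : Type*} [AddCommGroup X] [Module ℝ X]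

/-- `P_{[a,b]}(s) = min(b, max(a, s))`, where `a` and `b` may be infinite. -/
def clip (a b : EReal) (s : ℝ) : ℝ := (min b (max a (s : EReal))).toReal

/-- `minmod(a, b)` is `0` if `ab ≤ 0`, and `min(|a|, |b|)` otherwise. -/
def minmod (a b : EReal) : ℝ := if a * b ≤ 0 then 0 else (min a.abs b.abs).toReal

/-- The admissible controls: `{u ∈ L²(Ω) : a ≤ u ≤ b a.e.}`. -/
def admissible (Ω : Set (E n)) (a b : EReal) : Set (L2 Ω) :=
  {u | ∀ᵐ x ∂(volume.restrict Ω), a ≤ (u x : EReal) ∧ (u x : EReal) ≤ b}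

/-- The discrete admissible controls `U_ad ∩ U_h`. -/
def discreteAdmissible (T : Mesh Ω) (a b : EReal) : Set (L2 Ω) :=
  {u | u ∈ admissible Ω a b ∧ T.IsPiecewiseConst u}

/-- `(y, p, u) ∈ H¹₀ × H¹₀ × U_ad` solves the optimality system of the control problem. (For the
adjoint equation `a(w, p) = (y - y_d, w)` the arguments of the form are in this order.) -/
def IsKKT (A : E n → Matrix (Fin n) (Fin n) ℝ) (α : ℝ) (a b : EReal) (f yd ud : L2 Ω)
    (y p u : L2 Ω) : Prop :=
  MemH10 y ∧ MemH10 p ∧ u ∈ admissible Ω a b ∧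
  (∀ w : L2 Ω, MemH10 w → diffusionForm A (weakGrad y) (weakGrad w) = inner ℝ (f + u) w) ∧
  (∀ w : L2 Ω, MemH10 w → diffusionForm A (weakGrad w) (weakGrad p) = inner ℝ (y - yd) w) ∧
  (∀ v ∈ admissible Ω a b, 0 ≤ inner ℝ (p + α • (u - ud)) (v - u))

/-- `(yD, pD, uh) ∈ X × X × U_{ad,h}` solves the gradient scheme for the optimality system. -/
def IsDiscreteKKT (A : E n → Matrix (Fin n) (Fin n) ℝ) (D : GradDisc Ω X) (T : Mesh Ω)
    (α : ℝ) (a b : EReal) (f yd ud : L2 Ω) (yD pD : X) (uh : L2 Ω) : Prop :=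
  uh ∈ discreteAdmissible T a b ∧
  (∀ w : X, D.form A yD w = inner ℝ (f + uh) (D.recon w)) ∧
  (∀ w : X, D.form A w pD = inner ℝ (D.recon yD - yd) (D.recon w)) ∧
  (∀ v ∈ discreteAdmissible T a b, 0 ≤ inner ℝ (D.recon pD + α • (uh - ud)) (v - uh))

/-! ### The assumptions of the estimate

`c` is the constant hidden in the symbol `≲` of the assumptions. -/

/-- Approximation and interpolation errors: `wT w` is the function `w_T ∈ L²(Ω)` attached to
`w ∈ H²(Ω)` (its values for `w ∉ H²(Ω)` are irrelevant). -/
def ApproxInterp (A : E n → Matrix (Fin n) (Fin n) ℝ) (D : GradDisc Ω X) (T : Mesh Ω)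
    (c : ℝ) (wT : L2 Ω → L2 Ω) : Prop :=
  (∀ (w g : L2 Ω) (wD : X), MemH2 w → MemH1 g → IsWeakSolution A g w →
    D.IsSchemeSolution A g wD → ‖D.recon wD - wT w‖ ≤ c * T.size ^ 2 * normH1 g) ∧
  (∀ w : L2 Ω, MemH2 w → ∀ v : X,
    |inner ℝ (w - wT w) (D.recon v)| ≤ c * T.size ^ 2 * normH2 w * ‖D.recon v‖) ∧
  (∀ w : L2 Ω, MemH2 w → eLpNorm (T.proj (w - wT w : L2 Ω)) 2 (volume.restrict Ω)
    ≤ ENNReal.ofReal (c * T.size ^ 2 * normH2 w))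

/-- `‖Π_D v - P_T(Π_D v)‖ ≤ c h ‖∇_D v‖` for all `v`. -/
def ReconProjBound (D : GradDisc Ω X) (T : Mesh Ω) (c : ℝ) : Prop :=
  ∀ v : X, eLpNorm (fun x => D.recon v x - T.proj (D.recon v) x) 2 (volume.restrict Ω)
    ≤ ENNReal.ofReal (c * T.size * ‖D.grad v‖)

/-- `‖Π_D ψ_D‖_{L^∞} ≤ δ ‖F‖` for the solution `ψ_D` of the gradient scheme with any source `F`. -/
def SchemeLinftyBound (A : E n → Matrix (Fin n) (Fin n) ℝ) (D : GradDisc Ω X) (δ : ℝ) : Prop :=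
  ∀ (F : L2 Ω) (ψ : X), D.IsSchemeSolution A F ψ →
    eLpNorm (D.recon ψ) ∞ (volume.restrict Ω) ≤ ENNReal.ofReal (δ * ‖F‖)

/-- `|Ω_{1,T}| ≤ c h` and `u ∈ W^{1,∞}(T₁)`. -/
def MixedRegionBound (T : Mesh Ω) (a b : EReal) (u : L2 Ω) (c : ℝ) : Prop :=
  volume (T.mixedRegion a b u) ≤ ENNReal.ofReal (c * T.size) ∧ T.MemBrokenW1Inf a b u

/-- The post-processed control `P_{[a,b]}(P_T u_d - α⁻¹ q)`. -/
def postProcessed (T : Mesh Ω) (α : ℝ) (a b : EReal) (ud q : L2 Ω) (x : E n) : ℝ :=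
  clip a b (T.proj ud x - α⁻¹ * q x)

/-- The data term
`minmod(a,b) + ‖y_d‖_{H¹} + ‖u_d‖_{H²} + ‖f‖_{H¹} + ‖y‖_{H²} + ‖p‖_{H²}`. -/
def dataTerm (a b : EReal) (yd ud f y p : L2 Ω) : ℝ :=
  minmod a b + normH1 yd + normH2 ud + normH1 f + normH2 y + normH2 p

end Control

end OptControl

end

/-!
The error of the post-processed controls is `α⁻¹` times the error `p_T - Π_D p_D` of the adjoint
state, because the projection `P` on `[a, b]` is a contraction. With `q = u_d - α⁻¹ p`, the
variational inequality says that the exact control is `u = P(q)`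
(`ae_eq_clip_of_variationalInequality`). Since `P` is a contraction, `u` belongs to `H¹(Ω)`
(`memH1_of_contraction`), so that `f + u` is an admissible source in the approximation property of
the scheme; this is where `minmod(a, b)` enters, through `|P(s)| ≤ |s| + minmod(a, b)`.

The adjoint error is split with the piecewise constant function `w = P(P_T q)`, the projection of
the cell averages of `q`, and with the scheme solutions for the controls `u` and `w`.

* For the control `u` itself the scheme is compared with the exact problem
  (`norm_recon_adjoint_sub_le`); the error of the state in the source of the adjoint equation is
  needed only weakly, against reconstructions.
* The replacement of `u` by `w` is estimated by duality (`norm_recon_sub_le_of_dual`). The part of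
  the dual solution that is not piecewise constant is `O(h)` and meets `‖u - w‖ ≤ ‖q - P_T q‖`,
  which is `O(h)` by the Poincaré inequality on star-shaped cells (`lintegral_sub_average_sq_le`).
  Against the piecewise constant part, the cells on which the control is fully active or fully
  inactive contribute nothing, as there `u` and `w` have the same mean value. On the other cells
  `|u - w|` is at most the oscillation of `u`, which is `O(h)`, and the measure of these cells is
  `O(h)` too (`Mesh.abs_inner_sub_projL2_le`).
* The discrete control satisfies a variational inequality against `w`, and `w` satisfies the
  variational characterization of the projection against the discrete control. In the sum of the two
  the remaining adjoint difference has a sign (`mul_norm_sub_le_of_discreteKKT`).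

The facts on weakly differentiable functions come from mollification (`exists_mollification`): an
estimate is proved for smooth functions by integration along segments and passes to the limit by
Fatou's lemma. The derivative of `P(q)` is produced by duality from bounded difference quotients.
-/

namespace OptControl

open Filter Topology
open scoped Convolution

variable {n : ℕ}

/-- Jensen's inequality for the square and a probability measure. -/
theorem lintegral_sq_le_of_isProbabilityMeasure {α : Type*} [MeasurableSpace α] (μ : Measure α)
    [IsProbabilityMeasure μ] {f : α → ℝ≥0∞} (hf : AEMeasurable f μ) :
    (∫⁻ x, f x ∂μ) ^ 2 ≤ ∫⁻ x, f x ^ 2 ∂μ := by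
  have h := ENNReal.lintegral_mul_le_Lp_mul_Lq μ Real.HolderConjugate.two_two hf
    (aemeasurable_const (b := (1 : ℝ≥0∞)))
  simp only [Pi.mul_apply, mul_one, lintegral_const, measure_univ, ENNReal.rpow_two, one_pow,
    ENNReal.one_rpow] at h
  calc (∫⁻ x, f x ∂μ) ^ 2 ≤ ((∫⁻ x, f x ^ 2 ∂μ) ^ (1 / 2 : ℝ)) ^ 2 := by gcongr
    _ = ∫⁻ x, f x ^ 2 ∂μ := by
      rw [← ENNReal.rpow_two, ← ENNReal.rpow_mul]; norm_num

/-! ### Mollification of weakly differentiable functions -/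

/-- Convolution with a mollifier is a contraction of `L²`. -/
theorem lintegral_normed_convolution_sq_le (φ : ContDiffBump (0 : E n)) {G : E n → ℝ}
    (hG : AEStronglyMeasurable G volume) :
    ∫⁻ x, ‖(φ.normed volume ⋆[ContinuousLinearMap.lsmul ℝ ℝ, volume] G) x‖ₑ ^ 2
      ≤ ∫⁻ x, ‖G x‖ₑ ^ 2 := by
  have hφm : Measurable fun t => ‖φ.normed volume t‖ₑ :=
    φ.continuous_normed.measurable.enorm
  have hφ1 : ∫⁻ t, ‖φ.normed volume t‖ₑ = 1 := by
    have h1 := φ.integral_normed (μ := volume)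
    have h2 := ofReal_integral_eq_lintegral_ofReal (φ.integrable_normed (μ := volume))
      (Eventually.of_forall fun x => φ.nonneg_normed x)
    rw [h1, ENNReal.ofReal_one] at h2
    rw [h2]
    refine lintegral_congr fun t => ?_
    rw [Real.enorm_eq_ofReal (φ.nonneg_normed t)]
  set ν : Measure (E n) := volume.withDensity fun t => ‖φ.normed volume t‖ₑ with hν
  have : IsProbabilityMeasure ν := ⟨by rw [hν, withDensity_apply _ MeasurableSet.univ]; simpa⟩
  have hνac : ν ≪ volume := withDensity_absolutelyContinuous _ _
  have hsub : ∀ x : E n, AEStronglyMeasurable (fun t => G (x - t)) volume := fun x =>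
    hG.comp_quasiMeasurePreserving (quasiMeasurePreserving_sub_left volume x)
  have hpt : ∀ x, ‖(φ.normed volume ⋆[ContinuousLinearMap.lsmul ℝ ℝ, volume] G) x‖ₑ ^ 2
      ≤ ∫⁻ t, ‖φ.normed volume t‖ₑ * ‖G (x - t)‖ₑ ^ 2 := by
    intro x
    have h1 : ‖(φ.normed volume ⋆[ContinuousLinearMap.lsmul ℝ ℝ, volume] G) x‖ₑ
        ≤ ∫⁻ t, ‖G (x - t)‖ₑ ∂ν := by
      rw [hν, lintegral_withDensity_eq_lintegral_mul₀ hφm.aemeasurable (hsub x).enorm]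
      refine (enorm_integral_le_lintegral_enorm _).trans (le_of_eq ?_)
      refine lintegral_congr fun t => ?_
      simp [enorm_mul]
    calc _ ≤ (∫⁻ t, ‖G (x - t)‖ₑ ∂ν) ^ 2 := by gcongr
      _ ≤ ∫⁻ t, ‖G (x - t)‖ₑ ^ 2 ∂ν :=
        lintegral_sq_le_of_isProbabilityMeasure ν ((hsub x).mono_ac hνac).enorm
      _ = _ := by
        rw [hν, lintegral_withDensity_eq_lintegral_mul₀ hφm.aemeasurable
          ((hsub x).enorm.pow_const 2)]
        rfl
  calc _ ≤ ∫⁻ x, ∫⁻ t, ‖φ.normed volume t‖ₑ * ‖G (x - t)‖ₑ ^ 2 := lintegral_mono hpt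
    _ = ∫⁻ t, ∫⁻ x, ‖φ.normed volume t‖ₑ * ‖G (x - t)‖ₑ ^ 2 := by
      refine lintegral_lintegral_swap (AEMeasurable.mul
        (f := fun p : E n × E n => ‖φ.normed volume p.2‖ₑ)
        (g := fun p : E n × E n => ‖G (p.1 - p.2)‖ₑ ^ 2) ?_ ?_)
      · exact (hφm.comp measurable_snd).aemeasurable
      · exact (hG.comp_quasiMeasurePreserving
          (quasiMeasurePreserving_sub volume volume)).enorm.pow_const 2
    _ = ∫⁻ t, ‖φ.normed volume t‖ₑ * ∫⁻ x, ‖G x‖ₑ ^ 2 := by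
      refine lintegral_congr fun t => ?_
      rw [lintegral_const_mul' _ _ enorm_ne_top,
        lintegral_sub_right_eq_self (fun x => ‖G x‖ₑ ^ 2) t]
    _ = _ := by rw [lintegral_mul_const _ hφm, hφ1, one_mul]

/-- Away from the boundary, mollification commutes with the weak derivative. -/
theorem partialDeriv_normed_convolution {U : Set (E n)} (hU : IsOpen U)
    (φ : ContDiffBump (0 : E n)) {i : Fin n} {u g : E n → ℝ}
    (hu : LocallyIntegrable (U.indicator u) volume) (h : IsWeakPartial U i u g) {x : E n}
    (hx : Metric.closedBall x φ.rOut ⊆ U) :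
    partialDeriv i (φ.normed volume ⋆[ContinuousLinearMap.lsmul ℝ ℝ, volume] (U.indicator u)) x
      = (φ.normed volume ⋆[ContinuousLinearMap.lsmul ℝ ℝ, volume] (U.indicator g)) x := by
  have hd := (φ.hasCompactSupport_normed (μ := volume)).hasFDerivAt_convolution_left
    (ContinuousLinearMap.lsmul ℝ ℝ) (φ.contDiff_normed (n := 1)) hu x
  set e : E n := EuclideanSpace.single i 1
  -- the translated and reflected mollifier is the test function
  set ψ : E n → ℝ := fun z => φ.normed volume (x - z) with hψ
  have hψd : ∀ z, partialDeriv i ψ z = - fderiv ℝ (φ.normed volume) (x - z) e := by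
    intro z
    have h1 : HasFDerivAt (φ.normed volume) (fderiv ℝ (φ.normed volume) (x - z)) (x - z) :=
      ((φ.contDiff_normed (n := 1)).differentiable one_ne_zero _).hasFDerivAt
    have h2 : HasFDerivAt ψ _ z := h1.comp z ((hasFDerivAt_id z).const_sub x)
    rw [partialDeriv, HasFDerivAt.fderiv h2]
    simp [e]
  have hψt : IsTestFunction U ψ := by
    have hs : tsupport ψ ⊆ Metric.closedBall x φ.rOut := by
      refine closure_minimal (fun z hz => ?_) Metric.isClosed_closedBall
      have : x - z ∈ Function.support (φ.normed volume) := hz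
      rw [φ.support_normed_eq, mem_ball_zero_iff] at this
      rw [Metric.mem_closedBall, dist_comm, dist_eq_norm]
      exact this.le
    refine ⟨φ.contDiff_normed.comp (contDiff_const.sub contDiff_id), ?_, hs.trans hx⟩
    exact (isCompact_closedBall x φ.rOut).of_isClosed_subset (isClosed_tsupport _) hs
  have key := h ψ hψt
  have hswap : ∀ (f w : E n → ℝ),
      ∫ t, f t * w (x - t) = ∫ z, f (x - z) * w z := by
    intro f w
    rw [← integral_sub_left_eq_self (fun z => f (x - z) * w z) volume x]
    simp
  have hL : partialDeriv i
      (φ.normed volume ⋆[ContinuousLinearMap.lsmul ℝ ℝ, volume] (U.indicator u)) x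
      = ∫ t, fderiv ℝ (φ.normed volume) t e * U.indicator u (x - t) := by
    rw [partialDeriv, hd.fderiv]
    have hex := ((φ.hasCompactSupport_normed (μ := volume)).fderiv ℝ).convolutionExists_left
      ((ContinuousLinearMap.lsmul ℝ ℝ).precompL (E n))
      ((φ.contDiff_normed (n := 1)).continuous_fderiv one_ne_zero) hu x
    rw [convolution, ContinuousLinearMap.integral_apply hex.integrable]
    rfl
  rw [hL, hswap]
  have hR : (φ.normed volume ⋆[ContinuousLinearMap.lsmul ℝ ℝ, volume] (U.indicator g)) x
      = ∫ z, φ.normed volume (x - z) * U.indicator g z := by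
    rw [← hswap]; rfl
  rw [hR]
  have e1 : ∀ (f w : E n → ℝ), ∫ z, f z * U.indicator w z = ∫ z in U, w z * f z := by
    intro f w
    rw [← integral_indicator hU.measurableSet]
    refine integral_congr_ae (Eventually.of_forall fun z => ?_)
    by_cases hz : z ∈ U <;> simp [hz, mul_comm]
  rw [e1, e1]
  have : ∫ z in U, u z * partialDeriv i ψ z
      = - ∫ z in U, u z * fderiv ℝ (φ.normed volume) (x - z) e := by
    simp_rw [hψd, mul_neg, integral_neg]
  rw [this] at key
  linarith [neg_inj.1 key]

theorem abs_normed_convolution_le (φ : ContDiffBump (0 : E n)) {G : E n → ℝ} {B : ℝ}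
    (hG : ∀ᵐ x, |G x| ≤ B) (x : E n) :
    |(φ.normed volume ⋆[ContinuousLinearMap.lsmul ℝ ℝ, volume] G) x| ≤ B := by
  have h1 : ∀ᵐ t, ‖φ.normed volume t • G (x - t)‖ ≤ φ.normed volume t * B := by
    have := (quasiMeasurePreserving_sub_left (volume : Measure (E n)) x).ae hG
    filter_upwards [this] with t ht
    rw [norm_smul, Real.norm_of_nonneg (φ.nonneg_normed t)]
    exact mul_le_mul_of_nonneg_left ht (φ.nonneg_normed t)
  have h2 := norm_integral_le_of_norm_le ((φ.integrable_normed (μ := volume)).mul_const B) h1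
  rw [integral_mul_const, φ.integral_normed, one_mul] at h2
  exact h2

/-- Local approximation of a weakly differentiable function by smooth functions, whose derivatives
obey the `L²` and the `L^∞` bounds of the weak derivatives. -/
theorem exists_mollification {U : Set (E n)} (hU : IsOpen U) {u : E n → ℝ}
    {g : Fin n → E n → ℝ} (hu : MemLp u 2 (volume.restrict U))
    (hg : ∀ i, MemLp (g i) 2 (volume.restrict U)) (h : ∀ i, IsWeakPartial U i u (g i)) :
    ∃ v : ℕ → E n → ℝ, (∀ k, ContDiff ℝ 1 (v k)) ∧
      (∀ᵐ x, x ∈ U → Tendsto (fun k => v k x) atTop (𝓝 (u x))) ∧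
      ∀ C, IsCompact C → C ⊆ U → ∀ᶠ k in atTop, ∀ i,
        (∫⁻ x in C, ‖partialDeriv i (v k) x‖ₑ ^ 2 ≤ ∫⁻ x in U, ‖g i x‖ₑ ^ 2) ∧
        ∀ B, (∀ᵐ x ∂(volume.restrict U), |g i x| ≤ B) → ∀ x ∈ C, |partialDeriv i (v k) x| ≤ B := by
  have hloc : LocallyIntegrable (U.indicator u) volume :=
    ((memLp_indicator_iff_restrict hU.measurableSet).2 hu).locallyIntegrable one_le_two
  let φ : ℕ → ContDiffBump (0 : E n) := fun k =>
    ⟨1 / (2 * ((k : ℝ) + 1)), 1 / ((k : ℝ) + 1), by positivity, by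
      apply one_div_lt_one_div_of_lt <;> nlinarith [(Nat.cast_nonneg k : (0 : ℝ) ≤ k)]⟩
  have hφ0 : Tendsto (fun k => (φ k).rOut) atTop (𝓝 0) := tendsto_one_div_add_atTop_nhds_zero_nat
  have hφ2 : ∀ᶠ k in atTop, (φ k).rOut ≤ 2 * (φ k).rIn := by
    refine Eventually.of_forall fun k => le_of_eq ?_
    change 1 / ((k : ℝ) + 1) = 2 * (1 / (2 * ((k : ℝ) + 1)))
    field_simp
  refine ⟨fun k => (φ k).normed volume ⋆[ContinuousLinearMap.lsmul ℝ ℝ, volume] (U.indicator u),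
    fun k => ?_, ?_, ?_⟩
  · exact ((φ k).hasCompactSupport_normed).contDiff_convolution_left _
      ((φ k).contDiff_normed (n := 1)) hloc
  · filter_upwards [ContDiffBump.ae_convolution_tendsto_right_of_locallyIntegrable hφ0 hφ2 hloc]
      with x hx hxU
    rwa [Set.indicator_of_mem hxU] at hx
  · intro C hC hCU
    obtain ⟨δ, hδ, hδU⟩ := hC.exists_cthickening_subset_open hU hCU
    filter_upwards [hφ0.eventually_lt_const hδ] with k hk i
    have hd : ∀ x ∈ C, partialDeriv i
        ((φ k).normed volume ⋆[ContinuousLinearMap.lsmul ℝ ℝ, volume] (U.indicator u)) x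
        = ((φ k).normed volume ⋆[ContinuousLinearMap.lsmul ℝ ℝ, volume] (U.indicator (g i))) x :=
      fun x hx => partialDeriv_normed_convolution hU (φ k) hloc (h i)
        ((Metric.closedBall_subset_closedBall hk.le).trans
          ((Metric.closedBall_subset_cthickening hx δ).trans hδU))
    constructor
    · calc _ = ∫⁻ x in C, ‖((φ k).normed volume ⋆[ContinuousLinearMap.lsmul ℝ ℝ, volume]
            (U.indicator (g i))) x‖ₑ ^ 2 :=
          setLIntegral_congr_fun hC.measurableSet fun x hx => by simp only [hd x hx]
        _ ≤ ∫⁻ x, ‖((φ k).normed volume ⋆[ContinuousLinearMap.lsmul ℝ ℝ, volume]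
            (U.indicator (g i))) x‖ₑ ^ 2 := setLIntegral_le_lintegral _ _
        _ ≤ ∫⁻ x, ‖U.indicator (g i) x‖ₑ ^ 2 := lintegral_normed_convolution_sq_le _
          ((memLp_indicator_iff_restrict hU.measurableSet).2 (hg i)).1
        _ = _ := by
          rw [← lintegral_indicator hU.measurableSet]
          refine lintegral_congr fun x => ?_
          by_cases hx : x ∈ U <;> simp [hx]
    · intro B hB x hx
      rw [hd x hx]
      refine abs_normed_convolution_le _ ?_ x
      rw [ae_restrict_iff' hU.measurableSet] at hB
      have hB0 : 0 ≤ B := by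
        have hpos : volume U ≠ 0 := (hU.measure_pos volume ⟨x, hCU hx⟩).ne'
        obtain ⟨z, hz⟩ := (frequently_ae_mem_iff.2 hpos).and_eventually hB |>.exists
        exact (abs_nonneg _).trans (hz.2 hz.1)
      filter_upwards [hB] with z hz
      by_cases hzU : z ∈ U
      · simpa [hzU] using hz hzU
      · simpa [hzU] using hB0

/-! ### Differences of a weakly differentiable function -/

theorem real_enorm_sq (r : ℝ) : ‖r‖ₑ ^ 2 = ENNReal.ofReal (r ^ 2) := by
  rw [Real.enorm_eq_ofReal_abs, ← ENNReal.ofReal_pow (abs_nonneg r), sq_abs]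

/-- The squared Euclidean norm of the classical gradient. -/
noncomputable def gradSq (v : E n → ℝ) (x : E n) : ℝ≥0∞ := ∑ i, ‖partialDeriv i v x‖ₑ ^ 2

theorem continuous_partialDeriv {v : E n → ℝ} (hv : ContDiff ℝ 1 v) (i : Fin n) :
    Continuous (partialDeriv i v) :=
  (hv.continuous_fderiv one_ne_zero).clm_apply continuous_const

theorem measurable_gradSq {v : E n → ℝ} (hv : ContDiff ℝ 1 v) : Measurable (gradSq v) :=
  Finset.measurable_sum _ fun i _ =>
    ((continuous_partialDeriv hv i).measurable.enorm.pow_const 2)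

theorem fderiv_apply_eq_sum (v : E n → ℝ) (x w : E n) :
    fderiv ℝ v x w = ∑ i, w i * partialDeriv i v x := by
  have hw : w = ∑ i, w i • (EuclideanSpace.single i (1 : ℝ) : E n) := by
    ext j
    simp [Finset.sum_apply, Pi.single_apply]
  conv_lhs => rw [hw]
  simp [partialDeriv]

theorem enorm_fderiv_apply_sq_le (v : E n → ℝ) (x w : E n) :
    ‖fderiv ℝ v x w‖ₑ ^ 2 ≤ ‖w‖ₑ ^ 2 * gradSq v x := by
  have h : (fderiv ℝ v x w) ^ 2 ≤ ‖w‖ ^ 2 * ∑ i, partialDeriv i v x ^ 2 := by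
    rw [fderiv_apply_eq_sum, EuclideanSpace.real_norm_sq_eq]
    exact Finset.sum_mul_sq_le_sq_mul_sq _ _ _
  calc ‖fderiv ℝ v x w‖ₑ ^ 2 ≤ ENNReal.ofReal (‖w‖ ^ 2 * ∑ i, partialDeriv i v x ^ 2) := by
        rw [real_enorm_sq]; exact ENNReal.ofReal_le_ofReal h
    _ = ‖w‖ₑ ^ 2 * gradSq v x := by
        rw [ENNReal.ofReal_mul (by positivity), ENNReal.ofReal_pow (norm_nonneg _), ofReal_norm,
          ENNReal.ofReal_sum_of_nonneg fun i _ => sq_nonneg _]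
        simp_rw [gradSq, real_enorm_sq]

theorem hasDerivAt_segment {v : E n → ℝ} (hv : ContDiff ℝ 1 v) (a b : E n) (t : ℝ) :
    HasDerivAt (fun t : ℝ => v (a + t • (b - a))) (fderiv ℝ v (a + t • (b - a)) (b - a)) t := by
  have h1 : HasDerivAt (fun t : ℝ => a + t • (b - a)) (b - a) t := by
    simpa using ((hasDerivAt_id t).smul_const (b - a)).const_add a
  exact ((hv.differentiable one_ne_zero _).hasFDerivAt).comp_hasDerivAt t h1

theorem enorm_sub_sq_le_lintegral_gradSq {v : E n → ℝ} (hv : ContDiff ℝ 1 v) (a b : E n) :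
    ‖v b - v a‖ₑ ^ 2
      ≤ ∫⁻ t in Set.Ioc (0 : ℝ) 1, ‖b - a‖ₑ ^ 2 * gradSq v (a + t • (b - a)) := by
  have hc : Continuous fun t : ℝ => fderiv ℝ v (a + t • (b - a)) (b - a) :=
    ((hv.continuous_fderiv one_ne_zero).comp (by fun_prop)).clm_apply continuous_const
  have h1 := intervalIntegral.integral_eq_sub_of_hasDerivAt
    (fun t _ => hasDerivAt_segment hv a b t) (hc.intervalIntegrable 0 1)
  simp only [one_smul, zero_smul, add_zero, add_sub_cancel] at h1
  rw [intervalIntegral.integral_of_le zero_le_one] at h1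
  have : IsProbabilityMeasure (volume.restrict (Set.Ioc (0 : ℝ) 1)) := ⟨by simp⟩
  calc ‖v b - v a‖ₑ ^ 2
      ≤ (∫⁻ t in Set.Ioc (0 : ℝ) 1, ‖fderiv ℝ v (a + t • (b - a)) (b - a)‖ₑ) ^ 2 := by
        rw [← h1]; gcongr; exact enorm_integral_le_lintegral_enorm _
    _ ≤ ∫⁻ t in Set.Ioc (0 : ℝ) 1, ‖fderiv ℝ v (a + t • (b - a)) (b - a)‖ₑ ^ 2 :=
        lintegral_sq_le_of_isProbabilityMeasure _ hc.measurable.enorm.aemeasurable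
    _ ≤ _ := lintegral_mono fun t => enorm_fderiv_apply_sq_le _ _ _

/-- The increment of a smooth function along a family of segments, estimated by the gradient at the
points of the segments with a common parameter. -/
theorem lintegral_increment_sq_le {Y : Type*} [MeasurableSpace Y] {μ : Measure Y} [SFinite μ]
    {v : E n → ℝ} (hv : ContDiff ℝ 1 v) {a b : Y → E n} (ha : Measurable a) (hb : Measurable b)
    {d : ℝ} (hd : ∀ᵐ z ∂μ, ‖b z - a z‖ ≤ d) {J : ℝ≥0∞}
    (hJ : ∀ t ∈ Set.Ioc (0 : ℝ) 1, ∫⁻ z, gradSq v (a z + t • (b z - a z)) ∂μ ≤ J) :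
    ∫⁻ z, ‖v (b z) - v (a z)‖ₑ ^ 2 ∂μ ≤ ENNReal.ofReal d ^ 2 * J := by
  have hm : Measurable fun p : Y × ℝ => gradSq v (a p.1 + p.2 • (b p.1 - a p.1)) :=
    (measurable_gradSq hv).comp ((ha.comp measurable_fst).add
      (measurable_snd.smul ((hb.comp measurable_fst).sub (ha.comp measurable_fst))))
  calc ∫⁻ z, ‖v (b z) - v (a z)‖ₑ ^ 2 ∂μ
      ≤ ∫⁻ z, ENNReal.ofReal d ^ 2 *
          (∫⁻ t in Set.Ioc (0 : ℝ) 1, gradSq v (a z + t • (b z - a z))) ∂μ := by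
        refine lintegral_mono_ae ?_
        filter_upwards [hd] with z hz
        refine (enorm_sub_sq_le_lintegral_gradSq hv (a z) (b z)).trans ?_
        rw [lintegral_const_mul' _ _ (by finiteness)]
        gcongr
        rw [← ofReal_norm]
        exact ENNReal.ofReal_le_ofReal hz
    _ = ENNReal.ofReal d ^ 2 *
          ∫⁻ z, (∫⁻ t in Set.Ioc (0 : ℝ) 1, gradSq v (a z + t • (b z - a z))) ∂μ :=
        lintegral_const_mul' _ _ (by finiteness)
    _ = ENNReal.ofReal d ^ 2 *
          ∫⁻ t in Set.Ioc (0 : ℝ) 1, ∫⁻ z, gradSq v (a z + t • (b z - a z)) ∂μ := by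
        rw [lintegral_lintegral_swap hm.aemeasurable]
    _ ≤ ENNReal.ofReal d ^ 2 * ∫⁻ t in Set.Ioc (0 : ℝ) 1, J := by
        gcongr 1
        exact setLIntegral_mono measurable_const hJ
    _ = ENNReal.ofReal d ^ 2 * J := by simp

/-- The contraction `x ↦ s x + w` increases integrals at most by the factor `s⁻ⁿ`. -/
theorem setLIntegral_comp_smul_add_le {F : E n → ℝ≥0∞} (hF : Measurable F) {Q C : Set (E n)}
    (hQ : MeasurableSet Q) (hC : MeasurableSet C) {s s₀ : ℝ} (hs₀ : 0 < s₀) (hs : s₀ ≤ s)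
    (w : E n) (h : ∀ x ∈ Q, s • x + w ∈ C) :
    ∫⁻ x in Q, F (s • x + w) ≤ ENNReal.ofReal ((s₀⁻¹) ^ n) * ∫⁻ x in C, F x := by
  have hs0 : 0 < s := hs₀.trans_le hs
  have hF' : Measurable (C.indicator F) := hF.indicator hC
  calc ∫⁻ x in Q, F (s • x + w) ≤ ∫⁻ x in Q, C.indicator F (s • x + w) :=
        setLIntegral_mono' hQ fun x hx => by rw [Set.indicator_of_mem (h x hx)]
    _ ≤ ∫⁻ x, C.indicator F (s • x + w) := setLIntegral_le_lintegral _ _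
    _ = ∫⁻ x, C.indicator F (x + w) ∂(Measure.map (s • ·) (volume : Measure (E n))) :=
        (lintegral_map (hF'.comp (measurable_id.add_const w)) (measurable_const_smul s)).symm
    _ = ENNReal.ofReal |(s ^ n)⁻¹| * ∫⁻ x, C.indicator F (x + w) := by
        rw [Measure.map_addHaar_smul _ hs0.ne', lintegral_smul_measure]
        simp
    _ = ENNReal.ofReal |(s ^ n)⁻¹| * ∫⁻ x in C, F x := by
        rw [lintegral_add_right_eq_self, lintegral_indicator hC]
    _ ≤ _ := by
        gcongr
        rw [abs_of_pos (by positivity), ← inv_pow]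
        gcongr

theorem lintegral_le_of_ae_tendsto {Y : Type*} [MeasurableSpace Y] {μ : Measure Y}
    {F : ℕ → Y → ℝ≥0∞} {f : Y → ℝ≥0∞} {B : ℝ≥0∞} (hF : ∀ k, AEMeasurable (F k) μ)
    (h : ∀ᵐ x ∂μ, Tendsto (fun k => F k x) atTop (𝓝 (f x)))
    (hB : ∀ᶠ k in atTop, ∫⁻ x, F k x ∂μ ≤ B) : ∫⁻ x, f x ∂μ ≤ B := by
  calc ∫⁻ x, f x ∂μ = ∫⁻ x, liminf (fun k => F k x) atTop ∂μ :=
        lintegral_congr_ae (h.mono fun x hx => hx.liminf_eq.symm)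
    _ ≤ liminf (fun k => ∫⁻ x, F k x ∂μ) atTop := lintegral_liminf_le' hF
    _ ≤ B := by
        refine liminf_le_of_le (by isBoundedDefault) fun b hb => ?_
        obtain ⟨k, h1, h2⟩ := (hb.and hB).exists
        exact h1.trans h2

theorem sum_lintegral_eq_lintegral_gradSq {v : E n → ℝ} (hv : ContDiff ℝ 1 v) (C : Set (E n)) :
    ∫⁻ x in C, gradSq v x = ∑ i, ∫⁻ x in C, ‖partialDeriv i v x‖ₑ ^ 2 :=
  lintegral_finsetSum _ fun i _ => (continuous_partialDeriv hv i).measurable.enorm.pow_const 2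

theorem tendsto_enorm_sub_sq {v w : ℕ → ℝ} {a b : ℝ} (hv : Tendsto v atTop (𝓝 a))
    (hw : Tendsto w atTop (𝓝 b)) :
    Tendsto (fun k => ‖v k - w k‖ₑ ^ 2) atTop (𝓝 (‖a - b‖ₑ ^ 2)) :=
  ((ENNReal.continuous_pow 2).tendsto _).comp ((hv.sub hw).enorm)

/-- Translating a weakly differentiable function by a small vector `w` changes it at most by
`‖w‖ ‖∇u‖` in `L²`, locally. -/
theorem exists_forall_lintegral_translate_sub_sq_le {U : Set (E n)} (hU : IsOpen U) {u : E n → ℝ}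
    {g : Fin n → E n → ℝ} (hu : MemLp u 2 (volume.restrict U))
    (hg : ∀ i, MemLp (g i) 2 (volume.restrict U)) (h : ∀ i, IsWeakPartial U i u (g i))
    {S : Set (E n)} (hS : IsCompact S) (hSU : S ⊆ U) :
    ∃ δ > 0, ∀ w : E n, ‖w‖ ≤ δ → (∀ x ∈ S, x + w ∈ U) ∧ ∫⁻ x in S, ‖u (x + w) - u x‖ₑ ^ 2
      ≤ ENNReal.ofReal ‖w‖ ^ 2 * ∑ i, ∫⁻ x in U, ‖g i x‖ₑ ^ 2 := by
  obtain ⟨δ, hδ, hδU⟩ := hS.exists_cthickening_subset_open hU hSU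
  refine ⟨δ, hδ, fun w hw => ?_⟩
  have hmem : ∀ x ∈ S, ∀ t : ℝ, |t| ≤ 1 → x + t • w ∈ Metric.cthickening δ S := by
    intro x hx t ht
    refine Metric.closedBall_subset_cthickening hx δ ?_
    rw [mem_closedBall_iff_norm, add_sub_cancel_left, norm_smul, Real.norm_eq_abs]
    calc |t| * ‖w‖ ≤ 1 * δ := by gcongr
      _ = δ := one_mul δ
  have hmem1 : ∀ x ∈ S, x + w ∈ U := fun x hx => by
    simpa using hδU (hmem x hx 1 (by simp))
  refine ⟨hmem1, ?_⟩
  obtain ⟨v, hv, hvu, hvb⟩ := exists_mollification hU hu hg h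
  have hC : IsCompact (Metric.cthickening δ S) := hS.cthickening
  refine lintegral_le_of_ae_tendsto (F := fun k x => ‖v k (x + w) - v k x‖ₑ ^ 2)
    (fun k => ?_) ?_ ?_
  · exact ((((hv k).continuous.comp (continuous_id.add continuous_const)).sub
      (hv k).continuous).measurable.enorm.pow_const 2).aemeasurable
  · rw [ae_restrict_iff' hS.measurableSet]
    filter_upwards [hvu, (measurePreserving_add_right volume w).quasiMeasurePreserving.ae hvu]
      with x h1 h2 hx
    exact tendsto_enorm_sub_sq (h2 (hmem1 x hx)) (h1 (hSU hx))
  · filter_upwards [hvb _ hC hδU] with k hk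
    refine lintegral_increment_sq_le (hv k) (a := fun x => x) (b := fun x => x + w) measurable_id
      (measurable_id.add_const w) (Eventually.of_forall fun x => by simp) fun t ht => ?_
    simp only [add_sub_cancel_left]
    have := setLIntegral_comp_smul_add_le (measurable_gradSq (hv k)) hS.measurableSet
      hC.measurableSet one_pos le_rfl (t • w) fun x hx => by
        rw [one_smul]; exact hmem x hx t (by rw [abs_of_pos ht.1]; exact ht.2)
    simp only [one_smul, inv_one, one_pow, ENNReal.ofReal_one, one_mul] at this
    refine this.trans ?_
    rw [sum_lintegral_eq_lintegral_gradSq (hv k)]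
    exact Finset.sum_le_sum fun i _ => (hk i).1

/-! ### Star-shaped sets -/

/-- The cone over a compact part `Q` of a star-shaped set, together with a closed ball. -/
theorem exists_isCompact_cone {K Q : Set (E n)} {x₀ : E n} (hK : StarConvex ℝ x₀ K)
    (hQ : IsCompact Q) (hQK : Q ⊆ K) {r : ℝ} (hr : Metric.closedBall x₀ r ⊆ K) :
    ∃ C, IsCompact C ∧ C ⊆ K ∧ Metric.closedBall x₀ r ⊆ C ∧
      ∀ x ∈ Q, ∀ s : ℝ, 0 ≤ s → s ≤ 1 → x₀ + s • (x - x₀) ∈ C := by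
  refine ⟨Metric.closedBall x₀ r ∪
    (fun p : ℝ × E n => x₀ + p.1 • (p.2 - x₀)) '' (Set.Icc 0 1 ×ˢ Q), ?_, ?_, ?_, ?_⟩
  · exact (isCompact_closedBall x₀ r).union
      ((isCompact_Icc.prod hQ).image (by fun_prop))
  · refine Set.union_subset hr ?_
    rintro _ ⟨⟨s, x⟩, ⟨hs, hx⟩, rfl⟩
    have := hK (hQK hx) (sub_nonneg.2 hs.2) hs.1 (by ring)
    convert this using 1
    simp only [smul_sub, sub_smul, one_smul]
    abel
  · exact Set.subset_union_left
  · intro x hx s h0 h1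
    exact Or.inr ⟨(s, x), ⟨⟨h0, h1⟩, hx⟩, rfl⟩

theorem sq_sub_le_three_mul (a b c d : ℝ) :
    ‖a - d‖ₑ ^ 2 ≤ 3 * (‖b - a‖ₑ ^ 2 + ‖c - b‖ₑ ^ 2 + ‖c - d‖ₑ ^ 2) := by
  simp only [real_enorm_sq]
  rw [← ENNReal.ofReal_add (sq_nonneg _) (sq_nonneg _),
    ← ENNReal.ofReal_add (by positivity) (sq_nonneg _),
    show (3 : ℝ≥0∞) = ENNReal.ofReal 3 by simp, ← ENNReal.ofReal_mul (by norm_num)]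
  refine ENNReal.ofReal_le_ofReal ?_
  nlinarith [sq_nonneg ((b - a) + (c - b)), sq_nonneg ((b - a) - (c - d)),
    sq_nonneg ((c - b) - (c - d)), sq_nonneg ((b - a) - (c - b)), sq_nonneg ((b - a) + (c - d)),
    sq_nonneg ((c - b) + (c - d))]

/-- Mean oscillation of a smooth function on a compact part `Q` of a star-shaped set. A point of `Q`
is first contracted by the factor `l` into a ball around the centre, and there two points are joined
by a segment. On the first half of a segment the integration variable is its starting point, on the
second half its end point, so that all changes of variables are contractions by a factor
of at least `l / 2`. -/
theorem lintegral_prod_sub_sq_le_of_contDiff {Q C : Set (E n)} {x₀ : E n} {d l : ℝ}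
    (hl : 0 < l) (hl1 : l ≤ 1) (hQ : MeasurableSet Q) (hC : MeasurableSet C)
    (hQd : ∀ x ∈ Q, ‖x - x₀‖ ≤ d) (hQd' : ∀ x ∈ Q, ∀ y ∈ Q, ‖x - y‖ ≤ d)
    (hball : Metric.closedBall x₀ (l * d) ⊆ C)
    (hcone : ∀ x ∈ Q, ∀ s : ℝ, 0 ≤ s → s ≤ 1 → x₀ + s • (x - x₀) ∈ C)
    {v : E n → ℝ} (hv : ContDiff ℝ 1 v) :
    ∫⁻ p : E n × E n, ‖v p.1 - v p.2‖ₑ ^ 2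
        ∂((volume.restrict Q).prod (volume.restrict Q))
      ≤ ENNReal.ofReal (9 * d ^ 2 * (2 / l) ^ n) * volume Q * ∫⁻ x in C, gradSq v x := by
  set μ := (volume : Measure (E n)).restrict Q with hμ
  set I := ∫⁻ x in C, gradSq v x with hI
  set m : E n → E n := fun x => x₀ + l • (x - x₀) with hm
  have hmm : Measurable m := by simp only [hm]; fun_prop
  have hF := measurable_gradSq hv
  set J := ENNReal.ofReal ((2 / l) ^ n) * volume Q * I with hJ
  have hl2 : 0 < l / 2 := by positivity
  have hinv : (l / 2)⁻¹ = 2 / l := by rw [inv_div]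
  have hQ1 : ∀ᵐ p ∂(μ.prod μ), p.1 ∈ Q :=
    Measure.quasiMeasurePreserving_fst.ae (ae_restrict_mem hQ)
  have hQ2 : ∀ᵐ p ∂(μ.prod μ), p.2 ∈ Q :=
    Measure.quasiMeasurePreserving_snd.ae (ae_restrict_mem hQ)
  -- integration first in the variable which is contracted by at least `l / 2`
  have hfst : ∀ (s : ℝ), l / 2 ≤ s → ∀ w : E n → E n, Measurable w →
      (∀ x ∈ Q, ∀ y ∈ Q, s • x + w y ∈ C) →
      ∫⁻ p, gradSq v (s • p.1 + w p.2) ∂(μ.prod μ) ≤ J := by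
    intro s hs w hw hmem
    have hms : Measurable fun p : E n × E n => gradSq v (s • p.1 + w p.2) :=
      hF.comp ((measurable_fst.const_smul s).add (hw.comp measurable_snd))
    rw [lintegral_prod_symm _ hms.aemeasurable]
    calc ∫⁻ y, ∫⁻ x, gradSq v (s • x + w y) ∂μ ∂μ
        ≤ ∫⁻ _ in Q, ENNReal.ofReal ((2 / l) ^ n) * I := by
          refine setLIntegral_mono' hQ fun y hy => ?_
          have := setLIntegral_comp_smul_add_le hF hQ hC hl2 hs (w y) fun x hx => hmem x hx y hy
          rwa [hinv] at this
      _ = J := by rw [setLIntegral_const, hJ]; ring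
  have hsnd : ∀ (s : ℝ), l / 2 ≤ s → ∀ w : E n → E n, Measurable w →
      (∀ x ∈ Q, ∀ y ∈ Q, s • y + w x ∈ C) →
      ∫⁻ p, gradSq v (s • p.2 + w p.1) ∂(μ.prod μ) ≤ J := by
    intro s hs w hw hmem
    rw [← lintegral_prod_swap]
    exact hfst s hs w hw fun x hx y hy => hmem y hy x hx
  have hcontr : ∀ t ∈ Set.Ioc (0 : ℝ) 1, l / 2 ≤ 1 - t + t * l ∧ 0 ≤ 1 - t + t * l ∧
      1 - t + t * l ≤ 1 := by
    rintro t ⟨h0, h1⟩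
    have : l ≤ 1 - t + t * l := by nlinarith
    refine ⟨by linarith, by linarith, by nlinarith⟩
  have hcontr' : ∀ (t : ℝ) (x : E n), x + t • (m x - x)
      = (1 - t + t * l) • x + (t * (1 - l)) • x₀ := by
    intro t x; simp only [hm]; module
  have hcontr'' : ∀ t ∈ Set.Ioc (0 : ℝ) 1, ∀ x ∈ Q,
      (1 - t + t * l) • x + (t * (1 - l)) • x₀ ∈ C := by
    intro t ht x hx
    have := hcone x hx _ (hcontr t ht).2.1 (hcontr t ht).2.2
    convert this using 1
    module
  have hmx : ∀ x ∈ Q, ‖m x - x‖ ≤ d := by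
    intro x hx
    have : m x - x = (-(1 - l)) • (x - x₀) := by simp only [hm]; module
    rw [this, norm_smul, norm_neg, Real.norm_of_nonneg (by linarith)]
    have := hQd x hx
    nlinarith [norm_nonneg (x - x₀)]
  have hball' : ∀ x ∈ Q, m x ∈ Metric.closedBall x₀ (l * d) := by
    intro x hx
    rw [mem_closedBall_iff_norm]
    simp only [hm, add_sub_cancel_left, norm_smul, Real.norm_of_nonneg hl.le]
    exact mul_le_mul_of_nonneg_left (hQd x hx) hl.le
  have h1 : ∫⁻ p, ‖v (m p.1) - v p.1‖ₑ ^ 2 ∂(μ.prod μ) ≤ ENNReal.ofReal d ^ 2 * J := by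
    refine lintegral_increment_sq_le hv (a := fun p : E n × E n => p.1) (b := fun p => m p.1)
      measurable_fst (hmm.comp measurable_fst) (hQ1.mono fun p hp => hmx _ hp) fun t ht => ?_
    simp only [hcontr']
    exact hfst _ (hcontr t ht).1 (fun _ => (t * (1 - l)) • x₀) measurable_const
      fun x hx y hy => hcontr'' t ht x hx
  have h3 : ∫⁻ p, ‖v (m p.2) - v p.2‖ₑ ^ 2 ∂(μ.prod μ) ≤ ENNReal.ofReal d ^ 2 * J := by
    refine lintegral_increment_sq_le hv (a := fun p : E n × E n => p.2) (b := fun p => m p.2)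
      measurable_snd (hmm.comp measurable_snd) (hQ2.mono fun p hp => hmx _ hp) fun t ht => ?_
    simp only [hcontr']
    exact hsnd _ (hcontr t ht).1 (fun _ => (t * (1 - l)) • x₀) measurable_const
      fun x hx y hy => hcontr'' t ht y hy
  have h2 : ∫⁻ p, ‖v (m p.2) - v (m p.1)‖ₑ ^ 2 ∂(μ.prod μ) ≤ ENNReal.ofReal d ^ 2 * J := by
    refine lintegral_increment_sq_le hv (a := fun p : E n × E n => m p.1) (b := fun p => m p.2)
      (hmm.comp measurable_fst) (hmm.comp measurable_snd) ?_ fun t ht => ?_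
    · filter_upwards [hQ1, hQ2] with p hp1 hp2
      have : m p.2 - m p.1 = l • (p.2 - p.1) := by simp only [hm]; module
      rw [this, norm_smul, Real.norm_of_nonneg hl.le]
      have := hQd' _ hp2 _ hp1
      nlinarith [norm_nonneg (p.2 - p.1)]
    have hseg : ∀ x ∈ Q, ∀ y ∈ Q, m x + t • (m y - m x) ∈ C := by
      intro x hx y hy
      refine hball ?_
      have := (convex_closedBall x₀ (l * d)) (hball' x hx) (hball' y hy) (sub_nonneg.2 ht.2)
        ht.1.le (by ring)
      convert this using 1
      module
    rcases le_total t (1 / 2) with h | h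
    · have e : ∀ x y : E n, m x + t • (m y - m x)
          = (l * (1 - t)) • x + ((l * t) • y + (1 - l) • x₀) := by
        intro x y; simp only [hm]; module
      simp only [e] at hseg ⊢
      exact hfst (l * (1 - t)) (by nlinarith) (fun y => (l * t) • y + (1 - l) • x₀) (by fun_prop)
        hseg
    · have e : ∀ x y : E n, m x + t • (m y - m x)
          = (l * t) • y + ((l * (1 - t)) • x + (1 - l) • x₀) := by
        intro x y; simp only [hm]; module
      simp only [e] at hseg ⊢
      exact hsnd (l * t) (by nlinarith) (fun y => (l * (1 - t)) • y + (1 - l) • x₀) (by fun_prop)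
        hseg
  have hvm : Measurable v := hv.continuous.measurable
  calc _ ≤ ∫⁻ p, 3 * (‖v (m p.1) - v p.1‖ₑ ^ 2 + ‖v (m p.2) - v (m p.1)‖ₑ ^ 2
          + ‖v (m p.2) - v p.2‖ₑ ^ 2) ∂(μ.prod μ) :=
        lintegral_mono fun p => sq_sub_le_three_mul _ _ _ _
    _ = 3 * (∫⁻ p, ‖v (m p.1) - v p.1‖ₑ ^ 2 ∂(μ.prod μ)
          + ∫⁻ p, ‖v (m p.2) - v (m p.1)‖ₑ ^ 2 ∂(μ.prod μ)
          + ∫⁻ p, ‖v (m p.2) - v p.2‖ₑ ^ 2 ∂(μ.prod μ)) := by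
        rw [lintegral_const_mul' _ _ (by simp), lintegral_add_left, lintegral_add_left]
        all_goals fun_prop
    _ ≤ 3 * (ENNReal.ofReal d ^ 2 * J + ENNReal.ofReal d ^ 2 * J + ENNReal.ofReal d ^ 2 * J) := by
        gcongr
    _ ≤ _ := by
        have hd2 : ENNReal.ofReal d ^ 2 ≤ ENNReal.ofReal (d ^ 2) := by
          rcases le_total 0 d with h | h
          · rw [ENNReal.ofReal_pow h]
          · simp [ENNReal.ofReal_of_nonpos h]
        calc _ = 9 * (ENNReal.ofReal d ^ 2 * J) := by ring
          _ ≤ 9 * (ENNReal.ofReal (d ^ 2) * J) := by gcongr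
          _ = _ := by
            rw [ENNReal.ofReal_mul (by positivity), ENNReal.ofReal_mul (by norm_num), hJ]
            simp only [ENNReal.ofReal_ofNat]
            ring

/-- Mean oscillation of a weakly differentiable function on a star-shaped open set that contains a
ball around the centre: the Poincaré inequality with a constant that depends on the ratio of the
diameter and the radius of the ball only. -/
theorem lintegral_prod_sub_sq_le {K : Set (E n)} (hK : IsOpen K) {x₀ : E n}
    (hx₀ : x₀ ∈ K) (hstar : StarConvex ℝ x₀ K) {d l : ℝ} (hl : 0 < l) (hl1 : l ≤ 1)
    (hd : ∀ x ∈ K, ∀ y ∈ K, ‖x - y‖ ≤ d) (hball : Metric.closedBall x₀ (l * d) ⊆ K)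
    {u : E n → ℝ} {g : Fin n → E n → ℝ} (hu : MemLp u 2 (volume.restrict K))
    (hg : ∀ i, MemLp (g i) 2 (volume.restrict K)) (h : ∀ i, IsWeakPartial K i u (g i)) :
    ∫⁻ p : E n × E n, ‖u p.1 - u p.2‖ₑ ^ 2
        ∂((volume.restrict K).prod (volume.restrict K))
      ≤ ENNReal.ofReal (9 * d ^ 2 * (2 / l) ^ n) * volume K *
        ∑ i, ∫⁻ x in K, ‖g i x‖ₑ ^ 2 := by
  obtain ⟨v, hv, hvu, hvb⟩ := exists_mollification hK hu hg h
  obtain ⟨F, hFc, hFK, hFU, hFm⟩ := hK.exists_iUnion_isClosed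
  have hbdd : Bornology.IsBounded K :=
    (Metric.isBounded_closedBall (x := x₀) (r := d)).subset fun x hx => by
      rw [mem_closedBall_iff_norm]; exact hd x hx x₀ hx₀
  have hcpt : ∀ j, IsCompact (F j) := fun j =>
    Metric.isCompact_of_isClosed_isBounded (hFc j) (hbdd.subset (hFK j))
  have hprod : ⋃ j, F j ×ˢ F j = K ×ˢ K := by
    rw [← hFU]; exact Set.iUnion_prod_of_monotone hFm hFm
  rw [Measure.prod_restrict, ← hprod,
    setLIntegral_iUnion_of_directed _ (Monotone.directed_le fun i j hij =>
      Set.prod_mono (hFm hij) (hFm hij))]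
  refine iSup_le fun j => ?_
  rw [← Measure.prod_restrict]
  set Q := F j
  have hQm : MeasurableSet Q := (hFc j).measurableSet
  obtain ⟨C, hCc, hCK, hCb, hCcone⟩ := exists_isCompact_cone hstar (hcpt j) (hFK j) hball
  have hvu' : ∀ᵐ x ∂(volume.restrict Q), Tendsto (fun k => v k x) atTop (𝓝 (u x)) := by
    rw [ae_restrict_iff' hQm]
    exact hvu.mono fun x hx hxQ => hx (hFK j hxQ)
  refine lintegral_le_of_ae_tendsto (F := fun k p => ‖v k p.1 - v k p.2‖ₑ ^ 2) (fun k => ?_) ?_ ?_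
  · have := (hv k).continuous.measurable
    fun_prop
  · filter_upwards [Measure.quasiMeasurePreserving_fst.ae hvu',
      Measure.quasiMeasurePreserving_snd.ae hvu'] with p h1 h2
    exact tendsto_enorm_sub_sq h1 h2
  · filter_upwards [hvb C hCc hCK] with k hk
    refine (lintegral_prod_sub_sq_le_of_contDiff hl hl1 hQm hCc.measurableSet
      (fun x hx => hd x (hFK j hx) x₀ hx₀) (fun x hx y hy => hd x (hFK j hx) y (hFK j hy))
      hCb hCcone (hv k)).trans ?_
    rw [sum_lintegral_eq_lintegral_gradSq (hv k)]
    gcongr ENNReal.ofReal _ * volume ?_ * ?_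
    · exact hFK j
    · exact Finset.sum_le_sum fun i _ => (hk i).1

/-- The Poincaré inequality on a star-shaped open set. -/
theorem lintegral_sub_average_sq_le {K : Set (E n)} (hK : IsOpen K) {x₀ : E n}
    (hx₀ : x₀ ∈ K) (hstar : StarConvex ℝ x₀ K) {d l : ℝ} (hl : 0 < l) (hl1 : l ≤ 1)
    (hd : ∀ x ∈ K, ∀ y ∈ K, ‖x - y‖ ≤ d) (hball : Metric.closedBall x₀ (l * d) ⊆ K)
    {u : E n → ℝ} {g : Fin n → E n → ℝ} (hu : MemLp u 2 (volume.restrict K))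
    (hg : ∀ i, MemLp (g i) 2 (volume.restrict K)) (h : ∀ i, IsWeakPartial K i u (g i)) :
    ∫⁻ x in K, ‖u x - ⨍ z in K, u z‖ₑ ^ 2
      ≤ ENNReal.ofReal (9 * d ^ 2 * (2 / l) ^ n) * ∑ i, ∫⁻ x in K, ‖g i x‖ₑ ^ 2 := by
  have hbdd : Bornology.IsBounded K :=
    (Metric.isBounded_closedBall (x := x₀) (r := d)).subset fun x hx => by
      rw [mem_closedBall_iff_norm]; exact hd x hx x₀ hx₀
  have hpos : volume K ≠ 0 := (hK.measure_pos volume ⟨x₀, hx₀⟩).ne'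
  have hfin : volume K ≠ ⊤ := hbdd.measure_lt_top.ne
  have : IsFiniteMeasure (volume.restrict K) := ⟨by simpa using hfin.lt_top⟩
  set ν : Measure (E n) := (volume K)⁻¹ • volume.restrict K with hν
  have hνp : IsProbabilityMeasure ν := ⟨by simp [hν, ENNReal.inv_mul_cancel hpos hfin]⟩
  have huint : Integrable u (volume.restrict K) := hu.integrable one_le_two
  have havg : ⨍ z in K, u z = ∫ z, u z ∂ν := by
    rw [average_eq', Measure.restrict_apply_univ]
  have huν : Integrable u ν := huint.smul_measure (ENNReal.inv_ne_top.2 hpos)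
  have hpt : ∀ x, ‖u x - ⨍ z in K, u z‖ₑ ^ 2 ≤ (volume K)⁻¹ * ∫⁻ y in K, ‖u x - u y‖ₑ ^ 2 := by
    intro x
    have e : u x - ⨍ z in K, u z = ∫ y, (u x - u y) ∂ν := by
      rw [integral_sub (integrable_const _) huν, havg]; simp
    calc _ ≤ (∫⁻ y, ‖u x - u y‖ₑ ∂ν) ^ 2 := by
          rw [e]; gcongr; exact enorm_integral_le_lintegral_enorm _
      _ ≤ ∫⁻ y, ‖u x - u y‖ₑ ^ 2 ∂ν := lintegral_sq_le_of_isProbabilityMeasure ν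
          (aestronglyMeasurable_const.sub huν.1).enorm
      _ = _ := by rw [hν, lintegral_smul_measure]; rfl
  calc _ ≤ ∫⁻ x in K, (volume K)⁻¹ * ∫⁻ y in K, ‖u x - u y‖ₑ ^ 2 := lintegral_mono hpt
    _ = (volume K)⁻¹ * ∫⁻ x in K, ∫⁻ y in K, ‖u x - u y‖ₑ ^ 2 :=
        lintegral_const_mul' _ _ (ENNReal.inv_ne_top.2 hpos)
    _ = (volume K)⁻¹ * ∫⁻ p : E n × E n, ‖u p.1 - u p.2‖ₑ ^ 2
        ∂((volume.restrict K).prod (volume.restrict K)) := by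
        rw [lintegral_prod]
        exact ((hu.1.comp_quasiMeasurePreserving Measure.quasiMeasurePreserving_fst).sub
          (hu.1.comp_quasiMeasurePreserving Measure.quasiMeasurePreserving_snd)).enorm.pow_const 2
    _ ≤ (volume K)⁻¹ * (ENNReal.ofReal (9 * d ^ 2 * (2 / l) ^ n) * volume K *
        ∑ i, ∫⁻ x in K, ‖g i x‖ₑ ^ 2) := by
        gcongr
        exact lintegral_prod_sub_sq_le hK hx₀ hstar hl hl1 hd hball hu hg h
    _ = ((volume K)⁻¹ * volume K) * (ENNReal.ofReal (9 * d ^ 2 * (2 / l) ^ n) *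
        ∑ i, ∫⁻ x in K, ‖g i x‖ₑ ^ 2) := by ring
    _ = _ := by rw [ENNReal.inv_mul_cancel hpos hfin, one_mul]

/-- The oscillation of a function with bounded weak gradient on a star-shaped open set. -/
theorem exists_ae_abs_sub_le {K : Set (E n)} (hK : IsOpen K) {x₀ : E n}
    (hx₀ : x₀ ∈ K) (hstar : StarConvex ℝ x₀ K) {d L : ℝ}
    (hd : ∀ x ∈ K, ‖x - x₀‖ ≤ d)
    {u : E n → ℝ} {g : Fin n → E n → ℝ} (hu : MemLp u 2 (volume.restrict K))
    (hg : ∀ i, MemLp (g i) 2 (volume.restrict K)) (h : ∀ i, IsWeakPartial K i u (g i))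
    (hgL : ∀ i, ∀ᵐ x ∂(volume.restrict K), |g i x| ≤ L) :
    ∃ s : ℝ, ∀ᵐ x ∂(volume.restrict K), |u x - s| ≤ 2 * (n * L * d) := by
  obtain ⟨v, hv, hvu, hvb⟩ := exists_mollification hK hu hg h
  have key : ∀ x ∈ K, ∀ᶠ k in atTop, |v k x - v k x₀| ≤ n * L * d := by
    intro x hx
    have hC : IsCompact (segment ℝ x₀ x) := by
      rw [segment_eq_image_lineMap]
      exact isCompact_Icc.image AffineMap.lineMap_continuous
    filter_upwards [hvb _ hC (hstar.segment_subset hx)] with k hk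
    have hb : ∀ z ∈ segment ℝ x₀ x, ‖fderiv ℝ (v k) z (x - x₀)‖ ≤ n * L * d := by
      intro z hz
      rw [fderiv_apply_eq_sum]
      calc _ ≤ ∑ i, ‖(x - x₀) i * partialDeriv i (v k) z‖ := norm_sum_le _ _
        _ ≤ ∑ _i : Fin n, d * L := by
          refine Finset.sum_le_sum fun i _ => ?_
          rw [norm_mul]
          exact mul_le_mul ((PiLp.norm_apply_le _ i).trans (hd x hx)) ((hk i).2 L (hgL i) z hz)
            (norm_nonneg _) ((norm_nonneg _).trans (hd x hx))
        _ = n * L * d := by simp; ring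
    have hder : ∀ t ∈ Set.Icc (0 : ℝ) 1, HasDerivWithinAt (fun t : ℝ => v k (x₀ + t • (x - x₀)))
        (fderiv ℝ (v k) (x₀ + t • (x - x₀)) (x - x₀)) (Set.Icc 0 1) t := fun t _ =>
      (hasDerivAt_segment (hv k) x₀ x t).hasDerivWithinAt
    have := norm_image_sub_le_of_norm_deriv_le_segment_01' hder fun t ht => hb _ (by
      rw [segment_eq_image']; exact ⟨t, ⟨ht.1, ht.2.le⟩, rfl⟩)
    simpa using this
  have hpos : volume K ≠ 0 := (hK.measure_pos volume ⟨x₀, hx₀⟩).ne'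
  obtain ⟨y, hyK, hy⟩ := (frequently_ae_mem_iff.2 hpos).and_eventually hvu |>.exists
  refine ⟨u y, ?_⟩
  rw [ae_restrict_iff' hK.measurableSet]
  filter_upwards [hvu] with x hx hxK
  refine le_of_tendsto ((hx hxK).sub (hy hyK)).abs ?_
  filter_upwards [key x hxK, key y hyK] with k h1 h2
  rw [abs_le] at h1 h2 ⊢
  constructor <;> linarith [h1.1, h1.2, h2.1, h2.2]

/-! ### Weak derivatives and the space `H¹` -/

theorem lintegral_enorm_sq_eq {Ω : Set (E n)} (f : L2 Ω) :
    ∫⁻ x in Ω, ‖f x‖ₑ ^ 2 = ENNReal.ofReal (‖f‖ ^ 2) := by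
  rw [ENNReal.ofReal_pow (norm_nonneg _), ofReal_norm, Lp.enorm_def,
    eLpNorm_eq_lintegral_rpow_enorm_toReal (by simp) (by simp)]
  simp only [ENNReal.toReal_ofNat, ENNReal.rpow_ofNat, one_div]
  rw [← ENNReal.rpow_two, ← ENNReal.rpow_mul]
  norm_num

theorem norm_sq_eq_sum_norm_sq {Ω : Set (E n)} (G : L2Vec Ω) : ‖G‖ ^ 2 = ∑ i, ‖G i‖ ^ 2 :=
  PiLp.norm_sq_eq_of_L2 _ G

theorem memLp_coe {Ω : Set (E n)} (f : L2 Ω) : MemLp f 2 (volume.restrict Ω) := Lp.memLp f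

namespace IsTestFunction

variable {U : Set (E n)} {φ ψ : E n → ℝ}

theorem memLp (h : IsTestFunction U φ) (p : ℝ≥0∞) (μ : Measure (E n))
    [IsFiniteMeasureOnCompacts μ] : MemLp φ p μ :=
  h.1.continuous.memLp_of_hasCompactSupport h.2.1

theorem continuous_partialDeriv (h : IsTestFunction U φ) (i : Fin n) :
    Continuous (partialDeriv i φ) :=
  OptControl.continuous_partialDeriv (h.1.of_le (by exact_mod_cast le_top)) i

theorem differentiable (h : IsTestFunction U φ) : Differentiable ℝ φ :=
  h.1.differentiable (by simp)

theorem tsupport_partialDeriv_subset (i : Fin n) (φ : E n → ℝ) :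
    tsupport (partialDeriv i φ) ⊆ tsupport φ := by
  refine closure_minimal (fun x hx => ?_) (isClosed_tsupport φ)
  refine support_fderiv_subset ℝ (fun h0 => hx ?_)
  simp [partialDeriv, h0]

theorem memLp_partialDeriv (h : IsTestFunction U φ) (i : Fin n) (p : ℝ≥0∞) (μ : Measure (E n))
    [IsFiniteMeasureOnCompacts μ] : MemLp (partialDeriv i φ) p μ :=
  (h.continuous_partialDeriv i).memLp_of_hasCompactSupport
    (h.2.1.of_isClosed_subset (isClosed_tsupport _) (tsupport_partialDeriv_subset i φ))

theorem mono {V : Set (E n)} (h : IsTestFunction U φ) (hUV : U ⊆ V) : IsTestFunction V φ :=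
  ⟨h.1, h.2.1, h.2.2.trans hUV⟩

end IsTestFunction

theorem partialDeriv_add {φ ψ : E n → ℝ} (hφ : Differentiable ℝ φ) (hψ : Differentiable ℝ ψ)
    (i : Fin n) : partialDeriv i (φ + ψ) = partialDeriv i φ + partialDeriv i ψ := by
  ext x; simp [partialDeriv, fderiv_add (hφ x) (hψ x)]

theorem partialDeriv_smul {φ : E n → ℝ} (hφ : Differentiable ℝ φ) (c : ℝ)
    (i : Fin n) : partialDeriv i (c • φ) = c • partialDeriv i φ := by
  ext x; simp [partialDeriv, fderiv_const_smul (hφ x) c]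

/-- The test functions on `U`, as a space of functions. -/
def testFunctions (U : Set (E n)) : Submodule ℝ (E n → ℝ) where
  carrier := {φ | IsTestFunction U φ}
  zero_mem' := ⟨contDiff_const, HasCompactSupport.zero, by simp [tsupport]⟩
  add_mem' {φ ψ} hφ hψ := by
    refine ⟨hφ.1.add hψ.1, hφ.2.1.add hψ.2.1, (tsupport_add φ ψ).trans ?_⟩
    exact Set.union_subset hφ.2.2 hψ.2.2
  smul_mem' c φ hφ := by
    refine ⟨contDiff_const.smul hφ.1, hφ.2.1.smul_left (f := fun _ => c), ?_⟩
    exact (tsupport_smul_subset_right (fun _ => c) φ).trans hφ.2.2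

namespace IsWeakPartial

variable {U V : Set (E n)} {i : Fin n} {u u' g g' : E n → ℝ}

theorem congr (h : IsWeakPartial U i u g) (hu : u =ᵐ[volume.restrict U] u')
    (hg : g =ᵐ[volume.restrict U] g') : IsWeakPartial U i u' g' := by
  intro φ hφ
  have h1 : ∫ x in U, u' x * partialDeriv i φ x = ∫ x in U, u x * partialDeriv i φ x :=
    integral_congr_ae (hu.mono fun x hx => by simp only [hx])
  have h2 : ∫ x in U, g' x * φ x = ∫ x in U, g x * φ x :=
    integral_congr_ae (hg.mono fun x hx => by simp only [hx])
  rw [h1, h2, h φ hφ]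

theorem mono (hU : MeasurableSet U) (hVU : V ⊆ U)
    (h : IsWeakPartial U i u g) : IsWeakPartial V i u g := by
  intro φ hφ
  have key : ∀ w ψ : E n → ℝ, tsupport ψ ⊆ V → ∫ x in V, w x * ψ x = ∫ x in U, w x * ψ x := by
    intro w ψ hψ
    refine (setIntegral_eq_of_subset_of_forall_sdiff_eq_zero hU hVU fun x hx => ?_).symm
    rw [image_eq_zero_of_notMem_tsupport fun hx' => hx.2 (hψ hx'), mul_zero]
  rw [key _ _ ((IsTestFunction.tsupport_partialDeriv_subset i φ).trans hφ.2.2),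
    key _ _ hφ.2.2, h φ (hφ.mono hVU)]

theorem add (h : IsWeakPartial U i u g) (h' : IsWeakPartial U i u' g')
    (hu : MemLp u 2 (volume.restrict U)) (hu' : MemLp u' 2 (volume.restrict U))
    (hg : MemLp g 2 (volume.restrict U)) (hg' : MemLp g' 2 (volume.restrict U)) :
    IsWeakPartial U i (u + u') (g + g') := by
  intro φ hφ
  have hd := hφ.memLp_partialDeriv i 2 (volume.restrict U)
  have hφ2 := hφ.memLp 2 (volume.restrict U)
  have h1 := integral_add (hu.integrable_mul hd) (hu'.integrable_mul hd)
  have h2 := integral_add (hg.integrable_mul hφ2) (hg'.integrable_mul hφ2)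
  simp only [Pi.mul_apply] at h1 h2
  simp only [Pi.add_apply, add_mul]
  rw [h1, h2, h φ hφ, h' φ hφ]
  ring

theorem smul (h : IsWeakPartial U i u g) (c : ℝ) : IsWeakPartial U i (c • u) (c • g) := by
  intro φ hφ
  simp only [Pi.smul_apply, smul_eq_mul, mul_assoc, integral_const_mul]
  rw [h φ hφ]
  ring

theorem ae_eq (hU : IsOpen U) (h : IsWeakPartial U i u g) (h' : IsWeakPartial U i u g')
    (hg : MemLp g 2 (volume.restrict U)) (hg' : MemLp g' 2 (volume.restrict U)) :
    g =ᵐ[volume.restrict U] g' := by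
  have hloc : LocallyIntegrableOn (g - g') U volume :=
    locallyIntegrableOn_of_locallyIntegrable_restrict
      ((hg.sub hg').locallyIntegrable one_le_two)
  have := hU.ae_eq_zero_of_integral_contDiff_smul_eq_zero hloc fun φ h1 h2 h3 => by
    have hφ : IsTestFunction U φ := ⟨h1, h2, h3⟩
    have hφ2 := hφ.memLp 2 (volume.restrict U)
    have e : ∫ x in U, (g - g') x * φ x = 0 := by
      have e0 := integral_sub (hg.integrable_mul hφ2) (hg'.integrable_mul hφ2)
      simp only [Pi.mul_apply] at e0
      simp only [Pi.sub_apply, sub_mul]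
      rw [e0]
      have e1 := h φ hφ
      have e2 := h' φ hφ
      linarith
    rw [← e, ← setIntegral_eq_integral_of_forall_compl_eq_zero (s := U) fun x hx => by
      rw [image_eq_zero_of_notMem_tsupport fun hx' => hx (h3 hx'), zero_smul]]
    exact integral_congr_ae (Eventually.of_forall fun x => by simp [mul_comm])
  rw [EventuallyEq, ae_restrict_iff' hU.measurableSet]
  filter_upwards [this] with x hx hxU
  exact sub_eq_zero.1 (hx hxU)

end IsWeakPartial

section H1

variable {Ω : Set (E n)}

theorem MemH1.isWeakPartial {v : L2 Ω} (h : MemH1 v) (i : Fin n) :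
    IsWeakPartial Ω i v (weakGrad v i) := by
  have hex := h.2 i
  change IsWeakPartial Ω i v (weakPartial 2 Ω i v)
  rw [weakPartial, dif_pos hex]
  exact hex.choose_spec

theorem weakGrad_apply_eq (hΩ : IsOpen Ω) {v g : L2 Ω} {i : Fin n} (h : IsWeakPartial Ω i v g) :
    weakGrad v i = g := by
  have hex : ∃ g : L2 Ω, IsWeakPartial Ω i v g := ⟨g, h⟩
  change weakPartial 2 Ω i v = g
  rw [weakPartial, dif_pos hex]
  exact Lp.ext (hex.choose_spec.ae_eq hΩ h (memLp_coe _) (memLp_coe _))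

theorem memH1_of_isWeakPartial {v : L2 Ω} {g : Fin n → L2 Ω}
    (h : ∀ i, IsWeakPartial Ω i v (g i)) : MemH1 v :=
  ⟨memLp_coe v, fun i => ⟨g i, h i⟩⟩

theorem isWeakPartial_add {v w : L2 Ω} (hv : MemH1 v) (hw : MemH1 w) (i : Fin n) :
    IsWeakPartial Ω i (v + w : L2 Ω) (weakGrad v i + weakGrad w i : L2 Ω) :=
  ((hv.isWeakPartial i).add (hw.isWeakPartial i) (memLp_coe _) (memLp_coe _) (memLp_coe _)
    (memLp_coe _)).congr (Lp.coeFn_add v w).symm (Lp.coeFn_add _ _).symm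

theorem isWeakPartial_smul {v : L2 Ω} (hv : MemH1 v) (c : ℝ) (i : Fin n) :
    IsWeakPartial Ω i (c • v : L2 Ω) (c • weakGrad v i : L2 Ω) :=
  ((hv.isWeakPartial i).smul c).congr (Lp.coeFn_smul c v).symm (Lp.coeFn_smul c _).symm

theorem MemH1.add {v w : L2 Ω} (hv : MemH1 v) (hw : MemH1 w) : MemH1 (v + w) :=
  memH1_of_isWeakPartial (isWeakPartial_add hv hw)

theorem MemH1.smul {v : L2 Ω} (hv : MemH1 v) (c : ℝ) : MemH1 (c • v) :=
  memH1_of_isWeakPartial (isWeakPartial_smul hv c)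

theorem weakGrad_add (hΩ : IsOpen Ω) {v w : L2 Ω} (hv : MemH1 v) (hw : MemH1 w) :
    weakGrad (v + w) = weakGrad v + weakGrad w := by
  ext1 i
  exact weakGrad_apply_eq hΩ (isWeakPartial_add hv hw i)

theorem weakGrad_smul (hΩ : IsOpen Ω) {v : L2 Ω} (hv : MemH1 v) (c : ℝ) :
    weakGrad (c • v) = c • weakGrad v := by
  ext1 i
  exact weakGrad_apply_eq hΩ (isWeakPartial_smul hv c i)

theorem norm_le_normH1 (v : L2 Ω) : ‖v‖ ≤ normH1 v :=
  Real.le_sqrt_of_sq_le (by nlinarith [sq_nonneg ‖weakGrad v‖])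

theorem norm_weakGrad_le_normH1 (v : L2 Ω) : ‖weakGrad v‖ ≤ normH1 v :=
  Real.le_sqrt_of_sq_le (by nlinarith [sq_nonneg ‖v‖])

theorem normH1_nonneg (v : L2 Ω) : 0 ≤ normH1 v := Real.sqrt_nonneg _

theorem normH2_nonneg (v : L2 Ω) : 0 ≤ normH2 v := Real.sqrt_nonneg _

theorem normH1_le_add (v : L2 Ω) : normH1 v ≤ ‖v‖ + ‖weakGrad v‖ :=
  Real.sqrt_le_iff.2 ⟨by positivity, by nlinarith [norm_nonneg v, norm_nonneg (weakGrad v)]⟩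

theorem normH1_le_normH2 (v : L2 Ω) : normH1 v ≤ normH2 v :=
  Real.sqrt_le_sqrt (le_add_of_nonneg_right (Finset.sum_nonneg fun _ _ => sq_nonneg _))

theorem normH1_add_le (hΩ : IsOpen Ω) {v w : L2 Ω} (hv : MemH1 v) (hw : MemH1 w) :
    normH1 (v + w) ≤ 2 * (normH1 v + normH1 w) := by
  have h := normH1_le_add (v + w)
  rw [weakGrad_add hΩ hv hw] at h
  linarith [norm_add_le v w, norm_add_le (weakGrad v) (weakGrad w), norm_le_normH1 v,
    norm_le_normH1 w, norm_weakGrad_le_normH1 v, norm_weakGrad_le_normH1 w]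

theorem normH1_smul (hΩ : IsOpen Ω) {v : L2 Ω} (hv : MemH1 v) (c : ℝ) :
    normH1 (c • v) = |c| * normH1 v := by
  rw [normH1, normH1, weakGrad_smul hΩ hv, norm_smul, norm_smul, Real.norm_eq_abs,
    mul_pow, mul_pow, ← mul_add, Real.sqrt_mul (sq_nonneg _), Real.sqrt_sq (abs_nonneg c)]

theorem MemH1.sub_smul {v w : L2 Ω} (hv : MemH1 v) (hw : MemH1 w) (t : ℝ) :
    MemH1 (v - t • w) := by
  rw [sub_eq_add_neg, ← neg_smul]
  exact hv.add (hw.smul (-t))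

theorem normH1_sub_smul_le (hΩ : IsOpen Ω) {v w : L2 Ω} (hv : MemH1 v) (hw : MemH1 w) (t : ℝ) :
    normH1 (v - t • w) ≤ 2 * (normH1 v + |t| * normH1 w) := by
  have h := normH1_add_le hΩ hv (hw.smul (-t))
  rwa [normH1_smul hΩ hw, abs_neg, neg_smul, ← sub_eq_add_neg] at h

end H1

/-! ### Lipschitz functions of `H¹` functions -/

/-- A linear functional that is bounded by a seminorm `‖T ·‖` with values in a Hilbert space is the
inner product of `T ·` with a fixed vector. -/
theorem exists_inner_eq_of_abs_le {M H : Type*} [AddCommGroup M] [Module ℝ M]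
    [NormedAddCommGroup H] [InnerProductSpace ℝ H] [CompleteSpace H] (T : M →ₗ[ℝ] H)
    (l : M →ₗ[ℝ] ℝ) {B : ℝ} (hB : 0 ≤ B) (h : ∀ m, |l m| ≤ B * ‖T m‖) :
    ∃ g : H, ‖g‖ ≤ B ∧ ∀ m, l m = inner ℝ g (T m) := by
  obtain ⟨s, hs⟩ := T.rangeRestrict.exists_rightInverse_of_surjective
    (LinearMap.range_rangeRestrict T)
  have hs' : ∀ z, T (s z) = z := fun z => congrArg Subtype.val (LinearMap.congr_fun hs z)
  have hb : ∀ z : LinearMap.range T, ‖(l ∘ₗ s) z‖ ≤ B * ‖z‖ := fun z => by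
    have := h (s z)
    rwa [hs'] at this
  obtain ⟨f, hf, hfn⟩ := exists_extension_norm_eq (LinearMap.range T)
    ((l ∘ₗ s).mkContinuous B hb)
  refine ⟨(InnerProductSpace.toDual ℝ H).symm f, ?_, fun m => ?_⟩
  · rw [LinearIsometryEquiv.norm_map, hfn]
    exact LinearMap.mkContinuous_norm_le _ hB _
  · rw [InnerProductSpace.toDual_symm_apply, hf ⟨T m, m, rfl⟩]
    change l m = l (s ⟨T m, m, rfl⟩)
    have h0 := h (m - s ⟨T m, m, rfl⟩)
    rw [map_sub, map_sub, hs', sub_self, norm_zero, mul_zero] at h0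
    exact sub_eq_zero.1 (abs_nonpos_iff.1 h0)

/-- Integration against the derivative of a test function, for a contraction `F` of an `H¹`
function. The derivative is replaced by a difference quotient, which is moved to `F ∘ v`. -/
theorem abs_integral_contraction_mul_partialDeriv_le {Ω : Set (E n)} (hΩ : IsOpen Ω)
    (hb : Bornology.IsBounded Ω) {v w : L2 Ω} (hv : MemH1 v) {F : ℝ → ℝ}
    (hF : ∀ s t, |F s - F t| ≤ |s - t|) (hw : ∀ᵐ x ∂(volume.restrict Ω), w x = F (v x))
    {φ : E n → ℝ} (hφ : IsTestFunction Ω φ) (i : Fin n) :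
    |∫ x in Ω, w x * partialDeriv i φ x| ≤
      ‖weakGrad v‖ * (eLpNorm φ 2 (volume.restrict Ω)).toReal := by
  set e : E n := EuclideanSpace.single i 1 with he
  have hen : ‖e‖ = 1 := by simp [he]
  set G : E n → ℝ := Ω.indicator fun x => F (v x) with hG
  have hΩm := hΩ.measurableSet
  have hfin : IsFiniteMeasure (volume.restrict Ω) := ⟨by simpa using hb.measure_lt_top⟩
  have hGi : Integrable G volume := by
    rw [hG, integrable_indicator_iff hΩm]
    exact ((memLp_coe w).integrable one_le_two).congr hw
  obtain ⟨C, hC⟩ := (hφ.1.lipschitzWith_of_hasCompactSupport hφ.2.1 (by simp))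
  obtain ⟨δ, hδ, hδb⟩ := exists_forall_lintegral_translate_sub_sq_le hΩ (memLp_coe v)
    (fun i => memLp_coe (weakGrad v i)) hv.isWeakPartial hφ.2.1 hφ.2.2
  -- the estimate for difference quotients
  have hquot : ∀ t : ℝ, |t| ≤ δ → |∫ x, G x * (φ (x - t • e) - φ x)| ≤
      |t| * (‖weakGrad v‖ * (eLpNorm φ 2 (volume.restrict Ω)).toReal) := by
    intro t ht
    obtain ⟨hmem, hint⟩ := hδb (t • e) (by rw [norm_smul, hen, mul_one]; exact ht)
    obtain ⟨R, hR⟩ := hφ.1.continuous.bounded_above_of_compact_support hφ.2.1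
    have hGφ : ∀ a : E n, Integrable (fun x => G x * φ (x - a)) volume := fun a =>
      hGi.mul_bdd (c := R) (hφ.1.continuous.comp
        (continuous_id.sub continuous_const)).aestronglyMeasurable
        (Eventually.of_forall fun x => hR _)
    have e0 : ∫ x, G x * (φ (x - t • e) - φ x) = ∫ x, (G (x + t • e) - G x) * φ x := by
      have h1 : ∫ x, G x * φ (x - t • e) = ∫ x, G (x + t • e) * φ x := by
        rw [← integral_add_right_eq_self (fun x => G x * φ (x - t • e)) (t • e)]
        simp
      have h2 : Integrable (fun x => G (x + t • e) * φ x) volume := by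
        have := (hGφ (t • e)).comp_add_right (t • e)
        simpa using this
      have h3 : Integrable (fun x => G x * φ x) volume := by simpa using hGφ 0
      simp only [mul_sub, sub_mul]
      rw [integral_sub (hGφ _) h3, integral_sub h2 h3, h1]
    have hK := hφ.2.1.isCompact
    have hKm : MeasurableSet (tsupport φ) := hK.measurableSet
    have hle : ‖∫ x, (G (x + t • e) - G x) * φ x‖ₑ ≤
        (∫⁻ x in tsupport φ, ‖v (x + t • e) - v x‖ₑ ^ 2) ^ (1 / 2 : ℝ) *
          (∫⁻ x in tsupport φ, ‖φ x‖ₑ ^ 2) ^ (1 / 2 : ℝ) := by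
      have hvm : AEStronglyMeasurable (fun x => v (x + t • e) - v x)
          (volume.restrict (tsupport φ)) := by
        refine AEStronglyMeasurable.sub ?_ ((memLp_coe v).1.mono_measure
          (Measure.restrict_mono hφ.2.2 le_rfl))
        refine (memLp_coe v).1.comp_quasiMeasurePreserving ?_
        refine ⟨measurable_add_const _, ?_⟩
        have hmp := measurePreserving_add_right (volume : Measure (E n)) (t • e)
        have := (hmp.restrict_image_emb
          (Homeomorph.addRight (t • e)).measurableEmbedding (tsupport φ)).map_eq
        exact this.absolutelyContinuous.trans (Measure.absolutelyContinuous_of_le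
          (Measure.restrict_mono (Set.image_subset_iff.2 hmem) le_rfl))
      calc _ ≤ ∫⁻ x, ‖(G (x + t • e) - G x) * φ x‖ₑ := enorm_integral_le_lintegral_enorm _
        _ = ∫⁻ x in tsupport φ, ‖(G (x + t • e) - G x) * φ x‖ₑ := by
            refine (setLIntegral_eq_of_support_subset ?_).symm
            intro x hx
            by_contra hx'
            exact hx (by simp [image_eq_zero_of_notMem_tsupport hx'])
        _ ≤ ∫⁻ x in tsupport φ, ‖v (x + t • e) - v x‖ₑ * ‖φ x‖ₑ := by
            refine setLIntegral_mono' hKm fun x hx => ?_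
            rw [enorm_mul]
            gcongr
            rw [hG, Set.indicator_of_mem (hmem x hx), Set.indicator_of_mem (hφ.2.2 hx),
              Real.enorm_eq_ofReal_abs, Real.enorm_eq_ofReal_abs]
            exact ENNReal.ofReal_le_ofReal (hF _ _)
        _ ≤ _ := by
            have := ENNReal.lintegral_mul_le_Lp_mul_Lq (volume.restrict (tsupport φ))
              Real.HolderConjugate.two_two hvm.enorm
              (hφ.1.continuous.measurable.enorm.aemeasurable)
            simpa only [ENNReal.rpow_two, Pi.mul_apply] using this
    have hφn : (∫⁻ x in tsupport φ, ‖φ x‖ₑ ^ 2) ^ (1 / 2 : ℝ)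
        ≤ eLpNorm φ 2 (volume.restrict Ω) := by
      rw [eLpNorm_eq_lintegral_rpow_enorm_toReal (by simp) (by simp)]
      simp only [ENNReal.toReal_ofNat, ENNReal.rpow_ofNat]
      gcongr
      exact hφ.2.2
    have hvn : (∫⁻ x in tsupport φ, ‖v (x + t • e) - v x‖ₑ ^ 2) ^ (1 / 2 : ℝ)
        ≤ ENNReal.ofReal (|t| * ‖weakGrad v‖) := by
      have h1 : ∑ i, ∫⁻ x in Ω, ‖weakGrad v i x‖ₑ ^ 2 = ENNReal.ofReal (‖weakGrad v‖ ^ 2) := by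
        rw [norm_sq_eq_sum_norm_sq, ENNReal.ofReal_sum_of_nonneg fun i _ => sq_nonneg _]
        simp_rw [lintegral_enorm_sq_eq]
      rw [h1, norm_smul, hen, mul_one, Real.norm_eq_abs, ← ENNReal.ofReal_pow (abs_nonneg t),
        ← ENNReal.ofReal_mul (by positivity), ← mul_pow] at hint
      calc _ ≤ (ENNReal.ofReal ((|t| * ‖weakGrad v‖) ^ 2)) ^ (1 / 2 : ℝ) := by gcongr
        _ = _ := by
          rw [ENNReal.ofReal_rpow_of_nonneg (by positivity) (by norm_num), ← Real.sqrt_eq_rpow,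
            Real.sqrt_sq (by positivity)]
    have hfinal := hle.trans (mul_le_mul' hvn hφn)
    rw [e0, ← mul_assoc]
    have hnt : eLpNorm φ 2 (volume.restrict Ω) ≠ ⊤ := (hφ.memLp 2 _).2.ne
    rw [← ENNReal.ofReal_toReal hnt, ← ENNReal.ofReal_mul (by positivity),
      Real.enorm_eq_ofReal_abs, ENNReal.ofReal_le_ofReal_iff (by positivity)] at hfinal
    exact hfinal
  -- passage to the limit
  have hlim : Tendsto (fun t : ℝ => ∫ x, G x * (t⁻¹ * (φ (x - t • e) - φ x))) (𝓝[≠] 0)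
      (𝓝 (∫ x, G x * (-partialDeriv i φ x))) := by
    refine tendsto_integral_filter_of_dominated_convergence (fun x => ‖G x‖ * C) ?_ ?_ ?_ ?_
    · refine Eventually.of_forall fun t => hGi.1.mul ?_
      have := hφ.1.continuous
      exact Continuous.aestronglyMeasurable (by fun_prop)
    · filter_upwards [self_mem_nhdsWithin] with t ht
      refine Eventually.of_forall fun x => ?_
      rw [norm_mul, norm_mul, norm_inv]
      gcongr
      have h1 := hC.dist_le_mul (x - t • e) x
      rw [dist_eq_norm, dist_eq_norm, sub_sub_cancel_left, norm_neg, norm_smul, hen, mul_one] at h1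
      have htp : 0 < ‖t‖ := norm_pos_iff.2 ht
      rw [inv_mul_le_iff₀ htp]
      linarith
    · exact hGi.norm.mul_const _
    · refine Eventually.of_forall fun x => ?_
      refine Tendsto.const_mul _ ?_
      have h1 : HasDerivAt (fun t : ℝ => x - t • e) (-e) 0 := by
        simpa using ((hasDerivAt_id (0 : ℝ)).smul_const e).const_sub x
      have h2 : HasFDerivAt φ (fderiv ℝ φ x) (x - (0 : ℝ) • e) := by
        rw [zero_smul, sub_zero]; exact (hφ.differentiable x).hasFDerivAt
      have h3 := (h2.comp_hasDerivAt (0 : ℝ) h1).tendsto_slope_zero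
      simpa [partialDeriv, he] using h3
  have hbound : |∫ x, G x * (-partialDeriv i φ x)|
      ≤ ‖weakGrad v‖ * (eLpNorm φ 2 (volume.restrict Ω)).toReal := by
    refine le_of_tendsto hlim.abs ?_
    have hnear : ∀ᶠ t : ℝ in 𝓝[≠] 0, |t| ≤ δ := by
      refine nhdsWithin_le_nhds ?_
      filter_upwards [Metric.closedBall_mem_nhds (0 : ℝ) hδ] with t ht
      simpa using ht
    filter_upwards [hnear, self_mem_nhdsWithin] with t ht ht0
    have htp : 0 < |t| := abs_pos.2 ht0
    have e1 : ∫ x, G x * (t⁻¹ * (φ (x - t • e) - φ x))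
        = t⁻¹ * ∫ x, G x * (φ (x - t • e) - φ x) := by
      rw [← integral_const_mul]
      exact integral_congr_ae (Eventually.of_forall fun x => by ring)
    rw [e1, abs_mul, abs_inv, inv_mul_le_iff₀ htp]
    exact hquot t ht
  have e2 : ∫ x, G x * (-partialDeriv i φ x) = - ∫ x in Ω, w x * partialDeriv i φ x := by
    rw [← integral_neg, ← integral_indicator hΩm]
    rw [ae_restrict_iff' hΩm] at hw
    refine integral_congr_ae ?_
    filter_upwards [hw] with x hx
    by_cases hxΩ : x ∈ Ω <;> simp [hG, hxΩ, hx]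
  rwa [e2, abs_neg] at hbound

/-- A contraction of the real line maps `H¹` functions to `H¹` functions. -/
theorem memH1_of_contraction {Ω : Set (E n)} (hΩ : IsOpen Ω) (hb : Bornology.IsBounded Ω)
    {v w : L2 Ω} (hv : MemH1 v) {F : ℝ → ℝ} (hF : ∀ s t, |F s - F t| ≤ |s - t|)
    (hw : ∀ᵐ x ∂(volume.restrict Ω), w x = F (v x)) :
    MemH1 w ∧ ∀ i, ‖weakGrad w i‖ ≤ ‖weakGrad v‖ := by
  have hfin : IsFiniteMeasure (volume.restrict Ω) := ⟨by simpa using hb.measure_lt_top⟩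
  have key : ∀ i, ∃ g : L2 Ω, ‖g‖ ≤ ‖weakGrad v‖ ∧ IsWeakPartial Ω i w g := by
    intro i
    have hmem : ∀ φ : testFunctions Ω, MemLp (φ : E n → ℝ) 2 (volume.restrict Ω) :=
      fun φ => IsTestFunction.memLp φ.2 2 _
    have hint : ∀ φ : testFunctions Ω,
        Integrable (fun x => w x * partialDeriv i φ x) (volume.restrict Ω) := fun φ =>
      (memLp_coe w).integrable_mul (IsTestFunction.memLp_partialDeriv φ.2 i 2 _)
    let T : testFunctions Ω →ₗ[ℝ] L2 Ω :=
      { toFun := fun φ => (hmem φ).toLp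
        map_add' := fun φ ψ => MemLp.toLp_add (hmem φ) (hmem ψ)
        map_smul' := fun c φ => MemLp.toLp_const_smul c (hmem φ) }
    let l : testFunctions Ω →ₗ[ℝ] ℝ :=
      { toFun := fun φ => - ∫ x in Ω, w x * partialDeriv i φ x
        map_add' := fun φ ψ => by
          rw [Submodule.coe_add, partialDeriv_add (IsTestFunction.differentiable φ.2)
            (IsTestFunction.differentiable ψ.2)]
          simp only [Pi.add_apply, mul_add]
          rw [integral_add (hint φ) (hint ψ), neg_add]
        map_smul' := fun c φ => by
          rw [Submodule.coe_smul, partialDeriv_smul (IsTestFunction.differentiable φ.2)]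
          simp only [Pi.smul_apply, smul_eq_mul, RingHom.id_apply, mul_left_comm _ c,
            integral_const_mul]
          ring }
    obtain ⟨g, hg, hgl⟩ := exists_inner_eq_of_abs_le T l (norm_nonneg (weakGrad v)) fun φ => by
      change |-∫ x in Ω, w x * partialDeriv i φ x| ≤ _ * ‖(hmem φ).toLp‖
      rw [abs_neg, Lp.norm_toLp]
      exact abs_integral_contraction_mul_partialDeriv_le hΩ hb hv hF hw φ.2 i
    refine ⟨g, hg, fun φ hφ => ?_⟩
    have h1 : - ∫ x in Ω, w x * partialDeriv i φ x = inner ℝ g ((hmem ⟨φ, hφ⟩).toLp) :=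
      hgl ⟨φ, hφ⟩
    rw [L2.inner_def] at h1
    have h2 : ∫ x in Ω, inner ℝ (g x) (((hmem ⟨φ, hφ⟩).toLp : L2 Ω) x) = ∫ x in Ω, g x * φ x := by
      refine integral_congr_ae ?_
      filter_upwards [(hmem ⟨φ, hφ⟩).coeFn_toLp] with x hx
      rw [hx]
      simp [mul_comm]
    rw [h2] at h1
    linarith
  choose g hg hgw using key
  refine ⟨memH1_of_isWeakPartial hgw, fun i => ?_⟩
  rw [weakGrad_apply_eq hΩ (hgw i)]
  exact hg i

/-! ### The projection on an interval -/

section Clip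

variable {a b : EReal}

theorem coe_clip (ha : a ≠ ⊤) (hb : b ≠ ⊥) (s : ℝ) :
    (clip a b s : EReal) = min b (max a s) := by
  refine EReal.coe_toReal ?_ ?_
  · refine ne_of_lt ((min_le_right _ _).trans_lt (max_lt ha.lt_top (EReal.coe_lt_top s)))
  · exact ne_of_gt (lt_min hb.bot_lt ((EReal.bot_lt_coe s).trans_le (le_max_right _ _)))

theorem clip_cases (ha : a ≠ ⊤) (hb : b ≠ ⊥) (hab : a ≤ b) (s : ℝ) :
    (clip a b s = s ∧ a ≤ s ∧ s ≤ b) ∨ (a = clip a b s ∧ s < clip a b s) ∨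
      (b = clip a b s ∧ clip a b s < s) := by
  have h := coe_clip ha hb s
  rcases lt_or_ge (s : EReal) a with h1 | h1
  · rw [max_eq_left h1.le, min_eq_right hab] at h
    exact Or.inr (Or.inl ⟨h.symm, by rw [← h] at h1; exact_mod_cast h1⟩)
  · rw [max_eq_right h1] at h
    rcases lt_or_ge b (s : EReal) with h2 | h2
    · rw [min_eq_left h2.le] at h
      exact Or.inr (Or.inr ⟨h.symm, by rw [← h] at h2; exact_mod_cast h2⟩)
    · rw [min_eq_right h2] at h
      exact Or.inl ⟨by exact_mod_cast h, h1, h2⟩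

theorem clip_mono (ha : a ≠ ⊤) (hb : b ≠ ⊥) : Monotone (clip a b) := by
  intro s t hst
  have : (clip a b s : EReal) ≤ clip a b t := by
    rw [coe_clip ha hb, coe_clip ha hb]
    exact min_le_min le_rfl (max_le_max le_rfl (by exact_mod_cast hst))
  exact_mod_cast this

theorem le_clip (ha : a ≠ ⊤) (hb : b ≠ ⊥) (hab : a ≤ b) (s : ℝ) : a ≤ clip a b s := by
  rw [coe_clip ha hb]; exact le_min hab (le_max_left _ _)

theorem clip_le (ha : a ≠ ⊤) (hb : b ≠ ⊥) (s : ℝ) : clip a b s ≤ b := by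
  rw [coe_clip ha hb]; exact min_le_left _ _

theorem clip_eq_self (ha : a ≠ ⊤) (hb : b ≠ ⊥) {s : ℝ} (h1 : a ≤ s) (h2 : s ≤ b) :
    clip a b s = s := by
  have := coe_clip ha hb s
  rw [max_eq_right h1, min_eq_right h2] at this
  exact_mod_cast this

/-- The variational characterization of the projection. -/
theorem clip_sub_mul_nonneg (ha : a ≠ ⊤) (hb : b ≠ ⊥) (hab : a ≤ b) (s : ℝ) {r : ℝ}
    (h1 : a ≤ r) (h2 : r ≤ b) : 0 ≤ (clip a b s - s) * (r - clip a b s) := by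
  rcases clip_cases ha hb hab s with h | h | h
  · rw [h.1]; simp
  · have : clip a b s ≤ r := by
      have := h1; rw [h.1] at this; exact_mod_cast this
    exact mul_nonneg (by linarith [h.2]) (by linarith)
  · have : r ≤ clip a b s := by
      have := h2; rw [h.1] at this; exact_mod_cast this
    exact mul_nonneg_of_nonpos_of_nonpos (by linarith [h.2]) (by linarith)

theorem abs_clip_sub_clip_le (ha : a ≠ ⊤) (hb : b ≠ ⊥) (hab : a ≤ b) (s t : ℝ) :
    |clip a b s - clip a b t| ≤ |s - t| := by
  have h1 := clip_sub_mul_nonneg ha hb hab s (le_clip ha hb hab t) (clip_le ha hb t)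
  have h2 := clip_sub_mul_nonneg ha hb hab t (le_clip ha hb hab s) (clip_le ha hb s)
  refine abs_le_of_sq_le_sq' ?_ (abs_nonneg _) |> abs_le.2
  rw [sq_abs]
  nlinarith [sq_nonneg ((clip a b s - clip a b t) - (s - t))]

theorem minmod_nonneg (a b : EReal) : 0 ≤ minmod a b := by
  rw [minmod]; split_ifs
  · exact le_rfl
  · exact ENNReal.toReal_nonneg

theorem le_minmod_of_pos {r : ℝ} (hr : 0 < r) (hb : (r : EReal) ≤ b) : r ≤ minmod r b := by
  have h0 : (0 : EReal) < r := by exact_mod_cast hr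
  have hneg : ¬ (r : EReal) * b ≤ 0 := not_le.2 (EReal.mul_pos h0 (h0.trans_le hb))
  have hle : (r : EReal).abs ≤ b.abs := by
    induction b with
    | bot => simp at hb
    | top => simp
    | coe b =>
      have hb' : r ≤ b := by exact_mod_cast hb
      rw [EReal.abs_def, EReal.abs_def, abs_of_pos hr, abs_of_pos (hr.trans_le hb')]
      exact ENNReal.ofReal_le_ofReal hb'
  rw [minmod, if_neg hneg, min_eq_left hle, EReal.abs_def, ENNReal.toReal_ofReal (abs_nonneg _)]
  exact le_abs_self r

theorem neg_le_minmod_of_neg {r : ℝ} (hr : r < 0) (ha : a ≤ (r : EReal)) : -r ≤ minmod a r := by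
  have h0 : (r : EReal) < 0 := by exact_mod_cast hr
  have hneg : ¬ a * (r : EReal) ≤ 0 :=
    not_le.2 (by
      rw [← neg_mul_neg]
      exact EReal.mul_pos (EReal.neg_pos.2 (ha.trans_lt h0)) (EReal.neg_pos.2 h0))
  have hle : (r : EReal).abs ≤ a.abs := by
    induction a with
    | top => simp at ha
    | bot => simp
    | coe a =>
      have ha' : a ≤ r := by exact_mod_cast ha
      rw [EReal.abs_def, EReal.abs_def, abs_of_neg hr, abs_of_neg (ha'.trans_lt hr)]
      exact ENNReal.ofReal_le_ofReal (by linarith)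
  rw [minmod, if_neg hneg, min_eq_right hle, EReal.abs_def, ENNReal.toReal_ofReal (abs_nonneg _)]
  exact neg_le_abs r

theorem abs_clip_le (ha : a ≠ ⊤) (hb : b ≠ ⊥) (hab : a ≤ b) (s : ℝ) :
    |clip a b s| ≤ |s| + minmod a b := by
  have hm := minmod_nonneg a b
  rcases clip_cases ha hb hab s with h | h | h
  · rw [h.1]; linarith
  · rcases le_or_gt (clip a b s) 0 with h0 | h0
    · rw [abs_of_nonpos h0, abs_of_neg (h.2.trans_le h0)]; linarith [h.2]
    · have := le_minmod_of_pos h0 (clip_le ha hb s)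
      rw [← h.1] at this
      rw [abs_of_pos h0]; linarith [abs_nonneg s]
  · rcases le_or_gt 0 (clip a b s) with h0 | h0
    · rw [abs_of_nonneg h0, abs_of_pos (h0.trans_lt h.2)]; linarith [h.2]
    · have := neg_le_minmod_of_neg h0 (le_clip ha hb hab s)
      rw [← h.1] at this
      rw [abs_of_neg h0]; linarith [abs_nonneg s]

variable {Y : Type*} [MeasurableSpace Y] {μ : Measure Y} [IsFiniteMeasure μ] [NeZero μ]
  {q : Y → ℝ}

theorem average_le_of_ae_le (hq : Integrable q μ) {M : ℝ} (h : ∀ᵐ x ∂μ, q x ≤ M) :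
    ⨍ x, q x ∂μ ≤ M := by
  have hpos : 0 < μ.real Set.univ := by simp
  rw [average_eq, smul_eq_mul, inv_mul_le_iff₀ hpos]
  have := integral_mono_ae hq (integrable_const M) h
  simpa using this

theorem le_average_of_ae_le (hq : Integrable q μ) {m : ℝ} (h : ∀ᵐ x ∂μ, m ≤ q x) :
    m ≤ ⨍ x, q x ∂μ := by
  have := average_le_of_ae_le hq.neg (M := -m) (h.mono fun x hx => by simpa using hx)
  rw [average_eq] at this ⊢
  simp only [Pi.neg_apply, integral_neg, smul_neg] at this
  linarith

/-- An upper bound of `P(q)` also bounds `P` at the mean value of `q`. -/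
theorem clip_average_le (ha : a ≠ ⊤) (hb : b ≠ ⊥) (hq : Integrable q μ) {M : ℝ}
    (h : ∀ᵐ x ∂μ, clip a b (q x) ≤ M) : clip a b (⨍ x, q x ∂μ) ≤ M := by
  rcases le_or_gt b (M : EReal) with hM | hM
  · have := (clip_le ha hb (⨍ x, q x ∂μ)).trans hM
    exact_mod_cast this
  -- below the upper end of the interval, the projection is at least the identity
  have h' : ∀ᵐ x ∂μ, a ≤ M ∧ q x ≤ M := by
    filter_upwards [h] with x hx
    have h1 : ((clip a b (q x) : ℝ) : EReal) ≤ M := by exact_mod_cast hx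
    rw [coe_clip ha hb, min_le_iff, or_iff_right (not_le.2 hM), max_le_iff] at h1
    exact ⟨h1.1, by exact_mod_cast h1.2⟩
  obtain ⟨x, hx, -⟩ := h'.exists
  have h2 := clip_mono ha hb (average_le_of_ae_le hq (h'.mono fun x hx => hx.2))
  rwa [clip_eq_self (s := M) ha hb hx hM.le] at h2

/-- A lower bound of `P(q)` also bounds `P` at the mean value of `q`. -/
theorem le_clip_average (ha : a ≠ ⊤) (hb : b ≠ ⊥) (hab : a ≤ b) (hq : Integrable q μ) {m : ℝ}
    (h : ∀ᵐ x ∂μ, m ≤ clip a b (q x)) : m ≤ clip a b (⨍ x, q x ∂μ) := by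
  rcases le_or_gt (m : EReal) a with hm | hm
  · have := hm.trans (le_clip ha hb hab (⨍ x, q x ∂μ))
    exact_mod_cast this
  have h' : ∀ᵐ x ∂μ, m ≤ b ∧ m ≤ q x := by
    filter_upwards [h] with x hx
    have h1 : (m : EReal) ≤ (clip a b (q x) : ℝ) := by exact_mod_cast hx
    rw [coe_clip ha hb, le_min_iff, le_max_iff, or_iff_right (not_le.2 hm)] at h1
    exact ⟨h1.1, by exact_mod_cast h1.2⟩
  obtain ⟨x, hx, -⟩ := h'.exists
  have h2 := clip_mono ha hb (le_average_of_ae_le hq (h'.mono fun x hx => hx.2))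
  rwa [clip_eq_self (s := m) ha hb hm.le hx] at h2

theorem le_average_of_ae_le_ereal (hq : Integrable q μ) (h : ∀ᵐ x ∂μ, a ≤ q x) :
    a ≤ (⨍ x, q x ∂μ : ℝ) := by
  induction a with
  | bot => exact bot_le
  | top => obtain ⟨x, hx⟩ := h.exists; simp at hx
  | coe m => exact_mod_cast le_average_of_ae_le hq (h.mono fun x hx => by exact_mod_cast hx)

theorem average_le_of_ae_le_ereal (hq : Integrable q μ) (h : ∀ᵐ x ∂μ, q x ≤ b) :
    (⨍ x, q x ∂μ : ℝ) ≤ b := by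
  induction b with
  | top => exact le_top
  | bot => obtain ⟨x, hx⟩ := h.exists; simp at hx
  | coe m => exact_mod_cast average_le_of_ae_le hq (h.mono fun x hx => by exact_mod_cast hx)

end Clip

/-! ### Meshes and the projection on piecewise constant functions -/

variable {Ω : Set (E n)}

theorem volume_hyperplane {w : E n} (hw : w ≠ 0) (r : ℝ) :
    volume {x : E n | inner ℝ w x = r} = 0 := by
  have h := Measure.addHaar_affineSubspace (volume : Measure (E n))
    ((AffineSubspace.mk' ((r / ‖w‖ ^ 2) • w) (LinearMap.ker (innerₛₗ ℝ w)))) (fun htop => by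
      have := congrArg AffineSubspace.direction htop
      rw [AffineSubspace.direction_mk', AffineSubspace.direction_top] at this
      have hmem : w ∈ LinearMap.ker (innerₛₗ ℝ w) := this ▸ Submodule.mem_top
      simp [hw] at hmem)
  refine measure_mono_null (fun x hx => ?_) h
  have hw2 : ‖w‖ ^ 2 ≠ 0 := by simpa using hw
  have hx' : inner ℝ w x = r := hx
  rw [SetLike.mem_coe, AffineSubspace.mem_mk']
  simp only [vsub_eq_sub, LinearMap.mem_ker, innerₛₗ_apply_apply, inner_sub_right, hx',
    inner_smul_right, real_inner_self_eq_norm_sq]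
  field_simp
  ring

theorem volume_frontier_of_isPolytopal {K : Set (E n)} (hK : IsPolytopal K) :
    volume (frontier K) = 0 := by
  obtain ⟨-, -, -, S, hS, hsub⟩ := hK
  refine measure_mono_null hsub ?_
  exact (measure_biUnion_null_iff S.countable_toSet).2 fun s hs => volume_hyperplane (hS s hs) _

namespace Mesh

variable (T : Mesh Ω)

theorem restrict_eq :
    (volume.restrict Ω : Measure (E n)) = volume.restrict (⋃ K ∈ T.cells, K) := by
  refine Measure.restrict_congr_set ?_
  have hsub : (⋃ K ∈ T.cells, K) ⊆ Ω := Set.iUnion₂_subset T.subset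
  have hdiff : volume (Ω \ ⋃ K ∈ T.cells, K) = 0 := by
    refine measure_mono_null (t := ⋃ K ∈ T.cells, frontier K) (fun x hx => ?_) ?_
    · have hx1 : x ∈ ⋃ K ∈ T.cells, closure K := T.cover ▸ subset_closure hx.1
      obtain ⟨K, hK, hxK⟩ := Set.mem_iUnion₂.1 hx1
      refine Set.mem_iUnion₂.2 ⟨K, hK, hxK, ?_⟩
      rw [(T.polytopal K hK).2.1.interior_eq]
      exact fun h => hx.2 (Set.mem_iUnion₂.2 ⟨K, hK, h⟩)
    · exact (measure_biUnion_null_iff T.cells.countable_toSet).2 fun K hK =>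
        volume_frontier_of_isPolytopal (T.polytopal K hK)
  exact (ae_eq_set.2 ⟨hdiff, by rw [Set.sdiff_eq_empty.2 hsub, measure_empty]⟩)

variable {T} {K : Set (E n)}

theorem isOpen_cell (hK : K ∈ T.cells) : IsOpen K := (T.polytopal K hK).2.1

theorem measurableSet_cell (hK : K ∈ T.cells) : MeasurableSet K :=
  (isOpen_cell hK).measurableSet

theorem isBounded_cell (hK : K ∈ T.cells) : Bornology.IsBounded K :=
  (T.polytopal K hK).2.2.1

theorem volume_cell_ne_top (hK : K ∈ T.cells) : volume K ≠ ⊤ :=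
  (isBounded_cell hK).measure_lt_top.ne

theorem volume_cell_ne_zero (hK : K ∈ T.cells) : volume K ≠ 0 :=
  ((isOpen_cell hK).measure_pos volume (T.polytopal K hK).1).ne'

theorem isFiniteMeasure_cell (hK : K ∈ T.cells) : IsFiniteMeasure (volume.restrict K) :=
  ⟨by simpa using (volume_cell_ne_top hK).lt_top⟩

theorem neZero_cell (hK : K ∈ T.cells) : NeZero (volume.restrict K) :=
  ⟨by simpa using volume_cell_ne_zero hK⟩

theorem centroid_mem (hK : K ∈ T.cells) : centroid K ∈ K :=
  (T.star K hK).mem (T.polytopal K hK).1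

theorem restrict_cell_le (hK : K ∈ T.cells) : volume.restrict K ≤ volume.restrict Ω :=
  Measure.restrict_mono (T.subset K hK) le_rfl

theorem memLp_cell (hK : K ∈ T.cells) (v : L2 Ω) : MemLp v 2 (volume.restrict K) :=
  (memLp_coe v).mono_measure (restrict_cell_le hK)

theorem integrable_cell (hK : K ∈ T.cells) (v : L2 Ω) : Integrable v (volume.restrict K) :=
  have := isFiniteMeasure_cell hK
  (memLp_cell hK v).integrable one_le_two

theorem ae_cell (hK : K ∈ T.cells) {P : E n → Prop} (h : ∀ᵐ x ∂(volume.restrict Ω), P x) :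
    ∀ᵐ x ∂(volume.restrict K), P x :=
  (Measure.absolutelyContinuous_of_le (restrict_cell_le hK)) h

theorem norm_sub_le_diam (hK : K ∈ T.cells) {x y : E n} (hx : x ∈ K) (hy : y ∈ K) :
    ‖x - y‖ ≤ Metric.diam K := by
  rw [← dist_eq_norm]; exact Metric.dist_le_diam_of_mem (isBounded_cell hK) hx hy

theorem diam_le_size (hK : K ∈ T.cells) : Metric.diam K ≤ T.size :=
  le_ciSup (f := fun K : T.cells => Metric.diam (K : Set (E n))) (Set.finite_range _).bddAbove
    ⟨K, hK⟩

theorem proj_apply (hK : K ∈ T.cells) (v : E n → ℝ) {x : E n} (hx : x ∈ K) :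
    T.proj v x = ⨍ z in K, v z := by
  rw [Mesh.proj, Finset.sum_eq_single_of_mem K hK, Set.indicator_of_mem hx]
  intro L hL hLK
  exact Set.indicator_of_notMem (fun h => (T.disjoint L hL K hK hLK).ne_of_mem h hx rfl) _

/-- A regular cell contains a ball around its centroid with a radius comparable to the diameter. -/
theorem closedBall_subset_cell (hK : K ∈ T.cells) (hn : 0 < n) {η : ℝ} (hη : T.IsRegular η) :
    Metric.closedBall (centroid K) ((1 / (2 * max η 1)) * Metric.diam K) ⊆ K := by
  set S := {r : ℝ | 0 < r ∧ Metric.ball (centroid K) r ⊆ K} with hS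
  have hc := centroid_mem hK
  obtain ⟨r₀, hr₀, hr₀K⟩ := Metric.isOpen_iff.1 (isOpen_cell hK) _ hc
  have hbdd : BddAbove S := by
    refine ⟨2 * Metric.diam K, fun r hr => ?_⟩
    have hmem : centroid K + (EuclideanSpace.single ⟨0, hn⟩ (r / 2) : E n) ∈ K := by
      refine hr.2 ?_
      rw [mem_ball_iff_norm, add_sub_cancel_left, PiLp.norm_single, Real.norm_eq_abs,
        abs_of_pos (half_pos hr.1)]
      linarith [hr.1]
    have := norm_sub_le_diam hK hmem hc
    rw [add_sub_cancel_left, PiLp.norm_single, Real.norm_eq_abs,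
      abs_of_pos (half_pos hr.1)] at this
    linarith
  have hρ : 0 < inRadius K := hr₀.trans_le (le_csSup hbdd ⟨hr₀, hr₀K⟩)
  have hm : 0 < max η 1 := lt_max_of_lt_right one_pos
  have h1 : Metric.diam K ≤ max η 1 * inRadius K := by
    have := hη K hK
    rw [div_le_iff₀ hρ] at this
    exact this.trans (mul_le_mul_of_nonneg_right (le_max_left _ _) hρ.le)
  have h2 : (1 / (2 * max η 1)) * Metric.diam K < inRadius K := by
    rw [one_div, inv_mul_lt_iff₀ (by positivity)]
    nlinarith [mul_pos hm hρ]
  obtain ⟨r, hr, hlt⟩ := exists_lt_of_lt_csSup (s := S) ⟨r₀, hr₀, hr₀K⟩ h2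
  exact (Metric.closedBall_subset_ball hlt).trans hr.2

variable (T)

theorem size_nonneg : 0 ≤ T.size := Real.iSup_nonneg fun _ => Metric.diam_nonneg

theorem lintegral_eq_sum (f : E n → ℝ≥0∞) :
    ∫⁻ x in Ω, f x = ∑ K ∈ T.cells, ∫⁻ x in K, f x := by
  rw [T.restrict_eq, lintegral_biUnion_finset]
  · exact fun K hK L hL hKL => T.disjoint K hK L hL hKL
  · exact fun K hK => measurableSet_cell hK

theorem integral_eq_sum {f : E n → ℝ} (hf : Integrable f (volume.restrict Ω)) :
    ∫ x in Ω, f x = ∑ K ∈ T.cells, ∫ x in K, f x := by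
  rw [T.restrict_eq, integral_biUnion_finset]
  · exact fun K hK => measurableSet_cell hK
  · exact fun K hK L hL hKL => T.disjoint K hK L hL hKL
  · exact fun K hK => IntegrableOn.mono_set hf (T.subset K hK)

theorem memLp_proj (v : E n → ℝ) : MemLp (T.proj v) 2 (volume.restrict Ω) := by
  have : T.proj v = ∑ K ∈ T.cells, K.indicator fun _ => ⨍ z in K, v z := by
    ext x; simp [Mesh.proj]
  rw [this]
  refine memLp_finsetSum' _ fun K hK => memLp_indicator_const 2 (measurableSet_cell hK) _ ?_
  exact Or.inr ((Measure.restrict_apply_le _ _).trans_lt (volume_cell_ne_top hK).lt_top).ne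

/-- The projection on piecewise constant functions, as a map on `L²(Ω)`. -/
noncomputable def projL2 (v : L2 Ω) : L2 Ω := (T.memLp_proj v).toLp

theorem coeFn_projL2 (v : L2 Ω) : T.projL2 v =ᵐ[volume.restrict Ω] T.proj v :=
  (T.memLp_proj v).coeFn_toLp

theorem projL2_ae_cell (v : L2 Ω) {K : Set (E n)} (hK : K ∈ T.cells) :
    ∀ᵐ x ∂(volume.restrict K), T.projL2 v x = ⨍ z in K, v z := by
  filter_upwards [ae_cell hK (T.coeFn_projL2 v), ae_restrict_mem (measurableSet_cell hK)]
    with x hx hxK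
  rw [hx, proj_apply hK _ hxK]

end Mesh

theorem inner_eq_integral_mul (v w : L2 Ω) : inner ℝ v w = ∫ x in Ω, v x * w x := by
  rw [L2.inner_def]
  exact integral_congr_ae (Eventually.of_forall fun x => by simp [mul_comm])

theorem integrable_mul_coe (v w : L2 Ω) :
    Integrable (fun x => v x * w x) (volume.restrict Ω) :=
  (memLp_coe v).integrable_mul (memLp_coe w)

theorem Mesh.integral_cell_projL2 (T : Mesh Ω) (v : L2 Ω) {K : Set (E n)} (hK : K ∈ T.cells) :
    ∫ x in K, T.projL2 v x = ∫ x in K, v x := by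
  have := Mesh.isFiniteMeasure_cell hK
  rw [integral_congr_ae (T.projL2_ae_cell v hK)]
  exact integral_average (volume.restrict K) v

/-- The projection on piecewise constant functions is orthogonal. -/
theorem Mesh.inner_projL2 (T : Mesh Ω) (v : L2 Ω) {w : L2 Ω}
    (hw : T.IsPiecewiseConst w) : inner ℝ (T.projL2 v) w = inner ℝ v w := by
  rw [inner_eq_integral_mul, inner_eq_integral_mul, T.integral_eq_sum (integrable_mul_coe _ _),
    T.integral_eq_sum (integrable_mul_coe _ _)]
  refine Finset.sum_congr rfl fun K hK => ?_
  obtain ⟨c, hc⟩ := hw K hK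
  have key : ∀ f : L2 Ω, ∫ x in K, f x * w x = (∫ x in K, f x) * c := fun f => by
    rw [← integral_mul_const]
    exact integral_congr_ae (hc.mono fun x hx => by simp only [hx])
  rw [key, key, T.integral_cell_projL2 v hK]

theorem Mesh.IsPiecewiseConst.sub {T : Mesh Ω} {v w : L2 Ω} (hv : T.IsPiecewiseConst v)
    (hw : T.IsPiecewiseConst w) : T.IsPiecewiseConst (v - w) := by
  intro K hK
  obtain ⟨c, hc⟩ := hv K hK
  obtain ⟨d, hd⟩ := hw K hK
  refine ⟨c - d, ?_⟩
  filter_upwards [hc, hd, Mesh.ae_cell hK (Lp.coeFn_sub v w)] with x h1 h2 h3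
  rw [h3, Pi.sub_apply, h1, h2]

theorem norm_le_of_lintegral_le {v : L2 Ω} {r : ℝ} (hr : 0 ≤ r)
    (h : ∫⁻ x in Ω, ‖v x‖ₑ ^ 2 ≤ ENNReal.ofReal (r ^ 2)) : ‖v‖ ≤ r := by
  rw [lintegral_enorm_sq_eq, ENNReal.ofReal_le_ofReal_iff (sq_nonneg r)] at h
  exact le_of_sq_le_sq h hr

/-- Approximation of an `H¹` function by its cell averages. -/
theorem Mesh.norm_sub_projL2_le (T : Mesh Ω) (hΩ : IsOpen Ω) (hn : 0 < n) {η : ℝ}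
    (hη : T.IsRegular η) {v : L2 Ω} (hv : MemH1 v) :
    ‖v - T.projL2 v‖ ≤ Real.sqrt (9 * (4 * max η 1) ^ n) * T.size * ‖weakGrad v‖ := by
  have hs := T.size_nonneg
  have hm : 0 < max η 1 := lt_max_of_lt_right one_pos
  refine norm_le_of_lintegral_le (by positivity) ?_
  have hl1 : 1 / (2 * max η 1) ≤ 1 := by
    rw [div_le_one (by positivity)]; linarith [le_max_right η 1]
  have h2l : 2 / (1 / (2 * max η 1)) = 4 * max η 1 := by field_simp; ring
  have hcell : ∀ K ∈ T.cells, ∫⁻ x in K, ‖(v - T.projL2 v : L2 Ω) x‖ₑ ^ 2 ≤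
      ENNReal.ofReal (9 * T.size ^ 2 * (4 * max η 1) ^ n) *
        ∑ i, ∫⁻ x in K, ‖weakGrad v i x‖ₑ ^ 2 := by
    intro K hK
    have hP := lintegral_sub_average_sq_le (isOpen_cell hK) (centroid_mem hK) (T.star K hK)
      (l := 1 / (2 * max η 1)) (by positivity) hl1 (fun x hx y hy => norm_sub_le_diam hK hx hy)
      (closedBall_subset_cell hK hn hη) (memLp_cell hK v) (fun i => memLp_cell hK (weakGrad v i))
      (fun i => (hv.isWeakPartial i).mono hΩ.measurableSet (T.subset K hK))
    rw [h2l] at hP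
    calc ∫⁻ x in K, ‖(v - T.projL2 v : L2 Ω) x‖ₑ ^ 2
        = ∫⁻ x in K, ‖v x - ⨍ z in K, v z‖ₑ ^ 2 := by
          refine lintegral_congr_ae ?_
          filter_upwards [ae_cell hK (Lp.coeFn_sub v (T.projL2 v)), T.projL2_ae_cell v hK]
            with x h1 h2
          rw [h1, Pi.sub_apply, h2]
      _ ≤ _ := hP
      _ ≤ _ := by
          gcongr
          exact diam_le_size hK
  rw [T.lintegral_eq_sum]
  calc _ ≤ ∑ K ∈ T.cells, ENNReal.ofReal (9 * T.size ^ 2 * (4 * max η 1) ^ n) *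
        ∑ i, ∫⁻ x in K, ‖weakGrad v i x‖ₑ ^ 2 := Finset.sum_le_sum hcell
    _ = ENNReal.ofReal (9 * T.size ^ 2 * (4 * max η 1) ^ n) *
        ∑ i, ∫⁻ x in Ω, ‖weakGrad v i x‖ₑ ^ 2 := by
        rw [← Finset.mul_sum, Finset.sum_comm]
        simp_rw [T.lintegral_eq_sum]
    _ = ENNReal.ofReal (9 * T.size ^ 2 * (4 * max η 1) ^ n) *
          ENNReal.ofReal (‖weakGrad v‖ ^ 2) := by
        rw [norm_sq_eq_sum_norm_sq, ENNReal.ofReal_sum_of_nonneg fun i _ => sq_nonneg _]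
        simp_rw [lintegral_enorm_sq_eq]
    _ = _ := by
        rw [← ENNReal.ofReal_mul (by positivity), mul_pow _ ‖weakGrad v‖,
          mul_pow _ T.size, Real.sq_sqrt (by positivity)]
        ring_nf

variable {A : E n → Matrix (Fin n) (Fin n) ℝ}

/-! ### The diffusion form -/

theorem IsDiffusionTensor.integrable (hA : IsDiffusionTensor Ω A) (G H : L2Vec Ω) :
    Integrable (fun x => ∑ i, ∑ j, A x i j * G j x * H i x) (volume.restrict Ω) := by
  obtain ⟨hm, ⟨M, hM⟩, -, -⟩ := hA
  refine integrable_finsetSum _ fun i _ => integrable_finsetSum _ fun j _ => ?_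
  simp only [mul_assoc]
  exact (integrable_mul_coe (G j) (H i)).bdd_mul (c := M) (hm i j).aestronglyMeasurable
    (hM.mono fun x hx => hx i j)

theorem diffusionForm_add_left (hA : IsDiffusionTensor Ω A) (G G' H : L2Vec Ω) :
    diffusionForm A (G + G') H = diffusionForm A G H + diffusionForm A G' H := by
  rw [diffusionForm, diffusionForm, diffusionForm,
    ← integral_add (hA.integrable G H) (hA.integrable G' H)]
  refine integral_congr_ae ?_
  have h : ∀ᵐ x ∂(volume.restrict Ω), ∀ j, (G + G') j x = G j x + G' j x :=
    ae_all_iff.2 fun j => Lp.coeFn_add (G j) (G' j)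
  filter_upwards [h] with x hx
  simp only [hx, ← Finset.sum_add_distrib]
  exact Finset.sum_congr rfl fun i _ => Finset.sum_congr rfl fun j _ => by ring

theorem diffusionForm_smul_left (c : ℝ) (G H : L2Vec Ω) :
    diffusionForm A (c • G) H = c * diffusionForm A G H := by
  rw [diffusionForm, diffusionForm, ← integral_const_mul]
  refine integral_congr_ae ?_
  have h : ∀ᵐ x ∂(volume.restrict Ω), ∀ j, (c • G) j x = c * G j x :=
    ae_all_iff.2 fun j => Lp.coeFn_smul c (G j)
  filter_upwards [h] with x hx
  simp only [hx, Finset.mul_sum]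
  exact Finset.sum_congr rfl fun i _ => Finset.sum_congr rfl fun j _ => by ring

theorem diffusionForm_comm (hA : IsDiffusionTensor Ω A) (G H : L2Vec Ω) :
    diffusionForm A G H = diffusionForm A H G := by
  refine integral_congr_ae ?_
  filter_upwards [hA.2.2.2] with x hx
  rw [Finset.sum_comm]
  refine Finset.sum_congr rfl fun i _ => Finset.sum_congr rfl fun j _ => ?_
  rw [hx.apply i j]
  ring

theorem exists_pos_mul_norm_sq_le_diffusionForm (hA : IsDiffusionTensor Ω A) :
    ∃ m : ℝ, 0 < m ∧ ∀ G : L2Vec Ω, m * ‖G‖ ^ 2 ≤ diffusionForm A G G := by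
  obtain ⟨m, hm, hell⟩ := hA.2.2.1
  refine ⟨m, hm, fun G => ?_⟩
  have hsq : ∀ i, ‖G i‖ ^ 2 = ∫ x in Ω, G i x ^ 2 := fun i => by
    rw [← real_inner_self_eq_norm_sq, inner_eq_integral_mul]
    simp only [sq]
  have hint : ∀ i, Integrable (fun x => G i x ^ 2) (volume.restrict Ω) := fun i => by
    simpa only [sq] using integrable_mul_coe (G i) (G i)
  rw [norm_sq_eq_sum_norm_sq]
  simp_rw [hsq]
  rw [← integral_finsetSum _ fun i _ => hint i, ← integral_const_mul]
  refine integral_mono_ae ((integrable_finsetSum _ fun i _ => hint i).const_mul m)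
    (hA.integrable G G) ?_
  filter_upwards [hell] with x hx
  exact hx fun i => G i x

/-! ### Gradient schemes -/

namespace GradDisc

variable {X : Type*} [AddCommGroup X] [Module ℝ X] (D : GradDisc Ω X)

theorem form_add_left (hA : IsDiffusionTensor Ω A) (v v' w : X) :
    D.form A (v + v') w = D.form A v w + D.form A v' w := by
  simp only [form, map_add, diffusionForm_add_left hA]

theorem form_smul_left (c : ℝ) (v w : X) : D.form A (c • v) w = c * D.form A v w := by
  simp only [form, map_smul, diffusionForm_smul_left]

theorem form_comm (hA : IsDiffusionTensor Ω A) (v w : X) : D.form A v w = D.form A w v :=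
  diffusionForm_comm hA _ _

theorem form_sub_left (hA : IsDiffusionTensor Ω A) (v v' w : X) :
    D.form A (v - v') w = D.form A v w - D.form A v' w := by
  rw [sub_eq_add_neg, D.form_add_left hA, ← neg_one_smul ℝ v', form_smul_left]
  ring

variable {D}

theorem IsSchemeSolution.sub (hA : IsDiffusionTensor Ω A) {F F' : L2 Ω} {v v' : X}
    (h : D.IsSchemeSolution A F v) (h' : D.IsSchemeSolution A F' v') :
    D.IsSchemeSolution A (F - F') (v - v') := by
  intro w
  rw [D.form_sub_left hA, h w, h' w, inner_sub_left]

variable (D)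

/-- Existence for the gradient scheme: a linear system with trivial kernel. -/
theorem exists_isSchemeSolution [FiniteDimensional ℝ X] (hA : IsDiffusionTensor Ω A) (F : L2 Ω) :
    ∃ v : X, D.IsSchemeSolution A F v := by
  obtain ⟨m, hm, hcoer⟩ := exists_pos_mul_norm_sq_le_diffusionForm hA
  let L : X →ₗ[ℝ] Module.Dual ℝ X := LinearMap.mk₂ ℝ (fun v w => D.form A v w)
    (fun v v' w => D.form_add_left hA v v' w) (fun c v w => D.form_smul_left c v w)
    (fun v w w' => by
      rw [D.form_comm hA, D.form_add_left hA, D.form_comm hA w, D.form_comm hA w'])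
    (fun c v w => by
      rw [D.form_comm hA, D.form_smul_left, D.form_comm hA w, smul_eq_mul])
  have hL : Function.Injective L := by
    rw [← LinearMap.ker_eq_bot, LinearMap.ker_eq_bot']
    intro v hv
    have h0 : D.form A v v = 0 := LinearMap.congr_fun hv v
    have h1 := hcoer (D.grad v)
    refine D.eq_zero_of_norm_grad v ?_
    rw [GradDisc.form] at h0
    rw [h0] at h1
    have : ‖D.grad v‖ ^ 2 ≤ 0 := by nlinarith [sq_nonneg ‖D.grad v‖]
    nlinarith [norm_nonneg (D.grad v), sq_nonneg ‖D.grad v‖]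
  obtain ⟨v, hv⟩ := (LinearMap.injective_iff_surjective_of_finrank_eq_finrank
    (Subspace.dual_finrank_eq (K := ℝ) (V := X)).symm).1 hL ((innerₛₗ ℝ F) ∘ₗ D.recon)
  exact ⟨v, fun w => LinearMap.congr_fun hv w⟩

theorem coercivityConst_nonneg : 0 ≤ D.coercivityConst := by
  refine Real.sSup_nonneg ?_
  rintro _ ⟨w, -, rfl⟩
  positivity

theorem norm_recon_le [FiniteDimensional ℝ X] (w : X) :
    ‖D.recon w‖ ≤ D.coercivityConst * ‖D.grad w‖ := by
  rcases eq_or_ne w 0 with rfl | hw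
  · simp
  have hinj : Function.Injective D.grad := by
    rw [← LinearMap.ker_eq_bot, LinearMap.ker_eq_bot']
    exact fun v hv => D.eq_zero_of_norm_grad v (by rw [hv, norm_zero])
  -- the reconstruction as a bounded operator on the finite-dimensional range of the gradient
  let e := LinearEquiv.ofInjective D.grad hinj
  let R := LinearMap.toContinuousLinearMap (D.recon ∘ₗ e.symm.toLinearMap)
  have hbdd : BddAbove {r : ℝ | ∃ w : X, w ≠ 0 ∧ r = ‖D.recon w‖ / ‖D.grad w‖} := by
    refine ⟨‖R‖, ?_⟩
    rintro _ ⟨v, -, rfl⟩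
    refine div_le_of_le_mul₀ (norm_nonneg _) (by positivity) ?_
    have h := R.le_opNorm (e v)
    have h1 : R (e v) = D.recon v := by simp [R]
    have h2 : ‖e v‖ = ‖D.grad v‖ := rfl
    rwa [h1, h2] at h
  have hpos : 0 < ‖D.grad w‖ :=
    lt_of_le_of_ne (norm_nonneg _) fun h => hw (D.eq_zero_of_norm_grad w h.symm)
  rw [← div_le_iff₀ hpos]
  exact le_csSup hbdd ⟨w, hw, rfl⟩

variable {D}

/-- The energy estimate. -/
theorem norm_grad_le_of_form_le [FiniteDimensional ℝ X] {m CD r : ℝ} (hm : 0 < m)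
    (hcoer : ∀ G : L2Vec Ω, m * ‖G‖ ^ 2 ≤ diffusionForm A G G) (hCD : D.coercivityConst ≤ CD)
    (hr : 0 ≤ r) {v : X} (hv : D.form A v v ≤ r * ‖D.recon v‖) :
    ‖D.grad v‖ ≤ CD / m * r ∧ ‖D.recon v‖ ≤ CD ^ 2 / m * r := by
  have hCD0 : 0 ≤ CD := D.coercivityConst_nonneg.trans hCD
  have h1 : ‖D.recon v‖ ≤ CD * ‖D.grad v‖ :=
    (D.norm_recon_le v).trans (mul_le_mul_of_nonneg_right hCD (norm_nonneg _))
  have h2 : m * ‖D.grad v‖ ^ 2 ≤ r * (CD * ‖D.grad v‖) :=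
    ((hcoer _).trans hv).trans (mul_le_mul_of_nonneg_left h1 hr)
  have h3 : ‖D.grad v‖ ≤ CD / m * r := by
    rw [div_mul_eq_mul_div, le_div_iff₀ hm]
    rcases (norm_nonneg (D.grad v)).eq_or_lt with h0 | h0
    · rw [← h0, zero_mul]; positivity
    · nlinarith
  refine ⟨h3, h1.trans ?_⟩
  calc CD * ‖D.grad v‖ ≤ CD * (CD / m * r) := by gcongr
    _ = CD ^ 2 / m * r := by ring

theorem IsSchemeSolution.norm_le [FiniteDimensional ℝ X] {m CD : ℝ} (hm : 0 < m)
    (hcoer : ∀ G : L2Vec Ω, m * ‖G‖ ^ 2 ≤ diffusionForm A G G) (hCD : D.coercivityConst ≤ CD)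
    {F : L2 Ω} {v : X} (hv : D.IsSchemeSolution A F v) :
    ‖D.grad v‖ ≤ CD / m * ‖F‖ ∧ ‖D.recon v‖ ≤ CD ^ 2 / m * ‖F‖ :=
  norm_grad_le_of_form_le hm hcoer hCD (norm_nonneg F) ((hv v).le.trans (real_inner_le_norm _ _))

end GradDisc

variable {a b : EReal}

/-! ### Projected functions and their piecewise constant approximation -/

theorem exists_ae_eq_clip (hfin : volume Ω ≠ ⊤) (ha : a ≠ ⊤) (hb : b ≠ ⊥) (hab : a ≤ b)
    (q : L2 Ω) : ∃ v : L2 Ω, ∀ᵐ x ∂(volume.restrict Ω), v x = clip a b (q x) := by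
  have : IsFiniteMeasure (volume.restrict Ω) := ⟨by simpa using hfin.lt_top⟩
  have hm : MemLp (fun x => clip a b (q x)) 2 (volume.restrict Ω) := by
    refine ((memLp_coe q).abs.add (memLp_const (minmod a b))).of_le
      (((clip_mono ha hb).measurable.comp_aemeasurable
        (memLp_coe q).1.aemeasurable).aestronglyMeasurable) (Eventually.of_forall fun x => ?_)
    refine (abs_clip_le ha hb hab (q x)).trans (le_abs_self _)
  exact ⟨hm.toLp, hm.coeFn_toLp⟩

theorem norm_le_of_ae_eq_clip (hfin : volume Ω ≠ ⊤) (ha : a ≠ ⊤) (hb : b ≠ ⊥) (hab : a ≤ b)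
    {u q : L2 Ω} (hu : ∀ᵐ x ∂(volume.restrict Ω), u x = clip a b (q x)) :
    ‖u‖ ≤ ‖q‖ + minmod a b * Real.sqrt (volume.real Ω) := by
  have : IsFiniteMeasure (volume.restrict Ω) := ⟨by simpa using hfin.lt_top⟩
  have h1 : ‖u‖ ≤ ‖|q| + Lp.const 2 (volume.restrict Ω) (minmod a b)‖ := by
    refine Lp.norm_le_norm_of_ae_le ?_
    filter_upwards [hu, Lp.coeFn_add |q| (Lp.const 2 (volume.restrict Ω) (minmod a b)),
      Lp.coeFn_abs q, Lp.coeFn_const 2 (volume.restrict Ω) (minmod a b)] with x h1 h2 h3 h4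
    rw [h1, h2, Pi.add_apply, h3, h4]
    exact (abs_clip_le ha hb hab (q x)).trans (le_abs_self _)
  refine h1.trans ((norm_add_le _ _).trans ?_)
  rw [norm_abs_eq_norm]
  gcongr
  refine (Lp.norm_const_le 2 (volume.restrict Ω) (minmod a b)).trans (le_of_eq ?_)
  rw [Real.norm_of_nonneg (minmod_nonneg a b), Real.sqrt_eq_rpow]
  simp

/-- The `H¹` norm of a projected function. -/
theorem normH1_le_of_ae_eq_clip (hΩ : IsOpen Ω) (hbd : Bornology.IsBounded Ω) (ha : a ≠ ⊤)
    (hb : b ≠ ⊥) (hab : a ≤ b) {u q : L2 Ω} (hq : MemH1 q)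
    (hu : ∀ᵐ x ∂(volume.restrict Ω), u x = clip a b (q x)) :
    MemH1 u ∧ normH1 u ≤ (1 + Real.sqrt n) * normH1 q + minmod a b * Real.sqrt (volume.real Ω) := by
  obtain ⟨h1, h2⟩ := memH1_of_contraction hΩ hbd hq (abs_clip_sub_clip_le ha hb hab) hu
  refine ⟨h1, ?_⟩
  have h3 : ‖weakGrad u‖ ≤ Real.sqrt n * ‖weakGrad q‖ := by
    refine le_of_sq_le_sq ?_ (by positivity)
    rw [norm_sq_eq_sum_norm_sq, mul_pow, Real.sq_sqrt (Nat.cast_nonneg n)]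
    calc ∑ i, ‖weakGrad u i‖ ^ 2 ≤ ∑ _i : Fin n, ‖weakGrad q‖ ^ 2 :=
          Finset.sum_le_sum fun i _ => by gcongr; exact h2 i
      _ = n * ‖weakGrad q‖ ^ 2 := by simp
  have h4 := norm_le_of_ae_eq_clip hbd.measure_lt_top.ne ha hb hab hu
  have h5 := normH1_le_add u
  have h6 := norm_le_normH1 q
  have h7 := mul_le_mul_of_nonneg_left (norm_weakGrad_le_normH1 q) (Real.sqrt_nonneg n)
  linarith

namespace Mesh

variable (T : Mesh Ω)

/-- The projection of the mean values reproduces the mean value of the control on the cells on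
which the control is fully active or fully inactive. -/
theorem integral_sub_clip_average_eq_zero {K : Set (E n)} (hK : K ∈ T.cells) (ha : a ≠ ⊤)
    (hb : b ≠ ⊥) (hab : a ≤ b) {u q : L2 Ω}
    (hu : ∀ᵐ x ∂(volume.restrict Ω), u x = clip a b (q x)) (hunif : IsUniformCell a b u K) :
    ∫ x in K, (u x - clip a b (⨍ z in K, q z)) = 0 := by
  have := isFiniteMeasure_cell hK
  have := neZero_cell hK
  have huK := ae_cell hK hu
  have hq := integrable_cell hK q
  -- on a fully active cell the projection of the mean value is squeezed
  have hactive : ∀ r : EReal, (∀ᵐ x ∂(volume.restrict K), (u x : EReal) = r) →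
      ∫ x in K, (u x - clip a b (⨍ z in K, q z)) = 0 := by
    intro r hr
    obtain ⟨x₀, hx₀⟩ := hr.exists
    have hc : ∀ᵐ x ∂(volume.restrict K), u x = u x₀ := hr.mono fun x hx => by
      rw [← hx₀] at hx; exact_mod_cast hx
    have h1 : clip a b (⨍ z in K, q z) = u x₀ := by
      refine le_antisymm (clip_average_le ha hb hq ?_) (le_clip_average ha hb hab hq ?_)
      · filter_upwards [hc, huK] with x h1 h2; rw [← h2, h1]
      · filter_upwards [hc, huK] with x h1 h2; rw [← h2, h1]
    rw [h1]
    exact integral_eq_zero_of_ae (hc.mono fun x hx => by simp [hx])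
  rcases hunif with h | h | h
  · exact hactive a h
  · exact hactive b h
  · have heq : ∀ᵐ x ∂(volume.restrict K), u x = q x := by
      filter_upwards [h, huK] with x h1 h2
      rcases clip_cases ha hb hab (q x) with h3 | h3 | h3
      · rw [h2, h3.1]
      · rw [h2, ← h3.1] at h1; exact absurd h1.1 (lt_irrefl _)
      · rw [h2, ← h3.1] at h1; exact absurd h1.2 (lt_irrefl _)
    have hmean : clip a b (⨍ z in K, q z) = ⨍ z in K, q z := by
      refine clip_eq_self ha hb (le_average_of_ae_le_ereal hq ?_)
        (average_le_of_ae_le_ereal hq ?_)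
      · filter_upwards [h, heq] with x h1 h2; rw [← h2]; exact h1.1.le
      · filter_upwards [h, heq] with x h1 h2; rw [← h2]; exact h1.2.le
    rw [hmean, integral_congr_ae (heq.mono fun x hx => by
      rw [hx]),
      integral_sub hq (integrable_const _), integral_average (volume.restrict K) q, sub_self]

theorem finite_mixedCells (u : E n → ℝ) : (T.mixedCells a b u).Finite :=
  T.cells.finite_toSet.subset fun _ hK => hK.1

theorem ae_abs_weakPartial_le {u : E n → ℝ} (hW : T.MemBrokenW1Inf a b u) {K : Set (E n)}
    (hK : K ∈ T.mixedCells a b u) (i : Fin n) :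
    ∀ᵐ x ∂(volume.restrict K), |weakPartial ⊤ K i u x| ≤ T.normBrokenW1Inf a b u := by
  have hlt : ∀ L ∈ T.mixedCells a b u, normW1Inf L u < ⊤ := by
    intro L hL
    have hsum : ∑ i, eLpNorm (weakPartial ⊤ L i u) ⊤ (volume.restrict L) < ⊤ :=
      ENNReal.sum_lt_top.2 fun i _ => (Lp.memLp (weakPartial ⊤ L i u)).2
    exact max_lt (hW L hL).1.2 ((iSup_le fun i => Finset.single_le_sum
      (f := fun i => eLpNorm (weakPartial ⊤ L i u) ⊤ (volume.restrict L))
      (fun _ _ => zero_le) (Finset.mem_univ i)).trans_lt hsum)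
  have hfin : (⨆ L ∈ T.mixedCells a b u, normW1Inf L u) ≠ ⊤ := by
    have hsum : ∑ L ∈ (T.finite_mixedCells (a := a) (b := b) u).toFinset, normW1Inf L u < ⊤ :=
      ENNReal.sum_lt_top.2 fun L hL => hlt L ((Set.Finite.mem_toFinset _).1 hL)
    refine (lt_of_le_of_lt (iSup₂_le fun L hL => ?_) hsum).ne
    exact Finset.single_le_sum (f := fun L => normW1Inf L u)
      (fun _ _ => zero_le) ((Set.Finite.mem_toFinset _).2 hL)
  have hle : eLpNorm (weakPartial ⊤ K i u) ⊤ (volume.restrict K)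
      ≤ ⨆ L ∈ T.mixedCells a b u, normW1Inf L u :=
    ((le_iSup (fun i => eLpNorm (weakPartial ⊤ K i u) ⊤ (volume.restrict K)) i).trans
      (le_max_right _ _)).trans (le_iSup₂ (f := fun L _ => normW1Inf L u) K hK)
  filter_upwards [ae_le_eLpNormEssSup (f := weakPartial ⊤ K i u) (μ := volume.restrict K)]
    with x hx
  rw [← eLpNorm_exponent_top] at hx
  have := ENNReal.toReal_mono hfin (hx.trans hle)
  rwa [toReal_enorm, Real.norm_eq_abs] at this

/-- The control and its piecewise constant approximation differ by the oscillation of the control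
on a cell. -/
theorem ae_abs_sub_clip_average_le {K : Set (E n)} (ha : a ≠ ⊤)
    (hb : b ≠ ⊥) (hab : a ≤ b) {u q : L2 Ω}
    (hu : ∀ᵐ x ∂(volume.restrict Ω), u x = clip a b (q x)) (hW : T.MemBrokenW1Inf a b u)
    (hK : K ∈ T.mixedCells a b u) :
    ∀ᵐ x ∂(volume.restrict K), |u x - clip a b (⨍ z in K, q z)|
      ≤ 4 * n * T.normBrokenW1Inf a b u * T.size := by
  have hKc : K ∈ T.cells := hK.1
  have := isFiniteMeasure_cell hKc
  have := neZero_cell hKc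
  have huK := ae_cell hKc hu
  have hq := integrable_cell hKc q
  have hW1 := hW K hK
  have hweak : ∀ i, IsWeakPartial K i u (weakPartial ⊤ K i u) := fun i => by
    rw [weakPartial, dif_pos (hW1.2 i)]
    exact (hW1.2 i).choose_spec
  obtain ⟨s, hs⟩ := exists_ae_abs_sub_le (isOpen_cell hKc) (centroid_mem hKc) (T.star K hKc)
    (d := T.size) (fun x hx => (norm_sub_le_diam hKc hx (centroid_mem hKc)).trans
      (diam_le_size hKc)) (hW1.1.mono_exponent le_top)
    (fun i => (Lp.memLp (weakPartial ⊤ K i u)).mono_exponent le_top) hweak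
    (T.ae_abs_weakPartial_le hW hK)
  set ρ := 2 * (n * T.normBrokenW1Inf a b u * T.size)
  have h1 : clip a b (⨍ z in K, q z) ≤ s + ρ := by
    refine clip_average_le ha hb hq ?_
    filter_upwards [hs, huK] with x h1 h2
    rw [← h2]; linarith [(abs_le.1 h1).2]
  have h2 : s - ρ ≤ clip a b (⨍ z in K, q z) := by
    refine le_clip_average ha hb hab hq ?_
    filter_upwards [hs, huK] with x h1 h2
    rw [← h2]; linarith [(abs_le.1 h1).1]
  filter_upwards [hs] with x hx
  rw [abs_le] at hx ⊢
  have e : 4 * n * T.normBrokenW1Inf a b u * T.size = 2 * ρ := by simp only [ρ]; ring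
  rw [e]
  constructor <;> linarith [hx.1, hx.2]

theorem sum_volume_mixedCells_le (u : E n → ℝ) {c : ℝ}
    (h : volume (T.mixedRegion a b u) ≤ ENNReal.ofReal (c * T.size)) :
    ∑ K ∈ (T.finite_mixedCells (a := a) (b := b) u).toFinset, volume.real K ≤ |c| * T.size := by
  set S := (T.finite_mixedCells (a := a) (b := b) u).toFinset with hS
  have hSc : ∀ K ∈ S, K ∈ T.cells := fun K hK => ((Set.Finite.mem_toFinset _).1 hK).1
  have hsub : (⋃ K ∈ S, K) ⊆ T.mixedRegion a b u := by
    refine interior_maximal (Set.iUnion₂_subset fun K hK => ?_)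
      (isOpen_biUnion fun K hK => isOpen_cell (hSc K hK))
    exact subset_closure.trans (Set.subset_biUnion_of_mem (u := fun K : Set (E n) => closure K)
      ((Set.Finite.mem_toFinset _).1 hK))
  have hsum : ∑ K ∈ S, volume K ≤ ENNReal.ofReal (c * T.size) := by
    rw [← measure_biUnion_finset
      (fun K hK L hL hKL => T.disjoint K (hSc K hK) L (hSc L hL) hKL)
      (fun K hK => measurableSet_cell (hSc K hK))]
    exact (measure_mono hsub).trans h
  have h1 := ENNReal.toReal_mono ENNReal.ofReal_ne_top hsum
  rw [ENNReal.toReal_sum fun K hK => volume_cell_ne_top (hSc K hK)] at h1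
  refine h1.trans ?_
  rw [ENNReal.toReal_ofReal']
  exact max_le (mul_le_mul_of_nonneg_right (le_abs_self c) T.size_nonneg)
    (mul_nonneg (abs_nonneg c) T.size_nonneg)

/-- Error of the piecewise constant approximation of the control against a bounded piecewise
constant function: only the mixed cells contribute, and these have a small total measure. -/
theorem abs_inner_sub_projL2_le (ha : a ≠ ⊤)
    (hb : b ≠ ⊥) (hab : a ≤ b) {u q w z : L2 Ω}
    (hu : ∀ᵐ x ∂(volume.restrict Ω), u x = clip a b (q x))
    (hw : ∀ᵐ x ∂(volume.restrict Ω), w x = clip a b (T.projL2 q x)) {c : ℝ}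
    (hmix : MixedRegionBound T a b u c) {B : ℝ} (hB : 0 ≤ B)
    (hz : ∀ᵐ x ∂(volume.restrict Ω), |z x| ≤ B) :
    |inner ℝ (u - w) (T.projL2 z)|
      ≤ 4 * n * |c| * T.size ^ 2 * T.normBrokenW1Inf a b u * B := by
  set R := 4 * n * T.normBrokenW1Inf a b u * T.size with hR
  have hL : 0 ≤ T.normBrokenW1Inf a b u := ENNReal.toReal_nonneg
  have hR0 : 0 ≤ R := by have := T.size_nonneg; positivity
  set S := (T.finite_mixedCells (a := a) (b := b) u).toFinset with hS
  have hSc : S ⊆ T.cells := fun K hK => ((Set.Finite.mem_toFinset _).1 hK).1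
  have hcell : ∀ K ∈ T.cells, ∫ x in K, (u - w : L2 Ω) x * T.projL2 z x
      = (∫ x in K, (u x - clip a b (⨍ y in K, q y))) * ⨍ y in K, z y := by
    intro K hK
    rw [← integral_mul_const]
    refine integral_congr_ae ?_
    filter_upwards [ae_cell hK (Lp.coeFn_sub u w), ae_cell hK hw, T.projL2_ae_cell q hK,
      T.projL2_ae_cell z hK] with x h1 h2 h3 h4
    rw [h1, h4, Pi.sub_apply, h2, h3]
  rw [inner_eq_integral_mul, T.integral_eq_sum (integrable_mul_coe _ _),
    ← Finset.sum_subset hSc fun K hK hKS => by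
      rw [hcell K hK, T.integral_sub_clip_average_eq_zero hK ha hb hab hu, zero_mul]
      by_contra hun
      exact hKS ((Set.Finite.mem_toFinset _).2 ⟨hK, hun⟩)]
  refine (Finset.abs_sum_le_sum_abs _ _).trans ?_
  calc _ ≤ ∑ K ∈ S, (R * B) * volume.real K := by
        refine Finset.sum_le_sum fun K hK => ?_
        have hKc := hSc hK
        have := isFiniteMeasure_cell hKc
        have := neZero_cell hKc
        rw [hcell K hKc, abs_mul]
        have h1 : |∫ x in K, (u x - clip a b (⨍ y in K, q y))| ≤ R * volume.real K := by
          have := norm_integral_le_of_norm_le_const (μ := volume.restrict K)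
            (f := fun x => u x - clip a b (⨍ y in K, q y)) (C := R)
            (T.ae_abs_sub_clip_average_le ha hb hab hu hmix.2 ((Set.Finite.mem_toFinset _).1 hK))
          simpa using this
        have h2 : |⨍ y in K, z y| ≤ B := by
          rw [abs_le]
          have hzK := ae_cell hKc hz
          exact ⟨le_average_of_ae_le (integrable_cell hKc z) (hzK.mono fun x hx => (abs_le.1 hx).1),
            average_le_of_ae_le (integrable_cell hKc z) (hzK.mono fun x hx => (abs_le.1 hx).2)⟩
        calc _ ≤ (R * volume.real K) * B := by gcongr
          _ = _ := by ring
    _ ≤ (R * B) * (|c| * T.size) := by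
        rw [← Finset.mul_sum]
        gcongr
        exact T.sum_volume_mixedCells_le u hmix.1
    _ = _ := by rw [hR]; ring

end Mesh

/-! ### Optimality conditions -/

theorem bounds_of_mem_admissible (hΩ : IsOpen Ω) (hne : Ω.Nonempty) {u : L2 Ω}
    (hu : u ∈ admissible Ω a b) : a ≠ ⊤ ∧ b ≠ ⊥ ∧ a ≤ b := by
  have : NeZero (volume.restrict Ω) := ⟨by simpa using (hΩ.measure_pos volume hne).ne'⟩
  obtain ⟨x, h1, h2⟩ := Eventually.exists (f := ae (volume.restrict Ω)) hu
  exact ⟨(h1.trans_lt (EReal.coe_lt_top _)).ne, ((EReal.bot_lt_coe _).trans_le h2).ne',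
    h1.trans h2⟩

theorem mem_admissible_of_ae_eq_clip (ha : a ≠ ⊤) (hb : b ≠ ⊥) (hab : a ≤ b) {u q : L2 Ω}
    (hu : ∀ᵐ x ∂(volume.restrict Ω), u x = clip a b (q x)) : u ∈ admissible Ω a b :=
  hu.mono fun x hx => by rw [hx]; exact ⟨le_clip ha hb hab _, clip_le ha hb _⟩

theorem inner_clip_sub_nonneg (ha : a ≠ ⊤) (hb : b ≠ ⊥) (hab : a ≤ b) {u q v : L2 Ω}
    (hu : ∀ᵐ x ∂(volume.restrict Ω), u x = clip a b (q x)) (hv : v ∈ admissible Ω a b) :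
    0 ≤ inner ℝ (u - q) (v - u) := by
  rw [inner_eq_integral_mul]
  refine integral_nonneg_of_ae ?_
  filter_upwards [hu, hv, Lp.coeFn_sub u q, Lp.coeFn_sub v u] with x h1 h2 h3 h4
  rw [h3, h4, Pi.sub_apply, Pi.sub_apply, h1]
  exact clip_sub_mul_nonneg ha hb hab _ h2.1 h2.2

/-- The variational inequality determines the control as a projection of the adjoint state. -/
theorem ae_eq_clip_of_variationalInequality (hfin : volume Ω ≠ ⊤) (ha : a ≠ ⊤) (hb : b ≠ ⊥)
    (hab : a ≤ b) {α : ℝ} (hα : 0 < α) {p ud u : L2 Ω} (hu : u ∈ admissible Ω a b)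
    (h : ∀ v ∈ admissible Ω a b, 0 ≤ inner ℝ (p + α • (u - ud)) (v - u)) :
    ∀ᵐ x ∂(volume.restrict Ω), u x = clip a b ((ud - α⁻¹ • p : L2 Ω) x) := by
  obtain ⟨v, hv⟩ := exists_ae_eq_clip hfin ha hb hab (ud - α⁻¹ • p)
  have h1 := inner_clip_sub_nonneg ha hb hab hv hu
  have h2 := h v (mem_admissible_of_ae_eq_clip ha hb hab hv)
  have e : p + α • (u - ud) = α • (u - (ud - α⁻¹ • p)) := by
    rw [smul_sub, smul_sub, smul_sub, smul_smul, mul_inv_cancel₀ hα.ne', one_smul]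
    abel
  rw [e, real_inner_smul_left] at h2
  have h3 : 0 ≤ inner ℝ (u - (ud - α⁻¹ • p)) (v - u) := nonneg_of_mul_nonneg_right h2 hα
  have h4 : inner ℝ (v - (ud - α⁻¹ • p)) (u - v) + inner ℝ (u - (ud - α⁻¹ • p)) (v - u)
      = - ‖u - v‖ ^ 2 := by
    rw [← neg_sub u v, inner_neg_right, ← sub_eq_add_neg, ← inner_sub_left,
      ← real_inner_self_eq_norm_sq, ← inner_neg_left]
    congr 1
    abel
  have h5 : u - v = 0 := by
    rw [← norm_eq_zero]
    nlinarith [norm_nonneg (u - v), sq_nonneg ‖u - v‖]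
  rw [sub_eq_zero.1 h5]
  exact hv

theorem norm_sub_le_of_ae_eq_clip (ha : a ≠ ⊤) (hb : b ≠ ⊥) (hab : a ≤ b) {u q v r : L2 Ω}
    (hu : ∀ᵐ x ∂(volume.restrict Ω), u x = clip a b (q x))
    (hv : ∀ᵐ x ∂(volume.restrict Ω), v x = clip a b (r x)) : ‖u - v‖ ≤ ‖q - r‖ := by
  refine Lp.norm_le_norm_of_ae_le ?_
  filter_upwards [hu, hv, Lp.coeFn_sub u v, Lp.coeFn_sub q r] with x h1 h2 h3 h4
  rw [h3, h4, Pi.sub_apply, Pi.sub_apply, h1, h2]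
  exact abs_clip_sub_clip_le ha hb hab _ _

theorem norm_le_of_eLpNorm_le {v : L2 Ω} {f : E n → ℝ} (hf : v =ᵐ[volume.restrict Ω] f) {r : ℝ}
    (hr : 0 ≤ r) (h : eLpNorm f 2 (volume.restrict Ω) ≤ ENNReal.ofReal r) : ‖v‖ ≤ r := by
  rw [Lp.norm_def, eLpNorm_congr_ae hf]
  exact ENNReal.toReal_le_of_le_ofReal hr h

/-! ### The error estimate -/

section Estimate

variable {X : Type*} [AddCommGroup X] [Module ℝ X]
  {D : GradDisc Ω X} {T : Mesh Ω} {c : ℝ} {wT : L2 Ω → L2 Ω}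

/-- Error of the adjoint state of the gradient scheme for the exact control. The source of its
equation contains the discrete state, which is compared with the exact state in a weak sense. -/
theorem norm_recon_adjoint_sub_le [FiniteDimensional ℝ X] (hA : IsDiffusionTensor Ω A)
    {m CD : ℝ} (hm : 0 < m)
    (hcoer : ∀ G : L2Vec Ω, m * ‖G‖ ^ 2 ≤ diffusionForm A G G) (hCD : D.coercivityConst ≤ CD)
    (hAI : ApproxInterp A D T c wT) (hc : 0 ≤ c) {F y yd p : L2 Ω} {yD pD : X}
    (hy2 : MemH2 y) (hp2 : MemH2 p) (hF : MemH1 F) (hg : MemH1 (y - yd))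
    (hy : IsWeakSolution A F y) (hp : IsWeakSolution A (y - yd) p)
    (hyD : D.IsSchemeSolution A F yD) (hpD : D.IsSchemeSolution A (D.recon yD - yd) pD) :
    ‖wT p - D.recon pD‖ ≤ c * T.size ^ 2 *
      (normH1 (y - yd) + CD ^ 2 / m * (normH1 F + normH2 y)) := by
  obtain ⟨pD', hpD'⟩ := D.exists_isSchemeSolution hA (y - yd)
  have h1 := hAI.1 p (y - yd) pD' hp2 hg hp hpD'
  have h2 := hAI.1 y F yD hy2 hF hy hyD
  have hv := hpD.sub hA hpD'
  have hsrc : D.recon yD - yd - (y - yd) = (D.recon yD - wT y) - (y - wT y) := by abel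
  rw [hsrc] at hv
  have hform : D.form A (pD - pD') (pD - pD') ≤
      (c * T.size ^ 2 * (normH1 F + normH2 y)) * ‖D.recon (pD - pD')‖ := by
    rw [hv, inner_sub_left]
    have h3 := (real_inner_le_norm (D.recon yD - wT y) (D.recon (pD - pD'))).trans
      (mul_le_mul_of_nonneg_right h2 (norm_nonneg _))
    have h4 := (abs_le.1 (hAI.2.1 y hy2 (pD - pD'))).1
    linarith
  have h5 := (GradDisc.norm_grad_le_of_form_le hm hcoer hCD (by
    have := normH1_nonneg F; have := normH2_nonneg y; positivity) hform).2
  rw [map_sub] at h5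
  have h6 : wT p - D.recon pD = -((D.recon pD' - wT p) + (D.recon pD - D.recon pD')) := by abel
  rw [h6, norm_neg]
  refine (norm_add_le _ _).trans ((add_le_add h1 h5).trans (le_of_eq ?_))
  ring

/-- Difference of the discrete states for the exact control `u` and a control `w`. It is tested with
the solution of the dual scheme, which is bounded in `L^∞`. -/
theorem norm_recon_sub_le_of_dual [FiniteDimensional ℝ X] (hA : IsDiffusionTensor Ω A)
    {m CD δ : ℝ} (hm : 0 < m)
    (hcoer : ∀ G : L2Vec Ω, m * ‖G‖ ^ 2 ≤ diffusionForm A G G) (hCD : D.coercivityConst ≤ CD)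
    (hδ : 0 ≤ δ) (hinf : SchemeLinftyBound A D δ) (hRP : ReconProjBound D T c) (hc : 0 ≤ c)
    {u w : L2 Ω} {R : ℝ}
    (hR : ∀ (z : L2 Ω) (B : ℝ), 0 ≤ B → (∀ᵐ x ∂(volume.restrict Ω), |z x| ≤ B) →
      |inner ℝ (u - w) (T.projL2 z)| ≤ R * B)
    {e : X} (he : D.IsSchemeSolution A (u - w) e) :
    ‖D.recon e‖ ≤ ‖u - w‖ * (c * T.size * (CD / m)) + R * δ := by
  obtain ⟨z, hz⟩ := D.exists_isSchemeSolution hA (D.recon e)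
  have hs := T.size_nonneg
  have h1 : ‖D.recon e‖ ^ 2 = inner ℝ (u - w) (D.recon z) := by
    rw [← real_inner_self_eq_norm_sq, ← hz e, D.form_comm hA, he z]
  have h2 : ‖D.recon z - T.projL2 (D.recon z)‖ ≤ c * T.size * (CD / m * ‖D.recon e‖) := by
    refine (norm_le_of_eLpNorm_le ?_ (by positivity) (hRP z)).trans ?_
    · filter_upwards [Lp.coeFn_sub (D.recon z) (T.projL2 (D.recon z)),
        T.coeFn_projL2 (D.recon z)] with x h1 h2
      rw [h1, Pi.sub_apply, h2]
    · exact mul_le_mul_of_nonneg_left (hz.norm_le hm hcoer hCD).1 (by positivity)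
  have h3 : |inner ℝ (u - w) (T.projL2 (D.recon z))| ≤ R * (δ * ‖D.recon e‖) := by
    refine hR _ _ (by positivity) ?_
    have hb := hinf _ z hz
    filter_upwards [ae_le_eLpNormEssSup (f := D.recon z) (μ := volume.restrict Ω)] with x hx
    rw [← eLpNorm_exponent_top] at hx
    have := ENNReal.toReal_le_of_le_ofReal (by positivity) (hx.trans hb)
    rwa [toReal_enorm, Real.norm_eq_abs] at this
  have h4 : ‖D.recon e‖ ^ 2 ≤
      (‖u - w‖ * (c * T.size * (CD / m)) + R * δ) * ‖D.recon e‖ := by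
    have h5 : D.recon z = (D.recon z - T.projL2 (D.recon z)) + T.projL2 (D.recon z) := by abel
    rw [h1, h5, inner_add_right]
    have h6 := (real_inner_le_norm (u - w) (D.recon z - T.projL2 (D.recon z))).trans
      (mul_le_mul_of_nonneg_left h2 (norm_nonneg _))
    have h7 := (le_abs_self _).trans h3
    linarith
  have hR0 : 0 ≤ R := by
    have := hR 0 1 zero_le_one (by
      filter_upwards [Lp.coeFn_zero ℝ 2 (volume.restrict Ω)] with x hx
      rw [hx]; simp)
    linarith [abs_nonneg (inner ℝ (u - w) (T.projL2 0))]
  have hCD0 : 0 ≤ CD := D.coercivityConst_nonneg.trans hCD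
  rcases (norm_nonneg (D.recon e)).eq_or_lt with h0 | h0
  · rw [← h0]; positivity
  · rw [sq] at h4; exact le_of_mul_le_mul_right h4 h0

/-- Distance of the discrete control to the piecewise constant approximation `w = P(P_T q)` of the
exact control. The discrete variational inequality is compared with the variational
characterization of the projection, and the difference of the discrete adjoint states for `w` and
for the discrete control drops out by monotonicity. -/
theorem mul_norm_sub_le_of_discreteKKT (hA : IsDiffusionTensor Ω A) (ha : a ≠ ⊤) (hb : b ≠ ⊥)
    (hab : a ≤ b) {α : ℝ} (hα : 0 < α) {f yd ud p w uh : L2 Ω} {yD pD y2 p2 : X}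
    (hD : IsDiscreteKKT A D T α a b f yd ud yD pD uh)
    (hw : ∀ᵐ x ∂(volume.restrict Ω), w x = clip a b (T.projL2 (ud - α⁻¹ • p) x))
    (hy2 : D.IsSchemeSolution A (f + w) y2) (hp2 : D.IsSchemeSolution A (D.recon y2 - yd) p2) :
    α * ‖w - uh‖ ≤ ‖wT p - D.recon p2‖ + ‖T.projL2 (p - wT p)‖ := by
  obtain ⟨huh, hyD, hpD, hVI⟩ := hD
  set q := ud - α⁻¹ • p with hq
  have hwad : w ∈ admissible Ω a b := mem_admissible_of_ae_eq_clip ha hb hab hw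
  have hwpc : T.IsPiecewiseConst w := fun K hK => ⟨clip a b (⨍ z in K, q z), by
    filter_upwards [Mesh.ae_cell hK hw, T.projL2_ae_cell q hK] with x h1 h2
    rw [h1, h2]⟩
  have hpc : T.IsPiecewiseConst (w - uh) := hwpc.sub huh.2
  have h1 := hVI w ⟨hwad, hwpc⟩
  have h2 : 0 ≤ inner ℝ (w - q) (uh - w) := by
    have h := inner_clip_sub_nonneg ha hb hab hw huh.1
    rw [← neg_sub w uh, inner_neg_right, inner_sub_left, T.inner_projL2 q hpc] at h
    rwa [← neg_sub w uh, inner_neg_right, inner_sub_left]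
  have hmono : inner ℝ (D.recon pD - D.recon p2) (w - uh) ≤ 0 := by
    have hye : D.IsSchemeSolution A (w - uh) (y2 - yD) := by
      have h := hy2.sub hA (F' := f + uh) hyD
      rwa [add_sub_add_left_eq_sub] at h
    have hpD' : D.IsSchemeSolution A (D.recon yD - yd) pD := fun v => by
      rw [D.form_comm hA]; exact hpD v
    have hpe := hpD'.sub hA hp2
    have e1 := hye (pD - p2)
    have e2 := hpe (y2 - yD)
    rw [D.form_comm hA, e1, sub_sub_sub_cancel_right, map_sub, map_sub,
      ← neg_sub (D.recon y2) (D.recon yD), inner_neg_left, real_inner_self_eq_norm_sq,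
      real_inner_comm] at e2
    rw [e2]
    exact neg_nonpos.2 (sq_nonneg _)
  have hproj : inner ℝ (p - wT p) (w - uh) = inner ℝ (T.projL2 (p - wT p)) (w - uh) :=
    (T.inner_projL2 _ hpc).symm
  have hsplit : D.recon pD + α • (uh - ud) = (D.recon pD - D.recon p2) - (wT p - D.recon p2)
      - (p - wT p) - α • (w - uh) + α • (w - q) := by
    rw [hq]
    simp only [smul_sub, smul_smul, mul_inv_cancel₀ hα.ne', one_smul]
    abel
  rw [hsplit, inner_add_left, inner_sub_left, inner_sub_left, inner_sub_left, real_inner_smul_left,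
    real_inner_smul_left, real_inner_self_eq_norm_sq, hproj] at h1
  rw [← neg_sub w uh, inner_neg_right] at h2
  have h3 := (abs_le.1 (abs_real_inner_le_norm (wT p - D.recon p2) (w - uh))).1
  have h4 := (abs_le.1 (abs_real_inner_le_norm (T.projL2 (p - wT p)) (w - uh))).1
  have h5 : α * inner ℝ (w - q) (w - uh) ≤ 0 :=
    mul_nonpos_of_nonneg_of_nonpos hα.le (by linarith)
  rcases (norm_nonneg (w - uh)).eq_or_lt with h0 | h0
  · rw [← h0, mul_zero]; positivity
  · refine le_of_mul_le_mul_right ?_ h0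
    nlinarith

/-- The post-processing divides the error of the adjoint state by `α`. -/
theorem eLpNorm_postProcessed_sub_le (ha : a ≠ ⊤) (hb : b ≠ ⊥) (hab : a ≤ b) {α : ℝ} (hα : 0 < α)
    (ud q r : L2 Ω) :
    eLpNorm (fun x => postProcessed T α a b ud q x - postProcessed T α a b ud r x) 2
      (volume.restrict Ω) ≤ ENNReal.ofReal (α⁻¹ * ‖q - r‖) := by
  have h1 : ∀ᵐ x ∂(volume.restrict Ω), ‖postProcessed T α a b ud q x
      - postProcessed T α a b ud r x‖ ≤ α⁻¹ * ‖(q - r : L2 Ω) x‖ := by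
    filter_upwards [Lp.coeFn_sub q r] with x hx
    rw [hx, Pi.sub_apply, postProcessed, postProcessed]
    refine (abs_clip_sub_clip_le ha hb hab _ _).trans (le_of_eq ?_)
    rw [sub_sub_sub_cancel_left, ← mul_sub, abs_mul, abs_of_pos (inv_pos.2 hα), abs_sub_comm]
    rfl
  refine (eLpNorm_le_mul_eLpNorm_of_ae_le_mul h1 2).trans (le_of_eq ?_)
  rw [ENNReal.ofReal_mul (inv_pos.2 hα).le, ofReal_norm, Lp.enorm_def]

theorem ApproxInterp.abs (h : ApproxInterp A D T c wT) : ApproxInterp A D T |c| wT := by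
  have hc : c * T.size ^ 2 ≤ |c| * T.size ^ 2 :=
    mul_le_mul_of_nonneg_right (le_abs_self c) (sq_nonneg _)
  refine ⟨fun w g wD h1 h2 h3 h4 => (h.1 w g wD h1 h2 h3 h4).trans ?_,
    fun w hw v => (h.2.1 w hw v).trans ?_,
    fun w hw => (h.2.2 w hw).trans (ENNReal.ofReal_le_ofReal ?_)⟩
  · exact mul_le_mul_of_nonneg_right hc (normH1_nonneg g)
  · exact mul_le_mul_of_nonneg_right (mul_le_mul_of_nonneg_right hc (normH2_nonneg w))
      (norm_nonneg _)
  · exact mul_le_mul_of_nonneg_right hc (normH2_nonneg w)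

theorem ReconProjBound.abs (h : ReconProjBound D T c) : ReconProjBound D T |c| := fun v =>
  (h v).trans (ENNReal.ofReal_le_ofReal (mul_le_mul_of_nonneg_right
    (mul_le_mul_of_nonneg_right (le_abs_self c) T.size_nonneg) (norm_nonneg _)))

/-- Error of the adjoint state of the optimality system. Between the exact and the discrete
control there is the piecewise constant function `w = P(P_T q)`. -/
theorem norm_sub_recon_adjoint_le [FiniteDimensional ℝ X] (hΩ : IsOpen Ω) (hne : Ω.Nonempty)
    (hbd : Bornology.IsBounded Ω) (hA : IsDiffusionTensor Ω A) {m CD δ : ℝ} (hm : 0 < m)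
    (hcoer : ∀ G : L2Vec Ω, m * ‖G‖ ^ 2 ≤ diffusionForm A G G) (hCD : D.coercivityConst ≤ CD)
    (hδ : 0 ≤ δ) {α : ℝ} (hα : 0 < α) {f yd ud y p u uh : L2 Ω} {yD pD : X}
    (hKKT : IsKKT A α a b f yd ud y p u) (hDKKT : IsDiscreteKKT A D T α a b f yd ud yD pD uh)
    (hAI : ApproxInterp A D T c wT) (hRP : ReconProjBound D T c) (hinf : SchemeLinftyBound A D δ)
    (hmix : MixedRegionBound T a b u c) (hud : MemH2 ud) (hy2 : MemH2 y) (hp2 : MemH2 p)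
    (hyd : MemH1 yd) (hf : MemH1 f) :
    ‖wT p - D.recon pD‖ ≤ (1 + (CD ^ 2 / m) ^ 2 * α⁻¹) *
      (|c| * T.size ^ 2 * (normH1 (y - yd) + CD ^ 2 / m * (normH1 (f + u) + normH2 y))
        + CD ^ 2 / m * (‖(ud - α⁻¹ • p) - T.projL2 (ud - α⁻¹ • p)‖ * (|c| * T.size * (CD / m))
          + 4 * n * |c| * T.size ^ 2 * T.normBrokenW1Inf a b u * δ)
        + |c| * T.size ^ 2 * normH2 p) := by
  obtain ⟨hy0, hp0, huad, hyeq, hpeq, hVI⟩ := hKKT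
  obtain ⟨ha, hb, hab⟩ := bounds_of_mem_admissible hΩ hne huad
  have hfin : volume Ω ≠ ⊤ := hbd.measure_lt_top.ne
  replace hAI := hAI.abs
  replace hRP := hRP.abs
  have hc : 0 ≤ |c| := abs_nonneg c
  have hCD0 : 0 ≤ CD := D.coercivityConst_nonneg.trans hCD
  have hh := T.size_nonneg
  set q : L2 Ω := ud - α⁻¹ • p
  set s : ℝ := CD ^ 2 / m with hs
  have hs0 : 0 ≤ s := by positivity
  have huq := ae_eq_clip_of_variationalInequality hfin ha hb hab hα huad hVI
  obtain ⟨huH1, -⟩ := normH1_le_of_ae_eq_clip hΩ hbd ha hb hab (hud.1.sub_smul hp2.1 α⁻¹) huq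
  have hyydH1 : MemH1 (y - yd) := by simpa using hy2.1.sub_smul hyd 1
  obtain ⟨w, hw⟩ := exists_ae_eq_clip hfin ha hb hab (T.projL2 q)
  obtain ⟨y₁, hy₁⟩ := D.exists_isSchemeSolution hA (f + u)
  obtain ⟨p₁, hp₁⟩ := D.exists_isSchemeSolution hA (D.recon y₁ - yd)
  obtain ⟨y₂, hy₂⟩ := D.exists_isSchemeSolution hA (f + w)
  obtain ⟨p₂, hp₂⟩ := D.exists_isSchemeSolution hA (D.recon y₂ - yd)
  have hsub : ∀ {F G : L2 Ω} {v v' : X}, D.IsSchemeSolution A F v → D.IsSchemeSolution A G v' →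
      ‖D.recon v - D.recon v'‖ ≤ s * ‖F - G‖ := fun hv hv' => by
    have := ((hv.sub hA hv').norm_le hm hcoer hCD).2
    rwa [map_sub] at this
  -- the exact adjoint state and the discrete one for the exact control
  have hpsol : IsWeakSolution A (y - yd) p :=
    ⟨hp0, fun v hv => by rw [diffusionForm_comm hA]; exact hpeq v hv⟩
  have hA1 := norm_recon_adjoint_sub_le hA hm hcoer hCD hAI hc hy2 hp2 (hf.add huH1) hyydH1
    ⟨hy0, hyeq⟩ hpsol hy₁ hp₁
  set B₁ := |c| * T.size ^ 2 * (normH1 (y - yd) + s * (normH1 (f + u) + normH2 y))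
  -- the discrete adjoint states for the exact control and for `w`
  have hy12 : ‖D.recon y₁ - D.recon y₂‖ ≤ ‖q - T.projL2 q‖ * (|c| * T.size * (CD / m))
      + 4 * n * |c| * T.size ^ 2 * T.normBrokenW1Inf a b u * δ := by
    have hsol : D.IsSchemeSolution A (u - w) (y₁ - y₂) := by
      have := hy₁.sub hA hy₂
      rwa [add_sub_add_left_eq_sub] at this
    have h1 := norm_recon_sub_le_of_dual hA hm hcoer hCD hδ hinf hRP hc
      (fun z B hB hz => T.abs_inner_sub_projL2_le ha hb hab huq hw hmix hB hz) hsol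
    rw [map_sub] at h1
    refine h1.trans ?_
    gcongr
    exact norm_sub_le_of_ae_eq_clip ha hb hab huq hw
  set B₂ := ‖q - T.projL2 q‖ * (|c| * T.size * (CD / m))
      + 4 * n * |c| * T.size ^ 2 * T.normBrokenW1Inf a b u * δ
  have hA2 : ‖D.recon p₁ - D.recon p₂‖ ≤ s * B₂ := by
    have h1 := hsub hp₁ hp₂
    rw [sub_sub_sub_cancel_right] at h1
    exact h1.trans (mul_le_mul_of_nonneg_left hy12 hs0)
  -- the discrete adjoint states for `w` and for the discrete control
  have hA4 : ‖T.projL2 (p - wT p)‖ ≤ |c| * T.size ^ 2 * normH2 p := by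
    refine norm_le_of_eLpNorm_le (T.coeFn_projL2 _) ?_ (hAI.2.2 p hp2)
    have := normH2_nonneg p
    positivity
  set B₃ := |c| * T.size ^ 2 * normH2 p
  have h12 := norm_add_le (wT p - D.recon p₁) (D.recon p₁ - D.recon p₂)
  rw [sub_add_sub_cancel] at h12
  have hw1 := mul_norm_sub_le_of_discreteKKT (wT := wT) hA ha hb hab hα hDKKT hw hy₂ hp₂
  have hw2 : ‖w - uh‖ ≤ α⁻¹ * (B₁ + s * B₂ + B₃) := by
    rw [le_inv_mul_iff₀ hα]
    linarith
  have hA3 : ‖D.recon p₂ - D.recon pD‖ ≤ s * (s * (α⁻¹ * (B₁ + s * B₂ + B₃))) := by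
    have hpD' : D.IsSchemeSolution A (D.recon yD - yd) pD := fun v => by
      rw [D.form_comm hA]; exact hDKKT.2.2.1 v
    have h1 := hsub hp₂ hpD'
    have h2 := hsub hy₂ (G := f + uh) hDKKT.2.1
    rw [sub_sub_sub_cancel_right] at h1
    rw [add_sub_add_left_eq_sub] at h2
    exact h1.trans (mul_le_mul_of_nonneg_left
      (h2.trans (mul_le_mul_of_nonneg_left hw2 hs0)) hs0)
  have h13 := norm_add_le (wT p - D.recon p₂) (D.recon p₂ - D.recon pD)
  rw [sub_add_sub_cancel] at h13
  have e : (1 + s ^ 2 * α⁻¹) * (B₁ + s * B₂ + B₃)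
      = B₁ + s * B₂ + B₃ + s * (s * (α⁻¹ * (B₁ + s * B₂ + B₃))) := by ring
  rw [e]
  linarith [norm_nonneg (T.projL2 (p - wT p))]

end Estimate

/-- The `H¹` norms of the functions in the estimate of the adjoint state, in terms of a common
bound `N` of the data. -/
theorem normH1_le_of_data_le (hΩ : IsOpen Ω) (hbd : Bornology.IsBounded Ω) (ha : a ≠ ⊤)
    (hb : b ≠ ⊥) (hab : a ≤ b) {α N : ℝ} (hα : 0 < α) {f yd ud y p u : L2 Ω}
    (hu : ∀ᵐ x ∂(volume.restrict Ω), u x = clip a b ((ud - α⁻¹ • p : L2 Ω) x))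
    (hud : MemH1 ud) (hy : MemH1 y) (hp : MemH1 p) (hyd : MemH1 yd) (hf : MemH1 f)
    (hmN : minmod a b ≤ N) (hydN : normH1 yd ≤ N) (hudN : normH1 ud ≤ N) (hfN : normH1 f ≤ N)
    (hyN : normH1 y ≤ N) (hpN : normH1 p ≤ N) :
    normH1 (y - yd) ≤ 4 * ((1 + α⁻¹) * N) ∧
    normH1 (ud - α⁻¹ • p) ≤ 2 * ((1 + α⁻¹) * N) ∧
    normH1 (f + u) ≤
      (2 + 2 * (2 * (1 + Real.sqrt n) + Real.sqrt (volume.real Ω))) * ((1 + α⁻¹) * N) := by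
  have hα' : 0 < α⁻¹ := inv_pos.2 hα
  have hN0 : 0 ≤ N := (normH1_nonneg yd).trans hydN
  have hNβ : N ≤ (1 + α⁻¹) * N := le_mul_of_one_le_left hN0 (by linarith)
  have hq : normH1 (ud - α⁻¹ • p) ≤ 2 * ((1 + α⁻¹) * N) := by
    have h1 := normH1_sub_smul_le hΩ hud hp α⁻¹
    rw [abs_of_pos hα'] at h1
    have h3 := mul_le_mul_of_nonneg_left hpN hα'.le
    calc _ ≤ 2 * (normH1 ud + α⁻¹ * normH1 p) := h1
      _ ≤ 2 * (N + α⁻¹ * N) := by linarith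
      _ = _ := by ring
  obtain ⟨huH1, huN⟩ := normH1_le_of_ae_eq_clip hΩ hbd ha hb hab (hud.sub_smul hp α⁻¹) hu
  refine ⟨?_, hq, ?_⟩
  · have h1 := normH1_sub_smul_le hΩ hy hyd 1
    rw [one_smul, abs_one, one_mul] at h1
    linarith
  · have h1 := normH1_add_le hΩ hf huH1
    have h2 : normH1 u ≤ (1 + Real.sqrt n) * (2 * ((1 + α⁻¹) * N))
        + ((1 + α⁻¹) * N) * Real.sqrt (volume.real Ω) := by
      refine huN.trans ?_
      gcongr
      exact hmN.trans hNβ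
    calc _ ≤ 2 * (normH1 f + normH1 u) := h1
      _ ≤ 2 * ((1 + α⁻¹) * N + ((1 + Real.sqrt n) * (2 * ((1 + α⁻¹) * N))
          + ((1 + α⁻¹) * N) * Real.sqrt (volume.real Ω))) := by gcongr; exact hfN.trans hNβ
      _ = _ := by ring

/-- Collection of the constants in the estimate of the adjoint state: the powers of `α⁻¹` and `δ`
are separated from the other constants. -/
theorem error_le_of_data_le {α δ s r k₁ k₂ c h d N L Y F G Q y p : ℝ} (hα : 0 < α) (hδ : 0 < δ)
    (hs : 0 ≤ s) (hr : 0 ≤ r) (hk₂ : 0 ≤ k₂) (hc : 0 ≤ c) (hh : 0 ≤ h)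
    (hd : 0 ≤ d) (hN : 0 ≤ N) (hY : Y ≤ 4 * ((1 + α⁻¹) * N)) (hF : F ≤ k₁ * ((1 + α⁻¹) * N))
    (hG : G ≤ 2 * ((1 + α⁻¹) * N)) (hQ : Q ≤ k₂ * h * G) (hL : L ≤ N) (hy : y ≤ N) (hp : p ≤ N) :
    α⁻¹ * ((1 + s ^ 2 * α⁻¹) * (c * h ^ 2 * (Y + s * (F + y))
        + s * (Q * (c * h * r) + 4 * d * c * h ^ 2 * L * δ) + c * h ^ 2 * p)) ≤
      (1 + s ^ 2) * (c * (4 + s * |k₁| + s) + s * (k₂ * 2 * c * r + 4 * d * c) + c) *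
        (α⁻¹ * (1 + α⁻¹) * (1 + α⁻¹ + δ) * h ^ 2 * N) := by
  have hα' : 0 < α⁻¹ := inv_pos.2 hα
  set β := 1 + α⁻¹ with hβ
  set γ := β + δ with hγ
  have hβγ : β ≤ γ := by linarith
  have h1γ : 1 ≤ γ := by linarith
  have hδγ : δ ≤ γ := by linarith
  have hγ0 : 0 ≤ γ := by linarith
  have hNγ : N ≤ γ * N := le_mul_of_one_le_left hN h1γ
  have hβN : β * N ≤ γ * N := mul_le_mul_of_nonneg_right hβγ hN
  have hβN0 : 0 ≤ β * N := mul_nonneg (by linarith) hN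
  have hγN : 0 ≤ γ * N := mul_nonneg hγ0 hN
  have hY' : Y ≤ 4 * (γ * N) := by linarith
  have hF' : F ≤ |k₁| * (γ * N) := hF.trans
    ((mul_le_mul_of_nonneg_right (le_abs_self k₁) hβN0).trans (by gcongr))
  have hQ' : Q ≤ k₂ * h * (2 * (γ * N)) := hQ.trans (by gcongr; linarith)
  have hLδ : L * δ ≤ γ * N := by
    calc L * δ ≤ N * γ := by gcongr
      _ = γ * N := mul_comm _ _
  have hfac : 1 + s ^ 2 * α⁻¹ ≤ (1 + s ^ 2) * β := by rw [hβ]; nlinarith [sq_nonneg s]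
  have hin : c * h ^ 2 * (Y + s * (F + y))
        + s * (Q * (c * h * r) + 4 * d * c * h ^ 2 * L * δ) + c * h ^ 2 * p
      ≤ (c * (4 + s * |k₁| + s) + s * (k₂ * 2 * c * r + 4 * d * c) + c) * (h ^ 2 * (γ * N)) := by
    have e : 4 * d * c * h ^ 2 * L * δ = 4 * d * c * h ^ 2 * (L * δ) := by ring
    rw [e]
    calc _ ≤ c * h ^ 2 * (4 * (γ * N) + s * (|k₁| * (γ * N) + γ * N))
        + s * (k₂ * h * (2 * (γ * N)) * (c * h * r) + 4 * d * c * h ^ 2 * (γ * N))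
        + c * h ^ 2 * (γ * N) := by
          gcongr
          · exact hy.trans hNγ
          · exact hp.trans hNγ
      _ = _ := by ring
  have hβ0 : 0 ≤ β := by linarith
  have hM0 : 0 ≤ (c * (4 + s * |k₁| + s) + s * (k₂ * 2 * c * r + 4 * d * c) + c)
      * (h ^ 2 * (γ * N)) := by positivity
  calc _ ≤ α⁻¹ * (((1 + s ^ 2) * β) *
        ((c * (4 + s * |k₁| + s) + s * (k₂ * 2 * c * r + 4 * d * c) + c)
          * (h ^ 2 * (γ * N)))) := by
        refine mul_le_mul_of_nonneg_left ?_ hα'.le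
        exact (mul_le_mul_of_nonneg_left hin (by positivity)).trans
          (mul_le_mul_of_nonneg_right hfac hM0)
    _ = _ := by ring

end OptControl

/-- `C` depends only on `α` and `δ`; `K` depends only on `Ω`, `A`, the upper bound `CD` of the
coercivity constant, the constant `c` hidden in the assumptions, and `η`. -/
theorem theorem3p5 :
    ∃ C : ℝ → ℝ → ℝ,
      ∀ (n : ℕ), 2 ≤ n → n ≤ 3 →
      ∀ (Ω : Set (OptControl.E n)), IsOpen Ω → IsConnected Ω → Bornology.IsBounded Ω →
      ∀ (A : OptControl.E n → Matrix (Fin n) (Fin n) ℝ), OptControl.IsDiffusionTensor Ω A →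
      ∀ (CD c η : ℝ), ∃ K : ℝ,
      ∀ (α δ : ℝ), 0 < α → 0 < δ →
      ∀ (X : Type*) [AddCommGroup X] [Module ℝ X] [FiniteDimensional ℝ X]
        (D : OptControl.GradDisc Ω X) (T : OptControl.Mesh Ω)
        (a b : EReal) (f yd ud y p u : OptControl.L2 Ω)
        (yD pD : X) (uh : OptControl.L2 Ω) (wT : OptControl.L2 Ω → OptControl.L2 Ω),
        D.coercivityConst ≤ CD →
        T.IsRegular η →
        OptControl.IsKKT A α a b f yd ud y p u →
        OptControl.IsDiscreteKKT A D T α a b f yd ud yD pD uh →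
        OptControl.ApproxInterp A D T c wT →
        OptControl.ReconProjBound D T c →
        OptControl.SchemeLinftyBound A D δ →
        OptControl.MixedRegionBound T a b u c →
        OptControl.MemH2 ud → OptControl.MemH2 y → OptControl.MemH2 p →
        OptControl.MemH1 yd → OptControl.MemH1 f →
        eLpNorm (fun x => OptControl.postProcessed T α a b ud (wT p) x
            - OptControl.postProcessed T α a b ud (D.recon pD) x) 2 (volume.restrict Ω)
          ≤ ENNReal.ofReal (K * (C α δ * T.size ^ 2 *
              (T.normBrokenW1Inf a b u + OptControl.dataTerm a b yd ud f y p))) := by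
  refine ⟨fun α δ => α⁻¹ * (1 + α⁻¹) * (1 + α⁻¹ + δ), ?_⟩
  intro n hn _ Ω hΩ hconn hbd A hA CD c η
  obtain ⟨m, hm, hcoer⟩ := OptControl.exists_pos_mul_norm_sq_le_diffusionForm hA
  refine ⟨(1 + (CD ^ 2 / m) ^ 2) * (|c| * (4 + CD ^ 2 / m *
    |2 + 2 * (2 * (1 + Real.sqrt n) + Real.sqrt (volume.real Ω))| + CD ^ 2 / m)
    + CD ^ 2 / m * (Real.sqrt (9 * (4 * max η 1) ^ n) * 2 * |c| * (CD / m) + 4 * n * |c|)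
    + |c|), ?_⟩
  intro α δ hα hδ X _ _ _ D T a b f yd ud y p u yD pD uh wT hCD hη hKKT hDKKT hAI hRP hinf hmix
    hud hy2 hp2 hyd hf
  obtain ⟨ha, hb, hab⟩ := OptControl.bounds_of_mem_admissible hΩ hconn.nonempty hKKT.2.2.1
  have hCD0 : 0 ≤ CD := D.coercivityConst_nonneg.trans hCD
  have huq := OptControl.ae_eq_clip_of_variationalInequality hbd.measure_lt_top.ne ha hb hab hα
    hKKT.2.2.1 hKKT.2.2.2.2.2
  have hqP := T.norm_sub_projL2_le hΩ (by omega) hη (hud.1.sub_smul hp2.1 α⁻¹)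
  have herr := OptControl.norm_sub_recon_adjoint_le hΩ hconn.nonempty hbd hA hm hcoer hCD hδ.le hα
    hKKT hDKKT hAI hRP hinf hmix hud hy2 hp2 hyd hf
  have hL0 : 0 ≤ T.normBrokenW1Inf a b u := ENNReal.toReal_nonneg
  have hN : T.normBrokenW1Inf a b u + OptControl.dataTerm a b yd ud f y p
      = T.normBrokenW1Inf a b u + (OptControl.minmod a b + OptControl.normH1 yd
        + OptControl.normH2 ud + OptControl.normH1 f + OptControl.normH2 y
        + OptControl.normH2 p) := rfl
  set N := T.normBrokenW1Inf a b u + OptControl.dataTerm a b yd ud f y p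
  have hm0 := OptControl.minmod_nonneg a b
  have hn1 := OptControl.normH1_nonneg yd
  have hn2 := OptControl.normH2_nonneg ud
  have hn3 := OptControl.normH1_nonneg f
  have hn4 := OptControl.normH2_nonneg y
  have hn5 := OptControl.normH2_nonneg p
  have hyN : OptControl.normH2 y ≤ N := by linarith
  have hpN : OptControl.normH2 p ≤ N := by linarith
  have hudN : OptControl.normH2 ud ≤ N := by linarith
  obtain ⟨hY, hG, hF⟩ := OptControl.normH1_le_of_data_le (N := N) hΩ hbd ha hb hab hα huq hud.1
    hy2.1 hp2.1 hyd hf (by linarith) (by linarith)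
    ((OptControl.normH1_le_normH2 ud).trans hudN) (by linarith)
    ((OptControl.normH1_le_normH2 y).trans hyN) ((OptControl.normH1_le_normH2 p).trans hpN)
  refine (OptControl.eLpNorm_postProcessed_sub_le ha hb hab hα ud (wT p) (D.recon pD)).trans
    (ENNReal.ofReal_le_ofReal ?_)
  exact (mul_le_mul_of_nonneg_left herr (inv_pos.2 hα).le).trans
    (OptControl.error_le_of_data_le hα hδ (by positivity) (by positivity) (Real.sqrt_nonneg _)
      (abs_nonneg c) T.size_nonneg (Nat.cast_nonneg n) (by linarith) hY hF
      ((OptControl.norm_weakGrad_le_normH1 _).trans hG) hqP (by linarith) hyN hpN)
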